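/- **Setting.** Let $0=s_0<s_1<\cdots$, $d\ge1$, $A_j=(s_{j-1},s_j]$ with $|A_{j+d}|=|A_j|$ for all $j\ge1$, $\tau=\sum_{j=1}^d|A_j|$, $\mathfrak D_j=\bigcup_{k\ge0}A_{j+kd}$. Let $\lambda_1,\dots,\lambda_d\ge0$, $\lambda(u)=\sum_{j=1}^d\lambda_j 1_{\mathfrak D_j}(u)$, $\Lambda(t)=\int_0^t\lambda(u)\,du$, and let $N$ be a non-homogeneous Poisson process with $E\,N(t)=\Lambda(t)$ and arrival times $\Upsilon_1<\Upsilon_2<\cdots$. Let $Z_n^{(j)}$ ($n\ge1$, $1\le j\le d$) be independent random variables, independent of $N$, where $Z_n^{(j)}$ has law $F_j$ and $\int z^2F_j(dz)<\infty$. Put $Z_n=\sum_{j=1}^d Z_n^{(j)}1_{\{\Upsilon_n\in\mathfrak D_j\}}$ and, for some $\delta\in\mathbb R$, $S_t=\delta t+\sum_{n=1}^{N(t)}Z_n$, with quadratic variation $[S,S]_t=\sum_{0<u\le t}(\Delta S_u)^2$. Let $q\ge p\ge1$, $\alpha_0>0$, $\alpha_p\ne0$, $\alpha_{p+1}=\dots=\alpha_q=0$,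 $\beta_q\neq0$ be real parameters, let $\mathbf a=(\alpha_1,\dots,\alpha_q)'$, $\mathbf e=(0,\dots,0,1)'$, and let $B$ be the $q\times q$ companion matrix with ones above the diagonal, last row $(-\beta_q,\dots,-\beta_1)$ and zeros elsewhere. A *state process* is a process $(\mathbf Y_t)_{t\ge0}$ with càdlàg paths that solves $$d\mathbf Y_t=B\mathbf Y_{t^-}dt+\mathbf e(\alpha_0+\mathbf a'\mathbf Y_{t^-})\,d[S,S]_t,\qquad \mathbf Y_0\text{ independent of }(S_t)_{t\ge0}.$$ Its volatility is $V_0=\alpha_0+\mathbf a'\mathbf Y_0$, $V_t=\alpha_0+\mathbf a'\mathbf Y_{t^-}$ for $t>0$. Assume: (i) the eigenvalues of $B$ are distinct and have strictly negative real parts; let $\eta<0$ be the largest of these real parts; (ii) for some invertible complex matrix $P$ with $P^{-1}BP$ diagonal and some $r\in[1,\infty]$, for all $t\in[0,\tau]$ and $j=1,\dots,d$, $$\big(\Lambda(t+\tau)-\Lambda(t)\big)\int_{\mathbb R}\log\!\big(1+\|P^{-1}\mathbf e\mathbf a'P\|_r\,z^2\big)F_j(dz)<-\eta\tau,$$ where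 $\|\cdot\|_r$ is the matrix norm induced by the $L^r$-norm on $\mathbb C^q$. **Statement.** For each $t\in[0,\tau)$ there is a probability law on $\mathbb R^q$, that of a random vector $\mathbf U^{(t)}$, such that $\mathbf Y_{t+m\tau}$ converges in distribution to $\mathbf U^{(t)}$ as $m\to\infty$ for every state process $\mathbf Y$. If a state process $\mathbf Y$ satisfies $\mathbf Y_t\overset d=\mathbf U^{(t)}$ for all $t\in[0,\tau)$, then: (a) $\mathbf Y$ and $V$ are strictly periodically stationary with period $\tau$: for all $n$ and $t_1,\dots,t_n\ge0$, $$(\mathbf Y_{t_1},\dots,\mathbf Y_{t_n})\overset d=(\mathbf Y_{t_1+\tau},\dots,\mathbf Y_{t_n+\tau}),\qquad (V_{t_1},\dots,V_{t_n})\overset d=(V_{t_1+\tau},\dots,V_{t_n+\tau}).$$ (b) If moreover $V$ is almost surely non-negative, then the increments $G_t^{(l)}=\int_{(t,t+l]}\sqrt{V_u}\,dS_u$ have $\tau$-periodic means and covariances: for all $l>0$ and $t,h\ge0$, $$E\,G_t^{(l)}=E\,G_{t+\tau}^{(l)},\qquad \operatorname{cov}\big(G_t^{(l)},G_{t+h}^{(l)}\big)=\operatorname{cov}\big(G_{t+\tau}^{(l)},G_{t+h+\tau}^{(l)}\big),$$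 in the sense that $G_t^{(l)}$ (respectively $G_t^{(l)}G_{t+h}^{(l)}$) is integrable if and only if $G_{t+\tau}^{(l)}$ (respectively $G_{t+\tau}^{(l)}G_{t+h+\tau}^{(l)}$) is, and the equalities hold whenever these moments exist. -/

import Mathlib

open MeasureTheory ProbabilityTheory Filter Set
open scoped NNReal ENNReal Topology

noncomputable section

namespace SLDCogarch

/-! ### Path functionals -/

/-- Right-continuous with left limits. -/
def IsCadlag {E : Type*} [TopologicalSpace E] (x : ℝ≥0 → E) : Prop :=
  ∀ t, ContinuousWithinAt x (Ici t) t ∧ ∃ l, Tendsto x (𝓝[<] t) (𝓝 l)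

/-- The jump `Δx_u = x_u - x_{u-}`. -/
def jump (x : ℝ≥0 → ℝ) (u : ℝ≥0) : ℝ := x u - Function.leftLim x u

/-- The quadratic variation `[x,x]_t = ∑_{0 < u ≤ t} (Δx_u)²` of a path of finite variation
(such a path has no continuous martingale part); it is used only for paths that have finitely
many jumps on bounded intervals. -/
def quadVar (x : ℝ≥0 → ℝ) (t : ℝ≥0) : ℝ := ∑ᶠ u ∈ Ioc 0 t, jump x u ^ 2

/-- The path `x` frozen outside `[s, t]`. -/
def freeze (x : ℝ≥0 → ℝ) (s t u : ℝ≥0) : ℝ := x (max s (min u t))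

open Classical in
/-- The Lebesgue-Stieltjes integral `∫_{(s,t]} h_u dx_u`, for `s ≤ t` and a right-continuous
path `x` of bounded variation on `[s, t]`: the integral of `h` against the signed measure that
gives mass `x_b - x_a` to `(a, b] ⊆ (s, t]` and no mass to the complement of `(s, t]`. -/
def lsIntegral (h x : ℝ≥0 → ℝ) (s t : ℝ≥0) : ℝ :=
  if hx : BoundedVariationOn (freeze x s t) univ then ∫ᵛ u, h u ∂•hx.vectorMeasure else 0

/-! ### The driving semi-Lévy compound Poisson process -/

/-- The deterministic data of a semi-Lévy compound Poisson process. Indices are shifted by one: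
`lam j` and `F j` for `j = 0, …, d - 1` belong to the interval `A_{j+1} = (s_j, s_{j+1}]`. -/
structure SLCPData where
  d : ℕ
  d_pos : 0 < d
  s : ℕ → ℝ≥0
  s_zero : s 0 = 0
  s_strictMono : StrictMono s
  s_periodic : ∀ j, (s (j + d + 1) : ℝ) - s (j + d) = (s (j + 1) : ℝ) - s j
  lam : Fin d → ℝ≥0
  F : Fin d → Measure ℝ
  F_prob : ∀ j, IsProbabilityMeasure (F j)
  F_sq : ∀ j, Integrable (fun z : ℝ => z ^ 2) (F j)
  δ : ℝ

namespace SLCPData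

variable (D : SLCPData)

/-- The period: the total length of the first `d` intervals. -/
def τ : ℝ≥0 := ∑ j : Fin D.d, (D.s ((j : ℕ) + 1) - D.s (j : ℕ))

/-- `𝔇_j = ⋃_k A_{j+kd}`. -/
def 𝔇 (j : Fin D.d) : Set ℝ≥0 := ⋃ k : ℕ, Ioc (D.s ((j : ℕ) + k * D.d)) (D.s ((j : ℕ) + k * D.d + 1))

/-- The intensity function `λ(u) = ∑_j λ_j 1_{𝔇_j}(u)`. -/
def intensity (u : ℝ≥0) : ℝ := ∑ j, (D.𝔇 j).indicator (fun _ => (D.lam j : ℝ)) u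

/-- `Λ(t) = ∫_0^t λ(u) du`. -/
def Λ (t : ℝ≥0) : ℝ := ∫ u in (0 : ℝ)..t, D.intensity u.toNNReal

end SLCPData

/-- `N` is a non-homogeneous Poisson process with mean function `Λ`: a counting process
(nondecreasing right-continuous paths with jumps of size one, started at `0`) with independent
increments, `N_t - N_s` being Poisson distributed with mean `Λ(t) - Λ(s)`. -/
structure IsPoissonProcess {Ω : Type*} [MeasurableSpace Ω] (Λ : ℝ≥0 → ℝ) (N : ℝ≥0 → Ω → ℕ)
    (P : Measure Ω) : Prop where
  measurable : ∀ t, Measurable (N t)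
  zero : ∀ ω, N 0 ω = 0
  mono : ∀ ω, Monotone fun t => N t ω
  right_cont : ∀ ω t, ContinuousWithinAt (fun u => N u ω) (Ici t) t
  jump_le : ∀ ω t, N t ω ≤ Function.leftLim (fun u => N u ω) t + 1
  indep : HasIndepIncrements N P
  law : ∀ s t, s ≤ t → P.map (fun ω => N t ω - N s ω) = poissonMeasure (Λ t - Λ s).toNNReal

/-- The random ingredients of a semi-Lévy compound Poisson process: the Poisson process `N` and
the variables `Z_n^{(j)}` (`ζ n j`), all independent, `Z_n^{(j)}` with law `F_j`. -/
structure SLCP (D : SLCPData) {Ω : Type*} [MeasurableSpace Ω] (P : Measure Ω) where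
  N : ℝ≥0 → Ω → ℕ
  ζ : ℕ → Fin D.d → Ω → ℝ
  poisson : IsPoissonProcess D.Λ N P
  ζ_measurable : ∀ n j, Measurable (ζ n j)
  ζ_law : ∀ n j, P.map (ζ n j) = D.F j
  ζ_indep : iIndepFun (fun (i : ℕ × Fin D.d) => ζ i.1 i.2) P
  N_indep_ζ : IndepFun (fun ω t => N t ω) (fun ω (i : ℕ × Fin D.d) => ζ i.1 i.2 ω) P

namespace SLCP

variable {D : SLCPData} {Ω : Type*} [MeasurableSpace Ω] {P : Measure Ω} (X : SLCP D P)

/-- The arrival time `Υ_n` of the `n`-th jump of `N`. -/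
def arrival (n : ℕ) (ω : Ω) : ℝ≥0 := sInf {t | n ≤ X.N t ω}

/-- `Z_n = ∑_j Z_n^{(j)} 1{Υ_n ∈ 𝔇_j}`. -/
def Z (n : ℕ) (ω : Ω) : ℝ := ∑ j, (D.𝔇 j).indicator (fun _ => X.ζ n j ω) (X.arrival n ω)

/-- `S_t = δ t + ∑_{n=1}^{N(t)} Z_n`. -/
def S (t : ℝ≥0) (ω : Ω) : ℝ := D.δ * t + ∑ n ∈ Finset.Icc 1 (X.N t ω), X.Z n ω

end SLCP

/-! ### The COGARCH equations -/

/-- Parameters of a COGARCH(p, q) process, `q ≥ p ≥ 1`. Indices are shifted by one: `α i` is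
`α_{i+1}` and `β i` is `β_{i+1}`. -/
structure CogarchParams (p q : ℕ) where
  one_le_p : 1 ≤ p
  p_le_q : p ≤ q
  α₀ : ℝ
  α : Fin q → ℝ
  β : Fin q → ℝ
  α₀_pos : 0 < α₀
  α_p_ne : ∀ i : Fin q, (i : ℕ) + 1 = p → α i ≠ 0
  α_zero : ∀ i : Fin q, p < (i : ℕ) + 1 → α i = 0
  β_q_ne : ∀ i : Fin q, (i : ℕ) + 1 = q → β i ≠ 0

namespace CogarchParams

variable {p q : ℕ} (C : CogarchParams p q)

/-- The companion matrix: ones above the diagonal, last row `(-β_q, …, -β_1)`. -/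
def B : Matrix (Fin q) (Fin q) ℝ := fun i j =>
  if (i : ℕ) + 1 = q then - C.β j.rev else if (j : ℕ) = (i : ℕ) + 1 then 1 else 0

/-- The last unit vector. -/
def e (_ : CogarchParams p q) : Fin q → ℝ := fun i => if (i : ℕ) + 1 = q then 1 else 0

/-- `B` as a complex matrix. -/
def Bc : Matrix (Fin q) (Fin q) ℂ := C.B.map Complex.ofReal

/-- The matrix `e a'`, as a complex matrix. -/
def ea : Matrix (Fin q) (Fin q) ℂ := (Matrix.vecMulVec C.e C.α).map Complex.ofReal

/-- The largest real part of an eigenvalue of `B`. -/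
def η : ℝ := sSup (Complex.re '' spectrum ℂ C.Bc)

/-- The volatility path `V_t = α₀ + a' Y_{t-}` for `t > 0`, `V_0 = α₀ + a' Y_0`
(`Function.leftLim y 0 = y 0` on `ℝ≥0`). -/
def vol (y : ℝ≥0 → Fin q → ℝ) (t : ℝ≥0) : ℝ := C.α₀ + C.α ⬝ᵥ Function.leftLim y t

end CogarchParams

/-- The matrix norm `sup_{c ≠ 0} ‖A c‖_r / ‖c‖_r` induced by the `L^r`-norm on `ℂ^q`. -/
def lrNorm {q : ℕ} (r : ℝ≥0∞) (A : Matrix (Fin q) (Fin q) ℂ) : ℝ :=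
  ⨆ c : {c : Fin q → ℂ // c ≠ 0},
    ‖WithLp.toLp r (A.mulVec c.1)‖ / ‖WithLp.toLp r c.1‖

variable {D : SLCPData} {Ω : Type*} [MeasurableSpace Ω] {P : Measure Ω} {p q : ℕ}

/-- `Y` is a state process of the COGARCH equations driven by `S`: a stochastic process with
`Y_0` independent of `S` and almost surely càdlàg paths which solve
`dY_t = B Y_{t-} dt + e (α₀ + a' Y_{t-}) d[S,S]_t`. -/
structure IsStateProcess (C : CogarchParams p q) (X : SLCP D P) (Y : ℝ≥0 → Ω → Fin q → ℝ) :
    Prop where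
  measurable : ∀ t, Measurable (Y t)
  indep : IndepFun (Y 0) (fun ω t => X.S t ω) P
  cadlag : ∀ᵐ ω ∂P, IsCadlag fun t => Y t ω
  equation : ∀ᵐ ω ∂P, ∀ t, Y t ω = Y 0 ω
    + (∫ u in (0 : ℝ)..t, C.B.mulVec (Function.leftLim (fun v => Y v ω) u.toNNReal))
    + lsIntegral (C.vol fun v => Y v ω) (quadVar fun v => X.S v ω) 0 t • C.e

/-- The volatility process. -/
def V (C : CogarchParams p q) (Y : ℝ≥0 → Ω → Fin q → ℝ) (t : ℝ≥0) (ω : Ω) : ℝ :=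
  C.vol (fun v => Y v ω) t

/-- The increment `G_t^{(l)} = ∫_{(t, t+l]} √V_u dS_u`. -/
def G (C : CogarchParams p q) (X : SLCP D P) (Y : ℝ≥0 → Ω → Fin q → ℝ) (l t : ℝ≥0) (ω : Ω) : ℝ :=
  lsIntegral (fun u => √(V C Y u ω)) (fun u => X.S u ω) t (t + l)

/-- Strict periodic stationarity with period `τ`: all finite-dimensional distributions are
invariant under the shift by `τ`. -/
def StrictlyPeriodic {E : Type*} [MeasurableSpace E] (P : Measure Ω) (τ : ℝ≥0)
    (Y : ℝ≥0 → Ω → E) : Prop :=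
  ∀ (n : ℕ) (t : Fin n → ℝ≥0),
    IdentDistrib (fun ω i => Y (t i) ω) (fun ω i => Y (t i + τ) ω) P P

end SLDCogarch

end

/-!
The argument reduces the stochastic differential equation to a random contraction.

*Pathwise solution.* Along a path of the driving process that has finitely many jumps in bounded
time, a solution of the state equation is the limit of its Euler schemes (`EulerLimit.flow_eq`). The
Euler schemes are explicit functions of the initial state and of the increments of the driving path,
so the state at time `a + T` is `flow T` applied to the state at time `a` and to the increments of
the driving path after `a`, with one measurable functional `flow T` that serves every state process.
The class of processes driven in this way (`IsFlowProcess`) is closed under passing from `Y` to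
`Y (τ + ·)`, which is how statements about one period are propagated.

*Contraction.* Let `Q` diagonalize the companion matrix `B`. For the `L^r`-norm in the coordinates
`Q⁻¹ x`, an Euler step without jumps contracts with rate `η`, and a jump of size `z` expands by at
most `1 + c z ^ 2`, where `c = ‖Q⁻¹ e a' Q‖_r` (`CogarchParams.isContractionNorm`). In the limit,
the flow over one period is Lipschitz with constant `H = exp (η τ) * ∏ (1 + c Z_n ^ 2)`, the product
taken over the arrivals in the period (`EulerLimit.seminorm_sub_le`). The exponential formula
`SLCP.integral_prod_Z` for the Poisson process evaluates `E H ^ s`, and the logarithmic moment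
condition, which is the condition on the derivative of `log E H ^ s` at `s = 0`, makes it less than
one for some `s ∈ (0, 1]` (`exists_fractional_exponent`, `SLCP.isRandomContraction`).

*Invariant law.* A random map with `E H ^ s < 1` that moves the origin by a random distance with
finite moment of order `s` has exactly one attracting invariant law
(`IsRandomContraction.exists_invariant`): the iterates of the Dirac mass at `0` are tight, and
integrals of bounded `s`-Hölder test functions against iterates from different initial laws merge at
a geometric rate.

*Periodicity.* Since `Λ (τ + t) - Λ t` does not depend on `t`, the increments of the driving process
after one period are independent of the past (`SLCP.measure_stop_inter_shift`) and have the law of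
the driving process (`SLCP.map_shiftPath_pathLaw`). So the laws of `Y (m τ)` are the iterates of the
random contraction, and the limit law at phase `t` is the image of the invariant law under the flow
up to time `t`. If `Y 0` has the invariant law, then `Y 0` with the driving process and `Y τ` with
the driving process after `τ` are pairs with the same law (`identDistrib_shift`). The state, the
volatility and the price increments are the same functionals of these pairs: the state by the flow,
the volatility because the state almost surely does not jump at a given time (`ae_vol_eq`), and the
price increments because they are almost surely limits of Riemann sums (`ae_eq_priceIncrement`).
-/

noncomputable section

namespace SLDCogarch


/-! ### Counting paths -/

/-- A path of a counting process: nondecreasing, right-continuous, started at `0`, with jumps of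
size one. -/
structure IsCountingPath (ν : ℝ≥0 → ℕ) : Prop where
  zero : ν 0 = 0
  mono : Monotone ν
  right_cont : ∀ t, ContinuousWithinAt ν (Ici t) t
  jump_le : ∀ t, ν t ≤ Function.leftLim ν t + 1

/-- The time of the `n`-th jump of a path `ν` (and `0` if there is no such jump). -/
def arrivalTime (ν : ℝ≥0 → ℕ) (n : ℕ) : ℝ≥0 := sInf {t | n ≤ ν t}

/-- The path `t ↦ δ t + ∑_{n ≤ ν t} c n`. -/
def driftStep (ν : ℝ≥0 → ℕ) (δ : ℝ) (c : ℕ → ℝ) (t : ℝ≥0) : ℝ :=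
  δ * t + ∑ n ∈ Finset.Icc 1 (ν t), c n

namespace IsCountingPath

variable {ν : ℝ≥0 → ℕ} (hν : IsCountingPath ν)
include hν

lemma arrivalTime_le_iff {n : ℕ} {T : ℝ≥0} (hT : n ≤ ν T) {t : ℝ≥0} :
    arrivalTime ν n ≤ t ↔ n ≤ ν t := by
  refine ⟨fun h ↦ le_trans ?_ (hν.mono h), fun h ↦ csInf_le (OrderBot.bddBelow _) h⟩
  by_contra hcon
  set a := arrivalTime ν n with ha
  have h1 : ∀ᶠ u in 𝓝[≥] a, ν u = ν a := by
    have := hν.right_cont a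
    rw [ContinuousWithinAt, nhds_discrete, tendsto_pure] at this
    exact this
  obtain ⟨b, hab, hb⟩ := (mem_nhdsGE_iff_exists_Ico_subset).1 h1
  obtain ⟨t', ht', ht'b⟩ := exists_lt_of_csInf_lt (s := {t | n ≤ ν t}) ⟨T, hT⟩ hab
  have hat : a ≤ t' := csInf_le (OrderBot.bddBelow _) ht'
  have h2 : ν t' = ν a := hb ⟨hat, ht'b⟩
  exact hcon (h2 ▸ ht')

lemma lt_arrivalTime_iff {n : ℕ} {T : ℝ≥0} (hT : n ≤ ν T) {t : ℝ≥0} :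
    t < arrivalTime ν n ↔ ν t < n := by
  rw [← not_le, hν.arrivalTime_le_iff hT, not_le]

lemma arrivalTime_mem_Ioc_iff {n : ℕ} {T : ℝ≥0} (hT : n ≤ ν T) {s t : ℝ≥0} :
    arrivalTime ν n ∈ Ioc s t ↔ n ∈ Finset.Ioc (ν s) (ν t) := by
  rw [mem_Ioc, Finset.mem_Ioc, hν.lt_arrivalTime_iff hT, hν.arrivalTime_le_iff hT]

lemma arrivalTime_pos {n : ℕ} {T : ℝ≥0} (hT : n ≤ ν T) (hn : 0 < n) : 0 < arrivalTime ν n := by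
  rw [hν.lt_arrivalTime_iff hT, hν.zero]; exact hn

/-- Just before `u`, the path is constant, and one jump at most brings it to its value at `u`. -/
lemma exists_left_value {u : ℝ≥0} (hu : 0 < u) :
    ∃ k, (∀ᶠ v in 𝓝[<] u, ν v = k) ∧ (∀ v < u, ν v ≤ k) ∧ k ≤ ν u ∧ ν u ≤ k + 1 := by
  have h := hν.mono.tendsto_leftLim u
  rw [nhds_discrete, tendsto_pure] at h
  have : (𝓝[<] u).NeBot := nhdsLT_neBot_of_exists_lt ⟨0, hu⟩
  exact ⟨_, h, fun v hv ↦ hν.mono.le_leftLim hv, hν.mono.leftLim_le le_rfl, hν.jump_le u⟩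

/-- The jump number `n` is the only one that happens at its arrival time. -/
lemma left_value_arrivalTime {n k : ℕ} {T : ℝ≥0} (hT : n ≤ ν T) (hn : 0 < n)
    (hk : ∀ᶠ v in 𝓝[<] (arrivalTime ν n), ν v = k) (hk1 : ν (arrivalTime ν n) ≤ k + 1) :
    ν (arrivalTime ν n) = n ∧ k + 1 = n := by
  have hpos := hν.arrivalTime_pos hT hn
  have : (𝓝[<] (arrivalTime ν n)).NeBot := nhdsLT_neBot_of_exists_lt ⟨0, hpos⟩
  obtain ⟨v, hv, hvlt⟩ := (hk.and self_mem_nhdsWithin).exists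
  have h1 : k < n := hv ▸ (hν.lt_arrivalTime_iff hT).1 hvlt
  have h2 : n ≤ ν (arrivalTime ν n) := (hν.arrivalTime_le_iff hT).1 le_rfl
  omega

lemma apply_arrivalTime {n : ℕ} {T : ℝ≥0} (hT : n ≤ ν T) : ν (arrivalTime ν n) = n := by
  rcases Nat.eq_zero_or_pos n with rfl | hn
  · have : arrivalTime ν 0 ≤ 0 := (hν.arrivalTime_le_iff hT).2 (Nat.zero_le _)
    rw [le_antisymm this (zero_le), hν.zero]
  · obtain ⟨k, hk, -, -, hk1⟩ := hν.exists_left_value (hν.arrivalTime_pos hT hn)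
    exact (hν.left_value_arrivalTime hT hn hk hk1).1

lemma arrivalTime_lt {n : ℕ} {T : ℝ≥0} (hT : n + 1 ≤ ν T) :
    arrivalTime ν n < arrivalTime ν (n + 1) := by
  rw [hν.lt_arrivalTime_iff hT, hν.apply_arrivalTime (Nat.le_of_succ_le hT)]
  exact Nat.lt_succ_self n

lemma injOn_arrivalTime (T : ℝ≥0) : InjOn (arrivalTime ν) {n | n ≤ ν T} := by
  intro n hn m hm h
  rw [← hν.apply_arrivalTime hn, h, hν.apply_arrivalTime hm]

/-- On a bounded interval, short time intervals contain at most one jump. -/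
lemma exists_mesh (T : ℝ≥0) :
    ∃ ε : ℝ≥0, 0 < ε ∧ ∀ s t, t ≤ T → t < s + ε → ν t ≤ ν s + 1 := by
  have h1 : ∀ n ∈ Finset.range (ν T), ∀ᶠ ε in 𝓝[>] (0 : ℝ≥0),
      arrivalTime ν n + ε < arrivalTime ν (n + 1) := by
    intro n hn
    have hlt := hν.arrivalTime_lt (Finset.mem_range.1 hn)
    have : Tendsto (fun ε : ℝ≥0 ↦ arrivalTime ν n + ε) (𝓝[>] 0) (𝓝 (arrivalTime ν n + 0)) :=
      (tendsto_const_nhds.add tendsto_id).mono_left nhdsWithin_le_nhds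
    rw [add_zero] at this
    exact this.eventually_lt_const hlt
  rw [← Filter.eventually_all_finset] at h1
  obtain ⟨ε, hε, hε0⟩ := (h1.and self_mem_nhdsWithin).exists
  refine ⟨ε, hε0, fun s t hT hts ↦ ?_⟩
  by_contra hcon
  have hn : ν s + 1 + 1 ≤ ν t := by omega
  have hnT : ν s + 1 + 1 ≤ ν T := hn.trans (hν.mono hT)
  have h2 : s < arrivalTime ν (ν s + 1) :=
    (hν.lt_arrivalTime_iff (Nat.le_of_succ_le hnT)).2 (Nat.lt_succ_self _)
  have h3 : arrivalTime ν (ν s + 1 + 1) ≤ t := (hν.arrivalTime_le_iff hnT).2 hn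
  have h4 := hε (ν s + 1) (Finset.mem_range.2 hnT)
  exact absurd (h4.trans_le h3) (not_lt.2 (hts.le.trans (by gcongr)))

omit hν in
lemma _root_.SLDCogarch.sum_Icc_one_sub {c : ℕ → ℝ} {k l : ℕ} (h : k ≤ l) :
    ∑ n ∈ Finset.Icc 1 l, c n - ∑ n ∈ Finset.Icc 1 k, c n = ∑ n ∈ Finset.Ioc k l, c n := by
  have h0 : ∀ m : ℕ, Finset.Icc 1 m = Finset.Ioc 0 m := fun m ↦ by
    ext; simp [Finset.mem_Icc, Finset.mem_Ioc, Nat.lt_iff_add_one_le]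
  rw [h0, h0, ← Finset.sum_Ioc_consecutive c (Nat.zero_le k) h, add_sub_cancel_left]

lemma driftStep_sub {δ : ℝ} {c : ℕ → ℝ} {s t : ℝ≥0} (hst : s ≤ t) :
    driftStep ν δ c t - driftStep ν δ c s
      = δ * (t - s) + ∑ n ∈ Finset.Ioc (ν s) (ν t), c n := by
  rw [← sum_Icc_one_sub (hν.mono hst)]
  simp only [driftStep]; ring

omit hν in
lemma jump_driftStep {δ : ℝ} {c : ℕ → ℝ} {u : ℝ≥0} (hu : 0 < u) {k : ℕ}
    (hk : ∀ᶠ v in 𝓝[<] u, ν v = k) (hku : k ≤ ν u) :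
    jump (driftStep ν δ c) u = ∑ n ∈ Finset.Ioc k (ν u), c n := by
  have : (𝓝[<] u).NeBot := nhdsLT_neBot_of_exists_lt ⟨0, hu⟩
  have h1 : Tendsto (driftStep ν δ c) (𝓝[<] u) (𝓝 (δ * u + ∑ n ∈ Finset.Icc 1 k, c n)) := by
    have h2 : Tendsto (fun v : ℝ≥0 ↦ δ * (v : ℝ) + ∑ n ∈ Finset.Icc 1 k, c n) (𝓝[<] u)
        (𝓝 (δ * u + ∑ n ∈ Finset.Icc 1 k, c n)) :=
      Tendsto.mono_left (Continuous.tendsto (by fun_prop) u) nhdsWithin_le_nhds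
    refine h2.congr' ?_
    filter_upwards [hk] with v hv
    simp [driftStep, hv]
  rw [jump, leftLim_eq_of_tendsto h1, ← sum_Icc_one_sub hku, driftStep]
  ring

lemma quadVar_driftStep (δ : ℝ) (c : ℕ → ℝ) (t : ℝ≥0) :
    quadVar (driftStep ν δ c) t = ∑ n ∈ Finset.Icc 1 (ν t), c n ^ 2 := by
  classical
  have hinj : InjOn (arrivalTime ν) (Finset.Icc 1 (ν t) : Finset ℕ) :=
    (hν.injOn_arrivalTime t).mono fun n hn ↦ (Finset.mem_Icc.1 hn).2
  have h1 : ∀ n ∈ Finset.Icc 1 (ν t), jump (driftStep ν δ c) (arrivalTime ν n) = c n := by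
    intro n hn
    obtain ⟨hn1, hnt⟩ := Finset.mem_Icc.1 hn
    have hpos := hν.arrivalTime_pos hnt hn1
    obtain ⟨k, hk, -, hku, hk1⟩ := hν.exists_left_value hpos
    obtain ⟨h2, h3⟩ := hν.left_value_arrivalTime hnt hn1 hk hk1
    rw [jump_driftStep hpos hk hku, h2, ← h3]
    simp
  have h2 : ∑ᶠ u ∈ Ioc 0 t, jump (driftStep ν δ c) u ^ 2
      = ∑ᶠ u ∈ (((Finset.Icc 1 (ν t)).image (arrivalTime ν) : Finset ℝ≥0) : Set ℝ≥0),
          jump (driftStep ν δ c) u ^ 2 := by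
    refine finsum_mem_inter_support_eq _ _ _ ?_
    ext u
    simp only [mem_inter_iff, Function.mem_support, Finset.coe_image, Finset.coe_Icc, mem_image,
      and_congr_left_iff]
    intro hju
    constructor
    · rintro ⟨hu0, hut⟩
      obtain ⟨k, hk, hkv, hku, hk1⟩ := hν.exists_left_value hu0
      rw [jump_driftStep hu0 hk hku] at hju
      have hku' : ν u = k + 1 := by
        rcases hku.lt_or_eq with h | h
        · omega
        · simp [h] at hju
      have hkt : k + 1 ≤ ν t := hku' ▸ hν.mono hut
      refine ⟨k + 1, ⟨by simp, hkt⟩, le_antisymm ?_ (le_of_not_gt fun hlt ↦ ?_)⟩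
      · rw [hν.arrivalTime_le_iff hkt, hku']
      · have h3 := hkv _ hlt
        rw [hν.apply_arrivalTime hkt] at h3
        omega
    · rintro ⟨n, ⟨hn1, hnt⟩, rfl⟩
      exact ⟨hν.arrivalTime_pos hnt hn1, (hν.arrivalTime_le_iff hnt).2 hnt⟩
  rw [quadVar, h2, finsum_mem_coe_finset, Finset.sum_image hinj]
  exact Finset.sum_congr rfl fun n hn ↦ by rw [h1 n hn]

end IsCountingPath

/-! ### Lebesgue-Stieltjes integrals -/

section LSIntegral

variable {x : ℝ≥0 → ℝ} {s t : ℝ≥0} {μ₁ μ₂ : Measure ℝ≥0}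

lemma boundedVariationOn_freeze (hst : s ≤ t) (h₁ : μ₁ (Ioc s t) ≠ ∞) (h₂ : μ₂ (Ioc s t) ≠ ∞)
    (hx : ∀ u v, s ≤ u → u ≤ v → v ≤ t → x v - x u = μ₁.real (Ioc u v) - μ₂.real (Ioc u v)) :
    BoundedVariationOn (freeze x s t) univ := by
  let clamp : ℝ≥0 → ℝ≥0 := fun u ↦ max s (min u t)
  have hcl_s : ∀ u, s ≤ clamp u := fun u ↦ le_max_left _ _
  have hcl_t : ∀ u, clamp u ≤ t := fun u ↦ max_le hst (min_le_right _ _)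
  have hcl : Monotone clamp := fun u v huv ↦ max_le_max le_rfl (min_le_min huv le_rfl)
  let Gt : ℝ≥0 → ℝ := fun u ↦ μ₁.real (Ioc s (clamp u)) + μ₂.real (Ioc s (clamp u))
  have hfin : ∀ {μ : Measure ℝ≥0}, μ (Ioc s t) ≠ ∞ → ∀ a b, s ≤ a → b ≤ t → μ (Ioc a b) ≠ ∞ :=
    fun {μ} hμ a b ha hb ↦ ne_top_of_le_ne_top hμ (measure_mono (Ioc_subset_Ioc ha hb))
  have hadd : ∀ {μ : Measure ℝ≥0}, μ (Ioc s t) ≠ ∞ → ∀ u v, u ≤ v →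
      μ.real (Ioc s (clamp v)) - μ.real (Ioc s (clamp u)) = μ.real (Ioc (clamp u) (clamp v)) := by
    intro μ hμ u v huv
    have hu := hfin hμ s (clamp u) le_rfl (hcl_t u)
    have hv := hfin hμ (clamp u) (clamp v) (hcl_s u) (hcl_t v)
    rw [← Ioc_union_Ioc_eq_Ioc (hcl_s u) (hcl huv), measureReal_union
      (Ioc_disjoint_Ioc_of_le le_rfl) measurableSet_Ioc hu hv]
    ring
  have hGmono : Monotone Gt := by
    intro u v huv
    have h1 := hadd h₁ u v huv
    have h2 := hadd h₂ u v huv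
    have h3 : 0 ≤ μ₁.real (Ioc (clamp u) (clamp v)) := measureReal_nonneg
    have h4 : 0 ≤ μ₂.real (Ioc (clamp u) (clamp v)) := measureReal_nonneg
    simp only [Gt]; linarith
  have hGbv : BoundedVariationOn Gt univ := by
    refine (hGmono.monotoneOn univ).boundedVariationOn
      (C := μ₁.real (Ioc s t) + μ₂.real (Ioc s t)) fun u _ ↦ ?_
    rw [abs_of_nonneg (add_nonneg measureReal_nonneg measureReal_nonneg)]
    exact add_le_add (measureReal_mono (Ioc_subset_Ioc_right (hcl_t u)) h₁)
      (measureReal_mono (Ioc_subset_Ioc_right (hcl_t u)) h₂)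
  refine ne_top_of_le_ne_top hGbv (iSup_le fun p ↦ le_trans ?_ (le_iSup _ p))
  refine Finset.sum_le_sum fun i _ ↦ ?_
  have hle : p.2.1 i ≤ p.2.1 (i + 1) := p.2.2.1 (Nat.le_succ i)
  rw [edist_dist, edist_dist]
  refine ENNReal.ofReal_le_ofReal ?_
  have h0 := hx (clamp (p.2.1 i)) (clamp (p.2.1 (i + 1))) (hcl_s _) (hcl hle) (hcl_t _)
  have h1 := hadd h₁ _ _ hle
  have h2 := hadd h₂ _ _ hle
  have h3 : 0 ≤ μ₁.real (Ioc (clamp (p.2.1 i)) (clamp (p.2.1 (i + 1)))) := measureReal_nonneg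
  have h4 : 0 ≤ μ₂.real (Ioc (clamp (p.2.1 i)) (clamp (p.2.1 (i + 1)))) := measureReal_nonneg
  change |x (clamp (p.2.1 (i + 1))) - x (clamp (p.2.1 i))| ≤ |Gt _ - Gt _|
  have h5 : Gt (p.2.1 (i + 1)) - Gt (p.2.1 i)
      = μ₁.real (Ioc (clamp (p.2.1 i)) (clamp (p.2.1 (i + 1))))
        + μ₂.real (Ioc (clamp (p.2.1 i)) (clamp (p.2.1 (i + 1)))) := by
    simp only [Gt]; linarith
  rw [h0, h5, abs_of_nonneg (add_nonneg h3 h4), abs_le]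
  constructor <;> linarith

/-- If the increments of a right-continuous path on `[s, t]` are those of a difference `μ₁ - μ₂` of
finite measures, then the Lebesgue-Stieltjes integral is the difference of the integrals. -/
lemma lsIntegral_eq_integral_sub (hst : s ≤ t) (hxr : ∀ u, ContinuousWithinAt x (Ici u) u)
    (h₁ : μ₁ (Ioc s t) ≠ ∞) (h₂ : μ₂ (Ioc s t) ≠ ∞)
    (hx : ∀ u v, s ≤ u → u ≤ v → v ≤ t → x v - x u = μ₁.real (Ioc u v) - μ₂.real (Ioc u v))
    {g : ℝ≥0 → ℝ} (hg₁ : IntegrableOn g (Ioc s t) μ₁) (hg₂ : IntegrableOn g (Ioc s t) μ₂) :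
    lsIntegral g x s t = ∫ u in Ioc s t, g u ∂μ₁ - ∫ u in Ioc s t, g u ∂μ₂ := by
  have hbv := boundedVariationOn_freeze hst h₁ h₂ hx
  have f₁ : IsFiniteMeasure (μ₁.restrict (Ioc s t)) := ⟨by simpa using h₁.lt_top⟩
  have f₂ : IsFiniteMeasure (μ₂.restrict (Ioc s t)) := ⟨by simpa using h₂.lt_top⟩
  have hright : ∀ u, Function.rightLim (freeze x s t) u = freeze x s t u := by
    intro u
    refine ContinuousWithinAt.rightLim_eq ?_
    refine ContinuousWithinAt.comp (t := Ici (max s (min u t))) (hxr _)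
      (Continuous.continuousWithinAt (by fun_prop)) fun v hv ↦ ?_
    exact max_le_max le_rfl (min_le_min (show u ≤ v from hv) le_rfl)
  have key : hbv.vectorMeasure
      = (μ₁.restrict (Ioc s t)).toSignedMeasure - (μ₂.restrict (Ioc s t)).toSignedMeasure := by
    have hreal : ∀ (μ : Measure ℝ≥0) [IsFiniteMeasure (μ.restrict (Ioc s t))] (A : Set ℝ≥0),
        MeasurableSet A → (μ.restrict (Ioc s t)).toSignedMeasure A = μ.real (A ∩ Ioc s t) := by
      intro μ _ A hA
      rw [Measure.toSignedMeasure_apply_measurable hA, measureReal_restrict_apply hA]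
    refine VectorMeasure.ext_of_generateFrom {S : Set ℝ≥0 | ∃ l u, l ≤ u ∧ Ioc l u = S} ?_ ?_ ?_ ?_
    · rintro _ ⟨a, b, hab, rfl⟩
      rw [hbv.vectorMeasure_Ioc hab, hright, hright, sub_apply,
        hreal _ _ measurableSet_Ioc, hreal _ _ measurableSet_Ioc]
      have hI : Ioc a b ∩ Ioc s t = Ioc (max s (min a t)) (max s (min b t)) := by
        ext u; simp only [mem_inter_iff, mem_Ioc, le_max_iff, max_lt_iff, min_lt_iff, le_min_iff]
        constructor
        · rintro ⟨⟨h1, h2⟩, h3, h4⟩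
          exact ⟨⟨h3, Or.inl h1⟩, Or.inr ⟨h2, h4⟩⟩
        · rintro ⟨⟨h1, h2⟩, h3⟩
          have h4 := h3.resolve_left (not_le.2 h1)
          exact ⟨⟨h2.resolve_right (not_lt.2 h4.2), h4.1⟩, h1, h4.2⟩
      rw [hI]
      exact hx _ _ (le_max_left _ _) (max_le_max le_rfl (min_le_min hab le_rfl))
        (max_le hst (min_le_right _ _))
    · rw [← borel_eq_generateFrom_Ioc_le]; exact BorelSpace.measurable_eq
    · rintro _ ⟨a, b, hab, rfl⟩ _ ⟨a', b', hab', rfl⟩ hne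
      rw [Ioc_inter_Ioc] at hne ⊢
      exact ⟨_, _, le_of_lt (by simpa using hne), rfl⟩
    · have htop : limUnder atTop (freeze x s t) = x t := by
        refine Tendsto.limUnder_eq (tendsto_const_nhds.congr' ?_)
        filter_upwards [eventually_ge_atTop t] with u hu
        simp [freeze, hu, hst]
      have hbot : limUnder atBot (freeze x s t) = x s := by
        refine Tendsto.limUnder_eq (tendsto_const_nhds.congr' ?_)
        filter_upwards [eventually_le_atBot s] with u hu
        simp [freeze, min_le_of_left_le hu]
      rw [hbv.vectorMeasure_univ, htop, hbot, sub_apply,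
        hreal _ _ MeasurableSet.univ, hreal _ _ MeasurableSet.univ, univ_inter]
      exact hx s t le_rfl hst le_rfl
  have hflip : (ContinuousLinearMap.lsmul ℝ ℝ : ℝ →L[ℝ] ℝ →L[ℝ] ℝ)
      = (ContinuousLinearMap.lsmul ℝ ℝ : ℝ →L[ℝ] ℝ →L[ℝ] ℝ).flip := by
    ext; simp
  rw [lsIntegral, dif_pos hbv, key, VectorMeasure.integral_sub_vectorMeasure]
  · rw [hflip, VectorMeasure.integral_toSignedMeasure, VectorMeasure.integral_toSignedMeasure]
  · rw [VectorMeasure.Integrable, Measure.variation_toSignedMeasure]; exact hg₁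
  · rw [VectorMeasure.Integrable, Measure.variation_toSignedMeasure]; exact hg₂

end LSIntegral

/-- Lebesgue measure on `ℝ≥0`. -/
def lebNN : Measure ℝ≥0 := (volume.restrict (Ioi (0 : ℝ))).map Real.toNNReal

lemma preimage_toNNReal_Ioc (s t : ℝ≥0) :
    Real.toNNReal ⁻¹' (Ioc s t) ∩ Ioi 0 = Ioc (s : ℝ) t := by
  ext u
  simp only [mem_inter_iff, mem_preimage, mem_Ioc, mem_Ioi]
  constructor
  · rintro ⟨⟨h1, h2⟩, h0⟩
    rw [Real.toNNReal_le_iff_le_coe] at h2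
    exact ⟨by rwa [Real.lt_toNNReal_iff_coe_lt] at h1, h2⟩
  · rintro ⟨h1, h2⟩
    exact ⟨⟨Real.lt_toNNReal_iff_coe_lt.2 h1, Real.toNNReal_le_iff_le_coe.2 h2⟩,
      lt_of_le_of_lt s.2 h1⟩

lemma lebNN_Ioc (s t : ℝ≥0) : lebNN (Ioc s t) = ENNReal.ofReal (t - s) := by
  rw [lebNN, Measure.map_apply measurable_real_toNNReal measurableSet_Ioc,
    Measure.restrict_apply (measurable_real_toNNReal measurableSet_Ioc), preimage_toNNReal_Ioc,
    Real.volume_Ioc]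

lemma lebNN_real_Ioc {s t : ℝ≥0} (hst : s ≤ t) : lebNN.real (Ioc s t) = t - s := by
  rw [measureReal_def, lebNN_Ioc, ENNReal.toReal_ofReal (sub_nonneg.2 (NNReal.coe_le_coe.2 hst))]

lemma intervalIntegral_toNNReal {E : Type*} [NormedAddCommGroup E] [NormedSpace ℝ E]
    {g : ℝ≥0 → E} (hg : StronglyMeasurable g) {s t : ℝ≥0} (hst : s ≤ t) :
    ∫ u in (s : ℝ)..t, g u.toNNReal = ∫ u in Ioc s t, g u ∂lebNN := by
  rw [intervalIntegral.integral_of_le (NNReal.coe_le_coe.2 hst), lebNN,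
    setIntegral_map measurableSet_Ioc hg.aestronglyMeasurable
      measurable_real_toNNReal.aemeasurable,
    Measure.restrict_restrict (measurable_real_toNNReal measurableSet_Ioc), preimage_toNNReal_Ioc]

/-! ### Càdlàg paths on grids -/

/-- The largest point of the grid `a, a + h, a + 2h, …` that is strictly smaller than `u`
(for `a < u` and `0 < h`). -/
def gridLeft (a h u : ℝ≥0) : ℝ≥0 := a + (⌈(u - a) / h⌉₊ - 1 : ℕ) * h

lemma gridLeft_eq {a h u : ℝ≥0} {i : ℕ} (hu : u ∈ Ioc (a + i * h) (a + (i + 1 : ℕ) * h)) :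
    gridLeft a h u = a + i * h := by
  obtain ⟨h1, h2⟩ := hu
  have hh : 0 < h := by
    rcases eq_zero_or_pos h with rfl | hh
    · simp at h1 h2; exact absurd h1 (not_lt.2 h2)
    · exact hh
  have h3 : ⌈(u - a) / h⌉₊ = i + 1 := by
    rw [Nat.ceil_eq_iff (Nat.succ_ne_zero i), lt_div_iff₀ hh, div_le_iff₀ hh]
    constructor
    · simpa using lt_tsub_iff_left.2 h1
    · exact tsub_le_iff_left.2 h2
  rw [gridLeft, h3, Nat.add_sub_cancel]

lemma gridLeft_lt {a h u : ℝ≥0} (hu : a < u) : gridLeft a h u < u := by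
  rcases eq_zero_or_pos h with rfl | hh
  · simpa [gridLeft] using hu
  have hpos : 0 < (u - a) / h := div_pos (tsub_pos_of_lt hu) hh
  have h1 : ((⌈(u - a) / h⌉₊ - 1 : ℕ) : ℝ≥0) < (u - a) / h := by
    have h2 : ⌈(u - a) / h⌉₊ - 1 < ⌈(u - a) / h⌉₊ := Nat.sub_lt (Nat.ceil_pos.2 hpos) one_pos
    exact Nat.lt_ceil.1 h2
  rw [lt_div_iff₀ hh, lt_tsub_iff_left] at h1
  exact h1

lemma le_gridLeft_add {a h u : ℝ≥0} (hh : 0 < h) : u ≤ gridLeft a h u + h := by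
  have h1 : (u - a) / h ≤ ((⌈(u - a) / h⌉₊ - 1 : ℕ) : ℝ≥0) + 1 := by
    refine (Nat.le_ceil _).trans ?_
    have : ⌈(u - a) / h⌉₊ ≤ (⌈(u - a) / h⌉₊ - 1) + 1 := by omega
    exact_mod_cast this
  rw [div_le_iff₀ hh, tsub_le_iff_left] at h1
  refine h1.trans (le_of_eq ?_)
  rw [gridLeft]; ring

/-- The mesh of the grid that divides `[0, T]` into `n + 1` equal parts. -/
def mesh (T : ℝ≥0) (n : ℕ) : ℝ≥0 := T / (n + 1 : ℕ)

lemma succ_mul_mesh (T : ℝ≥0) (n : ℕ) : ((n + 1 : ℕ) : ℝ≥0) * mesh T n = T := by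
  rw [mesh, mul_div_cancel₀]
  exact_mod_cast Nat.succ_ne_zero n

lemma mesh_pos {T : ℝ≥0} (hT : 0 < T) (n : ℕ) : 0 < mesh T n :=
  div_pos hT (by exact_mod_cast Nat.succ_pos n)

lemma tendsto_mesh (T : ℝ≥0) : Tendsto (mesh T) atTop (𝓝 0) := by
  have h : Tendsto (fun n : ℕ ↦ T / ((n : ℕ) : ℝ≥0)) atTop (𝓝 0) :=
    tendsto_const_div_atTop_nhds_zero_nat T
  exact h.comp (tendsto_add_atTop_nat 1)

lemma mul_mesh_le {T : ℝ≥0} {n i : ℕ} (hi : i ≤ n + 1) : (i : ℝ≥0) * mesh T n ≤ T := by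
  conv_rhs => rw [← succ_mul_mesh T n]
  gcongr

lemma grid_mono (a h : ℝ≥0) : Monotone fun i : ℕ ↦ a + (i : ℝ≥0) * h := fun i j hij ↦ by
  dsimp only; gcongr

lemma tendsto_gridLeft {a u T : ℝ≥0} (hu : a < u) (hT : 0 < T) :
    Tendsto (fun n ↦ gridLeft a (mesh T n) u) atTop (𝓝[<] u) := by
  refine tendsto_nhdsWithin_iff.2 ⟨?_, Eventually.of_forall fun n ↦ gridLeft_lt hu⟩
  have h1 : Tendsto (fun n ↦ u - mesh T n) atTop (𝓝 (u - 0)) :=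
    tendsto_const_nhds.sub (tendsto_mesh T)
  rw [tsub_zero] at h1
  refine tendsto_of_tendsto_of_tendsto_of_le_of_le h1 tendsto_const_nhds (fun n ↦ ?_)
    fun n ↦ (gridLeft_lt hu).le
  exact tsub_le_iff_right.2 (le_gridLeft_add (mesh_pos hT n))

lemma measurable_comp_gridLeft {E : Type*} [MeasurableSpace E] (y : ℝ≥0 → E) (a h : ℝ≥0) :
    Measurable fun u ↦ y (gridLeft a h u) := by
  have h1 : Measurable fun u : ℝ≥0 ↦ ⌈(u - a) / h⌉₊ :=
    Nat.measurable_ceil.comp ((measurable_id.sub_const a).div_const h)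
  exact (measurable_from_nat (f := fun k : ℕ ↦ y (a + (k - 1 : ℕ) * h))).comp h1

section Cadlag

variable {E : Type*} [NormedAddCommGroup E] {y : ℝ≥0 → E}

lemma IsCadlag.tendsto_leftLim (hy : IsCadlag y) (t : ℝ≥0) :
    Tendsto y (𝓝[<] t) (𝓝 (Function.leftLim y t)) :=
  tendsto_leftLim_of_tendsto (hy t).2

lemma leftLim_zero (y : ℝ≥0 → E) : Function.leftLim y 0 = y 0 :=
  leftLim_eq_of_isBot (fun _ ↦ zero_le)

lemma IsCadlag.exists_bound (hy : IsCadlag y) (T : ℝ≥0) : ∃ K, ∀ u ≤ T, ‖y u‖ ≤ K := by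
  have h := (isCompact_Icc (a := (0 : ℝ≥0)) (b := T)).induction_on
    (p := fun A ↦ ∃ K, ∀ u ∈ A, ‖y u‖ ≤ K) ⟨0, by simp⟩
    (fun A A' hA ⟨K, hK⟩ ↦ ⟨K, fun u hu ↦ hK u (hA hu)⟩)
    (fun A A' ⟨K, hK⟩ ⟨K', hK'⟩ ↦ ⟨max K K', fun u hu ↦ hu.elim
      (fun h ↦ (hK u h).trans (le_max_left _ _)) fun h ↦ (hK' u h).trans (le_max_right _ _)⟩) ?_
  · obtain ⟨K, hK⟩ := h
    exact ⟨K, fun u hu ↦ hK u ⟨zero_le, hu⟩⟩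
  · intro t _
    have h1 : ∀ᶠ u in 𝓝[≥] t, ‖y u‖ ≤ ‖y t‖ + 1 :=
      ((hy t).1.norm).eventually_le_const (lt_add_one _)
    have h2 : ∀ᶠ u in 𝓝[<] t, ‖y u‖ ≤ ‖Function.leftLim y t‖ + 1 :=
      ((hy.tendsto_leftLim t).norm).eventually_le_const (lt_add_one _)
    refine ⟨{u | ‖y u‖ ≤ max (‖y t‖ + 1) (‖Function.leftLim y t‖ + 1)},
      mem_nhdsWithin_of_mem_nhds ?_, _, fun u hu ↦ hu⟩
    rw [← nhdsLT_sup_nhdsGE t]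
    exact ⟨h2.mono fun u hu ↦ hu.trans (le_max_right _ _),
      h1.mono fun u hu ↦ hu.trans (le_max_left _ _)⟩

lemma IsCadlag.norm_leftLim_le (hy : IsCadlag y) {T : ℝ≥0} {K : ℝ} (hK : ∀ u ≤ T, ‖y u‖ ≤ K)
    {u : ℝ≥0} (hu : u ≤ T) : ‖Function.leftLim y u‖ ≤ K := by
  rcases eq_zero_or_pos u with rfl | hpos
  · rw [leftLim_zero]; exact hK 0 hu
  have : (𝓝[<] u).NeBot := nhdsLT_neBot_of_exists_lt ⟨0, hpos⟩
  refine le_of_tendsto (hy.tendsto_leftLim u).norm ?_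
  filter_upwards [self_mem_nhdsWithin] with v hv
  exact hK v ((le_of_lt hv).trans hu)

lemma IsCadlag.tendsto_gridLeft (hy : IsCadlag y) {a u T : ℝ≥0} (hu : a < u) (hT : 0 < T) :
    Tendsto (fun n ↦ y (gridLeft a (mesh T n) u)) atTop (𝓝 (Function.leftLim y u)) :=
  (hy.tendsto_leftLim u).comp (SLDCogarch.tendsto_gridLeft hu hT)

lemma IsCadlag.measurable_leftLim [MeasurableSpace E] [BorelSpace E] (hy : IsCadlag y) :
    Measurable (Function.leftLim y) := by
  refine measurable_of_tendsto_metrizable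
    (f := fun n u ↦ y (gridLeft 0 (mesh 1 n) u)) (fun n ↦ measurable_comp_gridLeft y 0 _) ?_
  rw [tendsto_pi_nhds]
  intro u
  rcases eq_zero_or_pos u with rfl | hpos
  · simp [gridLeft, leftLim_zero]
  · exact hy.tendsto_gridLeft hpos one_pos

end Cadlag

lemma sum_setIntegral_grid {E : Type*} [NormedAddCommGroup E] [NormedSpace ℝ E]
    {μ : Measure ℝ≥0} {p : ℕ → ℝ≥0} (hp : Monotone p) {g : ℝ≥0 → E} (k : ℕ)
    (hg : IntegrableOn g (Ioc (p 0) (p k)) μ) :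
    ∑ i ∈ Finset.range k, ∫ u in Ioc (p i) (p (i + 1)), g u ∂μ
      = ∫ u in Ioc (p 0) (p k), g u ∂μ := by
  induction k with
  | zero => simp
  | succ k ih =>
    have h1 := hp (Nat.zero_le k)
    have h2 := hp (Nat.le_succ k)
    rw [Finset.sum_range_succ, ih (hg.mono_set (Ioc_subset_Ioc_right h2)),
      ← Ioc_union_Ioc_eq_Ioc h1 h2, setIntegral_union (Ioc_disjoint_Ioc_of_le le_rfl)
        measurableSet_Ioc (hg.mono_set (Ioc_subset_Ioc_right h2))
        (hg.mono_set (Ioc_subset_Ioc_left h1))]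

section Riemann

variable {E : Type*} [NormedAddCommGroup E] [ProperSpace E] {y : ℝ≥0 → E} {μ : Measure ℝ≥0}
  {a T : ℝ≥0}

lemma IsCadlag.integrableOn_comp_leftLim [MeasurableSpace E] [BorelSpace E]
    (hy : IsCadlag y) (hμ : μ (Ioc a (a + T)) ≠ ∞)
    {g : E → ℝ} (hg : Continuous g) :
    IntegrableOn (fun u ↦ g (Function.leftLim y u)) (Ioc a (a + T)) μ := by
  obtain ⟨K, hK⟩ := hy.exists_bound (a + T)
  obtain ⟨C, hC⟩ := (isCompact_closedBall (0 : E) K).exists_bound_of_continuousOn hg.continuousOn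
  refine Measure.integrableOn_of_bounded (M := C) hμ
    (hg.measurable.comp hy.measurable_leftLim).aestronglyMeasurable ?_
  refine (ae_restrict_iff' measurableSet_Ioc).2 (Eventually.of_forall fun u hu ↦ hC _ ?_)
  simpa using hy.norm_leftLim_le hK hu.2

/-- Riemann-Stieltjes sums with respect to a measure, with the integrand sampled at the left
end-points of the cells, converge to the integral of the left limits. -/
lemma IsCadlag.tendsto_sum_grid (hy : IsCadlag y) (hμ : μ (Ioc a (a + T)) ≠ ∞)
    {g : E → ℝ} (hg : Continuous g) :
    Tendsto (fun n ↦ ∑ i ∈ Finset.range (n + 1), g (y (a + i * mesh T n))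
        * μ.real (Ioc (a + i * mesh T n) (a + (i + 1 : ℕ) * mesh T n))) atTop
      (𝓝 (∫ u in Ioc a (a + T), g (Function.leftLim y u) ∂μ)) := by
  rcases eq_zero_or_pos T with rfl | hT
  · simp [mesh]
  obtain ⟨K, hK⟩ := hy.exists_bound (a + T)
  obtain ⟨C, hC⟩ := (isCompact_closedBall (0 : E) K).exists_bound_of_continuousOn hg.continuousOn
  have hbd : ∀ n, ∀ u ∈ Ioc a (a + T), ‖g (y (gridLeft a (mesh T n) u))‖ ≤ C := fun n u hu ↦
    hC _ (by simpa using hK _ ((gridLeft_lt hu.1).le.trans hu.2))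
  have hfin : IsFiniteMeasure (μ.restrict (Ioc a (a + T))) := ⟨by simpa using hμ.lt_top⟩
  have hmeas : ∀ n, Measurable fun u ↦ g (y (gridLeft a (mesh T n) u)) := fun n ↦
    measurable_comp_gridLeft (fun v ↦ g (y v)) a (mesh T n)
  have hint : ∀ n, IntegrableOn (fun u ↦ g (y (gridLeft a (mesh T n) u))) (Ioc a (a + T)) μ :=
    fun n ↦ Measure.integrableOn_of_bounded (M := C) hμ (hmeas n).aestronglyMeasurable
      ((ae_restrict_iff' measurableSet_Ioc).2 (Eventually.of_forall fun u hu ↦ hbd n u hu))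
  have heq : ∀ n, ∑ i ∈ Finset.range (n + 1), g (y (a + i * mesh T n))
        * μ.real (Ioc (a + i * mesh T n) (a + (i + 1 : ℕ) * mesh T n))
      = ∫ u in Ioc a (a + T), g (y (gridLeft a (mesh T n) u)) ∂μ := by
    intro n
    have h1 := sum_setIntegral_grid (μ := μ) (grid_mono a (mesh T n))
      (g := fun u ↦ g (y (gridLeft a (mesh T n) u))) (n + 1)
      (by simpa only [Nat.cast_zero, zero_mul, add_zero, succ_mul_mesh] using hint n)
    simp only [Nat.cast_zero, zero_mul, add_zero, succ_mul_mesh] at h1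
    rw [← h1]
    refine Finset.sum_congr rfl fun i _ ↦ ?_
    rw [setIntegral_congr_fun measurableSet_Ioc
      (g := fun _ ↦ g (y (a + i * mesh T n))) fun u hu ↦ by simp only [gridLeft_eq hu]]
    simp [mul_comm]
  simp_rw [heq]
  refine tendsto_integral_of_dominated_convergence (fun _ ↦ C)
    (fun n ↦ (hmeas n).aestronglyMeasurable) (integrable_const C) (fun n ↦ ?_) ?_
  · exact (ae_restrict_iff' measurableSet_Ioc).2 (Eventually.of_forall fun u hu ↦ hbd n u hu)
  · refine (ae_restrict_iff' measurableSet_Ioc).2 (Eventually.of_forall fun u hu ↦ ?_)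
    exact (hg.tendsto _).comp (hy.tendsto_gridLeft hu.1 hT)

end Riemann

/-! ### The Euler scheme -/

section Euler

variable {E : Type*} [NormedAddCommGroup E] [NormedSpace ℝ E]

/-- The Euler scheme for `dy = L y dt + (c₀ + A y) e dQ` with time step `h`, where `w i` stands for
the increment of `Q` in the `i`-th step. -/
def eulerScheme (L : E →L[ℝ] E) (A : E →L[ℝ] ℝ) (c₀ : ℝ) (e : E) (h : ℝ) (w : ℕ → ℝ) (x₀ : E) :
    ℕ → E
  | 0 => x₀
  | i + 1 => eulerScheme L A c₀ e h w x₀ i + h • L (eulerScheme L A c₀ e h w x₀ i)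
      + (w i * (c₀ + A (eulerScheme L A c₀ e h w x₀ i))) • e

lemma eulerScheme_congr {L : E →L[ℝ] E} {A : E →L[ℝ] ℝ} {c₀ : ℝ} {e : E} {h : ℝ} {w w' : ℕ → ℝ}
    {x₀ : E} {k : ℕ} (hw : ∀ i < k, w i = w' i) :
    eulerScheme L A c₀ e h w x₀ k = eulerScheme L A c₀ e h w' x₀ k := by
  induction k with
  | zero => rfl
  | succ k ih =>
    simp only [eulerScheme, ih fun i hi ↦ hw i (hi.trans (Nat.lt_succ_self k)),
      hw k (Nat.lt_succ_self k)]

/-- Discrete Grönwall inequality over a grid, with rates and source terms given by measures. -/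
lemma discrete_gronwall {μ : Measure ℝ≥0} {p : ℕ → ℝ≥0} (hp : Monotone p) {φ : ℝ≥0 → ℝ}
    (hφ0 : ∀ u, 0 ≤ φ u) {k : ℕ} (hμ : μ (Ioc (p 0) (p k)) ≠ ∞)
    (hφ : IntegrableOn φ (Ioc (p 0) (p k)) μ) {K : ℝ} (hK : 0 ≤ K) {d : ℕ → ℝ} (h0 : d 0 = 0)
    (hd : ∀ i < k, d (i + 1) ≤ (1 + K * μ.real (Ioc (p i) (p (i + 1)))) * d i
      + K * ∫ u in Ioc (p i) (p (i + 1)), φ u ∂μ) (hd0 : ∀ i, 0 ≤ d i) :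
    d k ≤ Real.exp (K * μ.real (Ioc (p 0) (p k))) * (K * ∫ u in Ioc (p 0) (p k), φ u ∂μ) := by
  induction k with
  | zero => simp [h0]
  | succ k ih =>
    have h1 := hp (Nat.zero_le k)
    have h2 := hp (Nat.le_succ k)
    have hs1 : Ioc (p 0) (p k) ⊆ Ioc (p 0) (p (k + 1)) := Ioc_subset_Ioc_right h2
    have hs2 : Ioc (p k) (p (k + 1)) ⊆ Ioc (p 0) (p (k + 1)) := Ioc_subset_Ioc_left h1
    have hμ1 := ne_top_of_le_ne_top hμ (measure_mono hs1)
    have hμ2 := ne_top_of_le_ne_top hμ (measure_mono hs2)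
    have hφ1 := hφ.mono_set hs1
    have hφ2 := hφ.mono_set hs2
    have ih' := ih hμ1 hφ1 (fun i hi ↦ hd i (hi.trans (Nat.lt_succ_self k)))
    have h3 : μ.real (Ioc (p 0) (p (k + 1)))
        = μ.real (Ioc (p 0) (p k)) + μ.real (Ioc (p k) (p (k + 1))) := by
      rw [← Ioc_union_Ioc_eq_Ioc h1 h2, measureReal_union (Ioc_disjoint_Ioc_of_le le_rfl)
        measurableSet_Ioc hμ1 hμ2]
    have h4 : ∫ u in Ioc (p 0) (p (k + 1)), φ u ∂μ
        = ∫ u in Ioc (p 0) (p k), φ u ∂μ + ∫ u in Ioc (p k) (p (k + 1)), φ u ∂μ := by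
      rw [← Ioc_union_Ioc_eq_Ioc h1 h2, setIntegral_union (Ioc_disjoint_Ioc_of_le le_rfl)
        measurableSet_Ioc hφ1 hφ2]
    set m := μ.real (Ioc (p k) (p (k + 1))) with hm
    have hm0 : 0 ≤ m := measureReal_nonneg
    have hI1 : 0 ≤ ∫ u in Ioc (p 0) (p k), φ u ∂μ := integral_nonneg fun u ↦ hφ0 u
    have hI2 : 0 ≤ ∫ u in Ioc (p k) (p (k + 1)), φ u ∂μ := integral_nonneg fun u ↦ hφ0 u
    have hm' : 0 ≤ μ.real (Ioc (p 0) (p k)) := measureReal_nonneg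
    rw [h3, h4, mul_add K, Real.exp_add, mul_add K]
    have h5 : 1 + K * m ≤ Real.exp (K * m) := by
      have := Real.add_one_le_exp (K * m); linarith
    have h6 : 1 ≤ Real.exp (K * μ.real (Ioc (p 0) (p k))) * Real.exp (K * m) := by
      rw [← Real.exp_add]; exact Real.one_le_exp (by positivity)
    calc d (k + 1) ≤ (1 + K * m) * d k + K * ∫ u in Ioc (p k) (p (k + 1)), φ u ∂μ :=
          hd k (Nat.lt_succ_self k)
      _ ≤ Real.exp (K * m) * (Real.exp (K * μ.real (Ioc (p 0) (p k)))
            * (K * ∫ u in Ioc (p 0) (p k), φ u ∂μ)) + K * ∫ u in Ioc (p k) (p (k + 1)), φ u ∂μ := by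
          gcongr
          exact hd0 k
      _ ≤ Real.exp (K * m) * (Real.exp (K * μ.real (Ioc (p 0) (p k)))
            * (K * ∫ u in Ioc (p 0) (p k), φ u ∂μ))
            + (Real.exp (K * μ.real (Ioc (p 0) (p k))) * Real.exp (K * m))
              * (K * ∫ u in Ioc (p k) (p (k + 1)), φ u ∂μ) := by
          exact add_le_add le_rfl (le_mul_of_one_le_left (by positivity) h6)
      _ = _ := by ring

variable [FiniteDimensional ℝ E]

/-- A càdlàg solution of `dy = L y dt + (c₀ + A y) e dQ` on `[a, a + T]` is the limit of its Euler
schemes. -/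
theorem tendsto_eulerScheme {L : E →L[ℝ] E} {A : E →L[ℝ] ℝ} {c₀ : ℝ} {e : E} {y : ℝ≥0 → E}
    (hy : IsCadlag y) {ν : Measure ℝ≥0} {a T : ℝ≥0} (hν : ν (Ioc a (a + T)) ≠ ∞)
    (heq : ∀ s t, a ≤ s → s ≤ t → t ≤ a + T → y t - y s
      = ∫ u in Ioc s t, L (Function.leftLim y u) ∂lebNN
        + (∫ u in Ioc s t, (c₀ + A (Function.leftLim y u)) ∂ν) • e) :
    Tendsto (fun n ↦ eulerScheme L A c₀ e (mesh T n)
      (fun i ↦ ν.real (Ioc (a + i * mesh T n) (a + (i + 1 : ℕ) * mesh T n))) (y a) (n + 1)) atTop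
      (𝓝 (y (a + T))) := by
  have : ProperSpace E := FiniteDimensional.proper ℝ E
  borelize E
  have : SecondCountableTopology E := secondCountable_of_proper
  rcases eq_zero_or_pos T with rfl | hT
  · have h0 : ∀ n : ℕ, mesh 0 n = 0 := fun n ↦ by simp [mesh]
    have h1 : ∀ (w : ℕ → ℝ) (hw : ∀ i, w i = 0) (k : ℕ),
        eulerScheme L A c₀ e 0 w (y a) k = y a := by
      intro w hw k
      induction k with
      | zero => rfl
      | succ k ih => simp [eulerScheme, ih, hw]
    simp only [h0, NNReal.coe_zero]
    refine tendsto_const_nhds.congr fun n ↦ ?_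
    rw [h1 _ (fun i ↦ by simp), add_zero]
  set m : Measure ℝ≥0 := lebNN + ν with hm
  have hlebfin : ∀ s t : ℝ≥0, lebNN (Ioc s t) ≠ ∞ := fun s t ↦ by rw [lebNN_Ioc]; simp
  have hmfin : m (Ioc a (a + T)) ≠ ∞ := by
    rw [hm, Measure.add_apply]; exact ENNReal.add_ne_top.2 ⟨hlebfin _ _, hν⟩
  obtain ⟨C, hC⟩ := hy.exists_bound (a + T)
  set K : ℝ := ‖L‖ + ‖A‖ * ‖e‖ with hK
  have hK0 : 0 ≤ K := by positivity
  let φ : ℕ → ℝ≥0 → ℝ := fun n u ↦ ‖Function.leftLim y u - y (gridLeft a (mesh T n) u)‖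
  have hφ0 : ∀ n u, 0 ≤ φ n u := fun n u ↦ norm_nonneg _
  have hφmeas : ∀ n, Measurable (φ n) := fun n ↦
    (hy.measurable_leftLim.sub (measurable_comp_gridLeft y a _)).norm
  have hφbd : ∀ n, ∀ u ∈ Ioc a (a + T), ‖φ n u‖ ≤ C + C := by
    intro n u hu
    rw [Real.norm_of_nonneg (hφ0 n u)]
    exact (norm_sub_le _ _).trans (add_le_add (hy.norm_leftLim_le hC hu.2)
      (hC _ ((gridLeft_lt hu.1).le.trans hu.2)))
  have hφint : ∀ n, IntegrableOn (φ n) (Ioc a (a + T)) m := fun n ↦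
    Measure.integrableOn_of_bounded (M := C + C) hmfin (hφmeas n).aestronglyMeasurable
      ((ae_restrict_iff' measurableSet_Ioc).2 (Eventually.of_forall fun u hu ↦ hφbd n u hu))
  have hφlim : Tendsto (fun n ↦ ∫ u in Ioc a (a + T), φ n u ∂m) atTop (𝓝 0) := by
    have hfin : IsFiniteMeasure (m.restrict (Ioc a (a + T))) := ⟨by simpa using hmfin.lt_top⟩
    have := tendsto_integral_of_dominated_convergence (μ := m.restrict (Ioc a (a + T)))
      (f := fun _ ↦ (0 : ℝ)) (fun _ ↦ C + C)
      (fun n ↦ (hφmeas n).aestronglyMeasurable) (integrable_const _)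
      (fun n ↦ (ae_restrict_iff' measurableSet_Ioc).2
        (Eventually.of_forall fun u hu ↦ hφbd n u hu))
      ((ae_restrict_iff' measurableSet_Ioc).2 (Eventually.of_forall fun u hu ↦ ?_))
    · simpa using this
    · have h1 := (tendsto_const_nhds (x := Function.leftLim y u)).sub (hy.tendsto_gridLeft hu.1 hT)
      simpa [φ] using h1.norm
  have hLmeas : Measurable fun u ↦ L (Function.leftLim y u) :=
    L.continuous.measurable.comp hy.measurable_leftLim
  have hAmeas : Measurable fun u ↦ c₀ + A (Function.leftLim y u) :=
    (A.continuous.measurable.comp hy.measurable_leftLim).const_add c₀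
  have hbound : ∀ n, ‖y (a + T) - eulerScheme L A c₀ e (mesh T n)
      (fun i ↦ ν.real (Ioc (a + i * mesh T n) (a + (i + 1 : ℕ) * mesh T n))) (y a) (n + 1)‖
      ≤ Real.exp (K * m.real (Ioc a (a + T))) * (K * ∫ u in Ioc a (a + T), φ n u ∂m) := by
    intro n
    set h := mesh T n with hh
    set p : ℕ → ℝ≥0 := fun i ↦ a + (i : ℝ≥0) * h with hp
    have hpmono : Monotone p := grid_mono a h
    have hp0 : p 0 = a := by simp [hp]
    have hpn : p (n + 1) = a + T := by simp only [hp, hh, succ_mul_mesh]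
    set x := eulerScheme L A c₀ e h
      (fun i ↦ ν.real (Ioc (a + i * h) (a + (i + 1 : ℕ) * h))) (y a) with hx
    have key := discrete_gronwall (μ := m) hpmono (hφ0 n) (k := n + 1) (K := K)
      (d := fun i ↦ ‖y (p i) - x i‖) (by rwa [hp0, hpn]) (by rw [hp0, hpn]; exact hφint n) hK0
      (by simp [hp0, hx, eulerScheme]) ?_ (fun i ↦ norm_nonneg _)
    · simpa only [hp0, hpn] using key
    intro i hi
    have hpa : a ≤ p i := hp0 ▸ hpmono (Nat.zero_le i)
    have hpi : p i ≤ p (i + 1) := hpmono (Nat.le_succ i)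
    have hpT : p (i + 1) ≤ a + T := hpn ▸ hpmono hi
    have hsub : Ioc (p i) (p (i + 1)) ⊆ Ioc a (a + T) := Ioc_subset_Ioc hpa hpT
    have hν' : ν (Ioc (p i) (p (i + 1))) ≠ ∞ := ne_top_of_le_ne_top hν (measure_mono hsub)
    have hbdl : ∀ u ∈ Ioc (p i) (p (i + 1)), ‖Function.leftLim y u‖ ≤ C := fun u hu ↦
      hy.norm_leftLim_le hC (hsub hu).2
    have hLint : IntegrableOn (fun u ↦ L (Function.leftLim y u)) (Ioc (p i) (p (i + 1))) lebNN :=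
      Measure.integrableOn_of_bounded (M := ‖L‖ * C) (hlebfin _ _) hLmeas.aestronglyMeasurable
        ((ae_restrict_iff' measurableSet_Ioc).2 (Eventually.of_forall fun u hu ↦
          (L.le_opNorm _).trans (by gcongr; exact hbdl u hu)))
    have hAint : IntegrableOn (fun u ↦ c₀ + A (Function.leftLim y u)) (Ioc (p i) (p (i + 1))) ν :=
      Measure.integrableOn_of_bounded (M := ‖c₀‖ + ‖A‖ * C) hν' hAmeas.aestronglyMeasurable
        ((ae_restrict_iff' measurableSet_Ioc).2 (Eventually.of_forall fun u hu ↦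
          (norm_add_le _ _).trans (add_le_add_right ((A.le_opNorm _).trans
            (mul_le_mul_of_nonneg_left (hbdl u hu) (norm_nonneg A))) _)))
    have hφm := (hφint n).mono_set hsub
    have hφleb : IntegrableOn (φ n) (Ioc (p i) (p (i + 1))) lebNN :=
      hφm.mono_measure (Measure.le_add_right le_rfl)
    have hφν : IntegrableOn (φ n) (Ioc (p i) (p (i + 1))) ν :=
      hφm.mono_measure (Measure.le_add_left le_rfl)
    have hφu : ∀ u ∈ Ioc (p i) (p (i + 1)), φ n u = ‖Function.leftLim y u - y (p i)‖ :=
      fun u hu ↦ by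
        have : gridLeft a (mesh T n) u = p i := gridLeft_eq hu
        simp only [φ, this]
    have hmass : lebNN.real (Ioc (p i) (p (i + 1))) = h := by
      rw [lebNN_real_Ioc hpi]; simp only [hp]; push_cast; ring
    -- local error of the drift
    have e1 : ‖∫ u in Ioc (p i) (p (i + 1)), L (Function.leftLim y u) ∂lebNN - (h : ℝ) • L (y (p i))‖
        ≤ ‖L‖ * ∫ u in Ioc (p i) (p (i + 1)), φ n u ∂lebNN := by
      have h1 : (h : ℝ) • L (y (p i)) = ∫ u in Ioc (p i) (p (i + 1)), L (y (p i)) ∂lebNN := by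
        rw [setIntegral_const, hmass]
      rw [h1, ← integral_sub hLint (integrableOn_const (hlebfin _ _)), ← integral_const_mul]
      refine norm_integral_le_of_norm_le (hφleb.const_mul _) ?_
      refine (ae_restrict_iff' measurableSet_Ioc).2 (Eventually.of_forall fun u hu ↦ ?_)
      rw [← map_sub, hφu u hu]
      exact L.le_opNorm _
    -- local error of the jump part
    set q := ν.real (Ioc (p i) (p (i + 1))) with hq
    have hq0 : 0 ≤ q := measureReal_nonneg
    have e2 : |∫ u in Ioc (p i) (p (i + 1)), (c₀ + A (Function.leftLim y u)) ∂ν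
          - q * (c₀ + A (y (p i)))| ≤ ‖A‖ * ∫ u in Ioc (p i) (p (i + 1)), φ n u ∂ν := by
      have h1 : q * (c₀ + A (y (p i))) = ∫ u in Ioc (p i) (p (i + 1)), (c₀ + A (y (p i))) ∂ν := by
        rw [setIntegral_const, smul_eq_mul]
      rw [h1, ← integral_sub hAint (integrableOn_const hν'), ← integral_const_mul,
        ← Real.norm_eq_abs]
      refine norm_integral_le_of_norm_le (hφν.const_mul _) ?_
      refine (ae_restrict_iff' measurableSet_Ioc).2 (Eventually.of_forall fun u hu ↦ ?_)
      rw [add_sub_add_left_eq_sub, ← map_sub, hφu u hu]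
      exact A.le_opNorm _
    have hIleb : 0 ≤ ∫ u in Ioc (p i) (p (i + 1)), φ n u ∂lebNN := integral_nonneg (hφ0 n)
    have hIν : 0 ≤ ∫ u in Ioc (p i) (p (i + 1)), φ n u ∂ν := integral_nonneg (hφ0 n)
    have e3 : ∫ u in Ioc (p i) (p (i + 1)), φ n u ∂m
        = ∫ u in Ioc (p i) (p (i + 1)), φ n u ∂lebNN + ∫ u in Ioc (p i) (p (i + 1)), φ n u ∂ν := by
      rw [hm, Measure.restrict_add, integral_add_measure hφleb hφν]
    have e4 : m.real (Ioc (p i) (p (i + 1))) = h + q := by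
      rw [hm, measureReal_add_apply (hlebfin _ _) hν', hmass]
    have hstep : x (i + 1) = x i + (h : ℝ) • L (x i) + (q * (c₀ + A (x i))) • e := rfl
    have hy1 := heq (p i) (p (i + 1)) hpa hpi hpT
    have hdec : y (p (i + 1)) - x (i + 1) = (y (p i) - x i)
        + (∫ u in Ioc (p i) (p (i + 1)), L (Function.leftLim y u) ∂lebNN - (h : ℝ) • L (y (p i)))
        + (h : ℝ) • L (y (p i) - x i)
        + (∫ u in Ioc (p i) (p (i + 1)), (c₀ + A (Function.leftLim y u)) ∂ν
          - q * (c₀ + A (y (p i)))) • e + (q * A (y (p i) - x i)) • e := by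
      rw [hstep, ← sub_add_cancel (y (p (i + 1))) (y (p i)), hy1, map_sub, map_sub]
      module
    have hh0 : (0 : ℝ) ≤ h := h.2
    have hd0 := norm_nonneg (y (p i) - x i)
    change ‖y (p (i + 1)) - x (i + 1)‖ ≤ (1 + K * m.real (Ioc (p i) (p (i + 1))))
      * ‖y (p i) - x i‖ + K * ∫ u in Ioc (p i) (p (i + 1)), φ n u ∂m
    rw [hdec, e3, e4]
    have e5 : ‖(q * A (y (p i) - x i)) • e‖ ≤ q * (‖A‖ * ‖y (p i) - x i‖) * ‖e‖ := by
      rw [norm_smul, norm_mul, Real.norm_of_nonneg hq0]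
      gcongr
      exact A.le_opNorm _
    have e6 : ‖(∫ u in Ioc (p i) (p (i + 1)), (c₀ + A (Function.leftLim y u)) ∂ν
        - q * (c₀ + A (y (p i)))) • e‖
        ≤ ‖A‖ * (∫ u in Ioc (p i) (p (i + 1)), φ n u ∂ν) * ‖e‖ := by
      rw [norm_smul, Real.norm_eq_abs]; gcongr
    have e7 : ‖(h : ℝ) • L (y (p i) - x i)‖ ≤ h * (‖L‖ * ‖y (p i) - x i‖) := by
      rw [norm_smul, Real.norm_of_nonneg hh0]
      gcongr
      exact L.le_opNorm _
    refine ((norm_add_le _ _).trans (add_le_add ((norm_add_le _ _).trans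
      (add_le_add (norm_add₃_le.trans (add_le_add (add_le_add le_rfl e1) e7)) e6)) e5)).trans ?_
    have f1 : 0 ≤ ‖L‖ * q * ‖y (p i) - x i‖ := by positivity
    have f2 : 0 ≤ ‖A‖ * ‖e‖ * h * ‖y (p i) - x i‖ := by positivity
    have f3 : 0 ≤ ‖L‖ * ∫ u in Ioc (p i) (p (i + 1)), φ n u ∂ν := by positivity
    have f4 : 0 ≤ ‖A‖ * ‖e‖ * ∫ u in Ioc (p i) (p (i + 1)), φ n u ∂lebNN := by positivity
    rw [hK]
    nlinarith
  have h0 : Tendsto (fun n ↦ Real.exp (K * m.real (Ioc a (a + T)))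
      * (K * ∫ u in Ioc a (a + T), φ n u ∂m)) atTop (𝓝 0) := by
    simpa using (hφlim.const_mul K).const_mul (Real.exp (K * m.real (Ioc a (a + T))))
  have h1 := squeeze_zero_norm (fun n ↦ hbound n) h0
  have h2 := (tendsto_const_nhds (x := y (a + T))).sub h1
  simpa using h2

end Euler

/-! ### Contraction estimates for the Euler scheme -/

section Contraction

variable {E : Type*} [NormedAddCommGroup E] [NormedSpace ℝ E]

/-- A seminorm `p`, equivalent to the norm, for which the flow of `L` contracts at the exponential
rate `η` (in its discretized form, up to a quadratic error in the step size) and the jump map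
`x ↦ (A x) e` has operator norm at most `c`. -/
structure IsContractionNorm (L : E →L[ℝ] E) (A : E →L[ℝ] ℝ) (e : E) (p : Seminorm ℝ E)
    (η c K : ℝ) : Prop where
  c_nonneg : 0 ≤ c
  drift : ∀ h : ℝ, 0 ≤ h → ∀ x, p (x + h • L x) ≤ Real.exp (h * η + K * h ^ 2) * p x
  jump : ∀ x, p (A x • e) ≤ c * p x
  norm_le : ∃ M, 0 < M ∧ ∀ x, ‖x‖ ≤ M * p x
  le_norm : ∃ M, 0 < M ∧ ∀ x, p x ≤ M * ‖x‖

variable {L : E →L[ℝ] E} {A : E →L[ℝ] ℝ} {c₀ : ℝ} {e : E} {p : Seminorm ℝ E} {η c K : ℝ}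

lemma IsContractionNorm.continuous (hp : IsContractionNorm L A e p η c K) : Continuous p := by
  obtain ⟨M, hM, h⟩ := hp.le_norm
  refine Seminorm.continuous_of_continuousAt_zero ?_
  rw [ContinuousAt, map_zero]
  refine squeeze_zero (fun x ↦ apply_nonneg p x) h ?_
  have : Continuous fun x : E ↦ M * ‖x‖ := by fun_prop
  simpa using this.tendsto 0

lemma IsContractionNorm.seminorm_eulerScheme_sub_le (hp : IsContractionNorm L A e p η c K) {h : ℝ}
    (hh : 0 ≤ h) {w : ℕ → ℝ} (hw : ∀ i, 0 ≤ w i) (x x' : E) (k : ℕ) :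
    p (eulerScheme L A c₀ e h w x k - eulerScheme L A c₀ e h w x' k)
      ≤ Real.exp (k * (h * η + K * h ^ 2))
        * (∏ i ∈ Finset.range k, (1 + c * Real.exp (-(h * η + K * h ^ 2)) * w i)) * p (x - x') := by
  have hdr := hp.drift h hh
  set g := h * η + K * h ^ 2
  clear_value g
  induction k with
  | zero => simp [eulerScheme]
  | succ k ih =>
    set u := eulerScheme L A c₀ e h w x k
    set v := eulerScheme L A c₀ e h w x' k
    have h1 : eulerScheme L A c₀ e h w x (k + 1) - eulerScheme L A c₀ e h w x' (k + 1)
        = ((u - v) + h • L (u - v)) + w k • (A (u - v) • e) := by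
      simp only [eulerScheme, map_sub]
      module
    have h2 : p (w k • (A (u - v) • e)) ≤ w k * (c * p (u - v)) := by
      rw [map_smul_eq_mul, Real.norm_of_nonneg (hw k)]
      exact mul_le_mul_of_nonneg_left (hp.jump _) (hw k)
    have h3 : Real.exp g * (1 + c * Real.exp (-g) * w k) = Real.exp g + c * w k := by
      have : Real.exp g * Real.exp (-g) = 1 := by rw [← Real.exp_add]; simp
      linear_combination c * w k * this
    have h4 : 0 ≤ Real.exp g + c * w k :=
      add_nonneg (Real.exp_nonneg _) (mul_nonneg hp.c_nonneg (hw k))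
    calc p (eulerScheme L A c₀ e h w x (k + 1) - eulerScheme L A c₀ e h w x' (k + 1))
        ≤ Real.exp g * p (u - v) + w k * (c * p (u - v)) := by
          rw [h1]
          exact (map_add_le_add p _ _).trans (add_le_add (hdr _) h2)
      _ = (Real.exp g + c * w k) * p (u - v) := by ring
      _ ≤ (Real.exp g + c * w k) * _ := mul_le_mul_of_nonneg_left ih h4
      _ = _ := by
          rw [← h3, Finset.prod_range_succ, Nat.cast_succ, add_mul, one_mul, Real.exp_add]; ring

lemma IsContractionNorm.seminorm_eulerScheme_le (hp : IsContractionNorm L A e p η c K) {h : ℝ}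
    (hh : 0 ≤ h) (hg : h * η + K * h ^ 2 ≤ 0) {w : ℕ → ℝ} (hw : ∀ i, 0 ≤ w i) {c' : ℝ} (hc : c ≤ c')
    (hc' : |c₀| * p e ≤ c') (x : E) (k : ℕ) :
    p (eulerScheme L A c₀ e h w x k)
      ≤ Real.exp (k * (h * η + K * h ^ 2))
        * (∏ i ∈ Finset.range k, (1 + c * Real.exp (-(h * η + K * h ^ 2)) * w i)) * p x
        + ((∏ i ∈ Finset.range k, (1 + c' * w i)) - 1) := by
  have hdr := hp.drift h hh
  set g := h * η + K * h ^ 2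
  clear_value g
  have hc0 : 0 ≤ c' := hp.c_nonneg.trans hc
  induction k with
  | zero => simp [eulerScheme]
  | succ k ih =>
    set u := eulerScheme L A c₀ e h w x k
    have h1 : eulerScheme L A c₀ e h w x (k + 1)
        = (u + h • L u) + (w k • (A u • e) + (w k * c₀) • e) := by
      simp only [eulerScheme]
      module
    have h2 : p (w k • (A u • e)) ≤ w k * (c * p u) := by
      rw [map_smul_eq_mul, Real.norm_of_nonneg (hw k)]
      exact mul_le_mul_of_nonneg_left (hp.jump _) (hw k)
    have h2' : p ((w k * c₀) • e) ≤ w k * c' := by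
      rw [map_smul_eq_mul, norm_mul, Real.norm_of_nonneg (hw k), Real.norm_eq_abs, mul_assoc]
      exact mul_le_mul_of_nonneg_left hc' (hw k)
    have h3 : Real.exp g * (1 + c * Real.exp (-g) * w k) = Real.exp g + c * w k := by
      have : Real.exp g * Real.exp (-g) = 1 := by rw [← Real.exp_add]; simp
      linear_combination c * w k * this
    have h4 : 0 ≤ Real.exp g + c * w k :=
      add_nonneg (Real.exp_nonneg _) (mul_nonneg hp.c_nonneg (hw k))
    have h5 : Real.exp g + c * w k ≤ 1 + c' * w k :=
      add_le_add (Real.exp_le_one_iff.2 hg) (mul_le_mul_of_nonneg_right hc (hw k))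
    set Pr := ∏ i ∈ Finset.range k, (1 + c' * w i) with hPr
    have h6 : 1 ≤ Pr := by
      have := Finset.prod_le_prod (s := Finset.range k) (f := fun _ ↦ (1 : ℝ))
        (g := fun i ↦ 1 + c' * w i) (fun _ _ ↦ zero_le_one)
        (fun i _ ↦ le_add_of_nonneg_right (mul_nonneg hc0 (hw i)))
      simpa using this
    set D := Real.exp (k * g) * (∏ i ∈ Finset.range k, (1 + c * Real.exp (-g) * w i)) * p x
    calc p (eulerScheme L A c₀ e h w x (k + 1))
        ≤ Real.exp g * p u + (w k * (c * p u) + w k * c') := by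
          rw [h1]
          exact (map_add_le_add p _ _).trans (add_le_add (hdr _)
            ((map_add_le_add p _ _).trans (add_le_add h2 h2')))
      _ = (Real.exp g + c * w k) * p u + w k * c' := by ring
      _ ≤ (Real.exp g + c * w k) * (D + (Pr - 1)) + w k * c' := by gcongr
      _ ≤ (Real.exp g + c * w k) * D + ((1 + c' * w k) * (Pr - 1) + w k * c') := by
          have := mul_le_mul_of_nonneg_right h5 (sub_nonneg.2 h6)
          linarith
      _ = _ := by
          rw [← h3, Finset.prod_range_succ, Finset.prod_range_succ, Nat.cast_succ,
            add_mul (k : ℝ), one_mul, Real.exp_add]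
          ring

/-- The sum of the squared jumps in the `i`-th cell of the grid `a, a + h, a + 2h, …`, when `ν`
counts the jumps and `z n` is the size of the `n`-th one. -/
def cellSum (ν : ℝ≥0 → ℕ) (z : ℕ → ℝ) (a h : ℝ≥0) (i : ℕ) : ℝ :=
  ∑ n ∈ Finset.Ioc (ν (a + i * h)) (ν (a + (i + 1 : ℕ) * h)), z n ^ 2

lemma cellSum_nonneg (ν : ℝ≥0 → ℕ) (z : ℕ → ℝ) (a h : ℝ≥0) (i : ℕ) : 0 ≤ cellSum ν z a h i :=
  Finset.sum_nonneg fun _ _ ↦ sq_nonneg _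

/-- `∏ (1 + c z_n²)` over the jumps with index in `(k, l]`. -/
def jumpProd (c : ℝ) (z : ℕ → ℝ) (k l : ℕ) : ℝ := ∏ n ∈ Finset.Ioc k l, (1 + c * z n ^ 2)

lemma one_le_jumpProd {c : ℝ} (hc : 0 ≤ c) (z : ℕ → ℝ) (k l : ℕ) : 1 ≤ jumpProd c z k l := by
  have := Finset.prod_le_prod (s := Finset.Ioc k l) (f := fun _ ↦ (1 : ℝ))
    (g := fun n ↦ 1 + c * z n ^ 2) (fun _ _ ↦ zero_le_one)
    (fun i _ ↦ le_add_of_nonneg_right (mul_nonneg hc (sq_nonneg _)))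
  simpa [jumpProd] using this

lemma jumpProd_mul {c : ℝ} {z : ℕ → ℝ} {k l m : ℕ} (h1 : k ≤ l) (h2 : l ≤ m) :
    jumpProd c z k l * jumpProd c z l m = jumpProd c z k m :=
  Finset.prod_Ioc_consecutive _ h1 h2

lemma one_add_sum_le_jumpProd {c : ℝ} (hc : 0 ≤ c) (z : ℕ → ℝ) (k l : ℕ) :
    1 + c * ∑ n ∈ Finset.Ioc k l, z n ^ 2 ≤ jumpProd c z k l := by
  rw [jumpProd]
  refine Finset.induction_on (Finset.Ioc k l) (by simp) fun n s hn ih ↦ ?_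
  rw [Finset.sum_insert hn, Finset.prod_insert hn]
  have h1 : 0 ≤ c * z n ^ 2 := mul_nonneg hc (sq_nonneg _)
  have h2 : 0 ≤ c * ∑ n ∈ s, z n ^ 2 := mul_nonneg hc (Finset.sum_nonneg fun _ _ ↦ sq_nonneg _)
  refine le_trans ?_ (mul_le_mul_of_nonneg_left ih (by linarith))
  nlinarith [mul_nonneg h1 h2]

lemma prod_cellSum_le {ν : ℝ≥0 → ℕ} (hν : Monotone ν) {c : ℝ} (hc : 0 ≤ c) (z : ℕ → ℝ) (a h : ℝ≥0)
    (k : ℕ) : ∏ i ∈ Finset.range k, (1 + c * cellSum ν z a h i)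
      ≤ jumpProd c z (ν a) (ν (a + k * h)) := by
  induction k with
  | zero => simp [jumpProd]
  | succ k ih =>
    have h1 : ν a ≤ ν (a + k * h) := hν le_self_add
    have h2 : ν (a + k * h) ≤ ν (a + (k + 1 : ℕ) * h) := hν (grid_mono a h (Nat.le_succ k))
    rw [Finset.prod_range_succ, ← jumpProd_mul h1 h2]
    refine mul_le_mul ih (one_add_sum_le_jumpProd hc _ _ _) ?_
      (zero_le_one.trans (one_le_jumpProd hc _ _ _))
    exact add_nonneg zero_le_one (mul_nonneg hc (cellSum_nonneg _ _ _ _ _))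

/-- `y₁` is the limit of the Euler schemes started in `y₀`, over the time interval `(a, a + T]`,
for the jumps counted by `ν` with sizes `z`. -/
def EulerLimit (L : E →L[ℝ] E) (A : E →L[ℝ] ℝ) (c₀ : ℝ) (e : E) (ν : ℝ≥0 → ℕ) (z : ℕ → ℝ)
    (a T : ℝ≥0) (y₀ y₁ : E) : Prop :=
  Tendsto (fun n ↦ eulerScheme L A c₀ e (mesh T n) (cellSum ν z a (mesh T n)) y₀ (n + 1)) atTop
    (𝓝 y₁)

lemma tendsto_exp_mesh (η K : ℝ) (T : ℝ≥0) :
    Tendsto (fun n : ℕ ↦ Real.exp ((n + 1 : ℕ) * ((mesh T n : ℝ) * η + K * (mesh T n : ℝ) ^ 2)))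
      atTop (𝓝 (Real.exp (η * T))) ∧
    Tendsto (fun n : ℕ ↦ Real.exp (-((mesh T n : ℝ) * η + K * (mesh T n : ℝ) ^ 2)))
      atTop (𝓝 1) := by
  have h0 : Tendsto (fun n ↦ (mesh T n : ℝ)) atTop (𝓝 0) := by
    have := NNReal.tendsto_coe.2 (tendsto_mesh T)
    simpa using this
  have h1 : ∀ n : ℕ, ((n + 1 : ℕ) : ℝ) * mesh T n = T := fun n ↦ by
    have := congrArg (fun x : ℝ≥0 ↦ (x : ℝ)) (succ_mul_mesh T n)
    simpa using this
  constructor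
  · have h2 : Tendsto (fun n : ℕ ↦ η * (T : ℝ) + K * T * mesh T n) atTop (𝓝 (η * T)) := by
      simpa using (h0.const_mul (K * T)).const_add (η * (T : ℝ))
    refine ((Real.continuous_exp.tendsto _).comp h2).congr fun n ↦ ?_
    rw [Function.comp_apply]
    congr 1
    linear_combination (-η - K * mesh T n) * h1 n
  · have h2 : Tendsto (fun n : ℕ ↦ -((mesh T n : ℝ) * η + K * (mesh T n : ℝ) ^ 2)) atTop (𝓝 0) := by
      have := ((h0.mul_const η).add ((h0.pow 2).const_mul K)).neg
      simpa using this
    have h3 := (Real.continuous_exp.tendsto _).comp h2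
    rwa [Real.exp_zero] at h3

lemma tendsto_jumpProd {u : ℕ → ℝ} {c : ℝ} (hu : Tendsto u atTop (𝓝 c)) (z : ℕ → ℝ) (k l : ℕ) :
    Tendsto (fun n ↦ jumpProd (u n) z k l) atTop (𝓝 (jumpProd c z k l)) :=
  tendsto_finsetProd _ fun _ _ ↦ (hu.mul_const _).const_add 1

namespace EulerLimit

variable {ν : ℝ≥0 → ℕ} {z : ℕ → ℝ} {a T : ℝ≥0} {y₀ y₁ y₀' y₁' : E}

/-- Solutions driven by the same jumps approach each other. -/
lemma seminorm_sub_le (hp : IsContractionNorm L A e p η c K) (hν : Monotone ν)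
    (h : EulerLimit L A c₀ e ν z a T y₀ y₁) (h' : EulerLimit L A c₀ e ν z a T y₀' y₁') :
    p (y₁ - y₁') ≤ Real.exp (η * T) * jumpProd c z (ν a) (ν (a + T)) * p (y₀ - y₀') := by
  obtain ⟨h1, h2⟩ := tendsto_exp_mesh η K T
  have h2' := h2.const_mul c
  rw [mul_one] at h2'
  have h3 := tendsto_jumpProd h2' z (ν a) (ν (a + T))
  refine le_of_tendsto_of_tendsto' ((hp.continuous.tendsto _).comp (h.sub h'))
    ((h1.mul h3).mul_const (p (y₀ - y₀'))) fun n ↦ ?_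
  refine (hp.seminorm_eulerScheme_sub_le (mesh T n).2 (cellSum_nonneg _ _ _ _) _ _ _).trans ?_
  have h4 := prod_cellSum_le hν (c := c * Real.exp (-((mesh T n : ℝ) * η + K * (mesh T n : ℝ) ^ 2)))
    (mul_nonneg hp.c_nonneg (Real.exp_nonneg _)) z a (mesh T n) (n + 1)
  rw [succ_mul_mesh] at h4
  exact mul_le_mul_of_nonneg_right (mul_le_mul_of_nonneg_left h4 (Real.exp_nonneg _))
    (apply_nonneg p _)

/-- Growth of a solution. -/
lemma seminorm_le (hp : IsContractionNorm L A e p η c K) (hη : η < 0) (hν : Monotone ν)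
    {c' : ℝ} (hc : c ≤ c') (hc' : |c₀| * p e ≤ c') (h : EulerLimit L A c₀ e ν z a T y₀ y₁) :
    p y₁ ≤ Real.exp (η * T) * jumpProd c z (ν a) (ν (a + T)) * p y₀
      + (jumpProd c' z (ν a) (ν (a + T)) - 1) := by
  obtain ⟨h1, h2⟩ := tendsto_exp_mesh η K T
  have h2' := h2.const_mul c
  rw [mul_one] at h2'
  have h3 := tendsto_jumpProd h2' z (ν a) (ν (a + T))
  have h0 : Tendsto (fun n ↦ (mesh T n : ℝ)) atTop (𝓝 0) := by
    have := NNReal.tendsto_coe.2 (tendsto_mesh T)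
    simpa using this
  have h5 : ∀ᶠ n in atTop, (mesh T n : ℝ) * η + K * (mesh T n : ℝ) ^ 2 ≤ 0 := by
    have : Tendsto (fun n ↦ η + K * (mesh T n : ℝ)) atTop (𝓝 η) := by
      simpa using (h0.const_mul K).const_add η
    filter_upwards [this.eventually (gt_mem_nhds hη)] with n hn
    have := mul_nonpos_of_nonneg_of_nonpos (mesh T n).2 hn.le
    change (mesh T n : ℝ) * _ ≤ 0 at this
    nlinarith
  refine le_of_tendsto_of_tendsto ((hp.continuous.tendsto _).comp h)
    (((h1.mul h3).mul_const (p y₀)).add_const _) ?_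
  filter_upwards [h5] with n hn
  refine (hp.seminorm_eulerScheme_le (mesh T n).2 hn (cellSum_nonneg _ _ _ _) hc hc' _ _).trans ?_
  have h4 := prod_cellSum_le hν (c := c * Real.exp (-((mesh T n : ℝ) * η + K * (mesh T n : ℝ) ^ 2)))
    (mul_nonneg hp.c_nonneg (Real.exp_nonneg _)) z a (mesh T n) (n + 1)
  have h6 := prod_cellSum_le hν (hp.c_nonneg.trans hc) z a (mesh T n) (n + 1)
  rw [succ_mul_mesh] at h4 h6
  exact add_le_add (mul_le_mul_of_nonneg_right (mul_le_mul_of_nonneg_left h4 (Real.exp_nonneg _))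
    (apply_nonneg p _)) (sub_le_sub_right h6 _)

end EulerLimit

end Contraction

/-! ### The contraction norm of the companion matrix -/

lemma norm_toLp_mul_le {q : ℕ} (r : ℝ≥0∞) [Fact (1 ≤ r)] {a : Fin q → ℂ} {M : ℝ} (hM : 0 ≤ M)
    (ha : ∀ i, ‖a i‖ ≤ M) (v : Fin q → ℂ) :
    ‖WithLp.toLp r (fun i ↦ a i * v i)‖ ≤ M * ‖WithLp.toLp r v‖ := by
  have hle : ∀ i, ‖a i * v i‖ ≤ ‖(M : ℂ) * v i‖ := fun i ↦ by
    rw [norm_mul, norm_mul, Complex.norm_of_nonneg hM]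
    exact mul_le_mul_of_nonneg_right (ha i) (norm_nonneg _)
  have h1 : M * ‖WithLp.toLp r v‖ = ‖WithLp.toLp r (fun i ↦ (M : ℂ) * v i)‖ := by
    have : WithLp.toLp r (fun i ↦ (M : ℂ) * v i) = (M : ℂ) • WithLp.toLp r v := rfl
    rw [this, norm_smul, Complex.norm_of_nonneg hM]
  rw [h1]
  rcases eq_or_ne r ∞ with rfl | hr
  · rw [PiLp.norm_toLp, PiLp.norm_toLp]
    exact (pi_norm_le_iff_of_nonneg (norm_nonneg _)).2 fun i ↦
      (hle i).trans (norm_le_pi_norm (fun i ↦ (M : ℂ) * v i) i)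
  · have hr0 : 0 < r.toReal :=
      ENNReal.toReal_pos (zero_lt_one.trans_le (Fact.out : 1 ≤ r)).ne' hr
    rw [PiLp.norm_eq_sum hr0, PiLp.norm_eq_sum hr0]
    refine Real.rpow_le_rpow (Finset.sum_nonneg fun i _ ↦ Real.rpow_nonneg (norm_nonneg _) _)
      (Finset.sum_le_sum fun i _ ↦ Real.rpow_le_rpow (norm_nonneg _) (hle i) hr0.le) (by positivity)

lemma norm_toLp_mulVec_le_lrNorm {q : ℕ} (r : ℝ≥0∞) [Fact (1 ≤ r)] (M : Matrix (Fin q) (Fin q) ℂ)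
    (v : Fin q → ℂ) :
    ‖WithLp.toLp r (M.mulVec v)‖ ≤ lrNorm r M * ‖WithLp.toLp r v‖ := by
  rcases eq_or_ne v 0 with rfl | hv
  · simp
  let f : PiLp r (fun _ : Fin q ↦ ℂ) →ₗ[ℂ] PiLp r (fun _ : Fin q ↦ ℂ) :=
    (WithLp.linearEquiv r ℂ (Fin q → ℂ)).symm.toLinearMap ∘ₗ M.mulVecLin ∘ₗ
      (WithLp.linearEquiv r ℂ (Fin q → ℂ)).toLinearMap
  have hbdd : BddAbove (range fun c : {c : Fin q → ℂ // c ≠ 0} ↦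
      ‖WithLp.toLp r (M.mulVec c.1)‖ / ‖WithLp.toLp r c.1‖) := by
    refine ⟨‖LinearMap.toContinuousLinearMap f‖, ?_⟩
    rintro _ ⟨c, rfl⟩
    exact div_le_of_le_mul₀ (norm_nonneg _) (norm_nonneg _)
      ((LinearMap.toContinuousLinearMap f).le_opNorm (WithLp.toLp r c.1))
  have h1 := le_ciSup hbdd ⟨v, hv⟩
  have h2 : 0 < ‖WithLp.toLp r v‖ := norm_pos_iff.2 (by simpa using hv)
  exact (div_le_iff₀ h2).1 h1

lemma lrNorm_nonneg {q : ℕ} (r : ℝ≥0∞) [Fact (1 ≤ r)] (M : Matrix (Fin q) (Fin q) ℂ) :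
    0 ≤ lrNorm r M :=
  Real.iSup_nonneg fun _ ↦ div_nonneg (norm_nonneg _) (norm_nonneg _)

lemma norm_one_add_mul_le {d : ℂ} {η : ℝ} (hd : d.re ≤ η) {h : ℝ} (hh : 0 ≤ h) {K : ℝ}
    (hK : ‖d‖ ^ 2 / 2 ≤ K) : ‖1 + (h : ℂ) * d‖ ≤ Real.exp (h * η + K * h ^ 2) := by
  have h1 : ‖1 + (h : ℂ) * d‖ ^ 2 = 1 + (2 * h * d.re + h ^ 2 * ‖d‖ ^ 2) := by
    rw [← Complex.normSq_eq_norm_sq, ← Complex.normSq_eq_norm_sq, Complex.normSq_apply,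
      Complex.normSq_apply]
    simp
    ring
  have h2 : ‖1 + (h : ℂ) * d‖ ^ 2 ≤ Real.exp (h * η + K * h ^ 2) ^ 2 := by
    rw [h1, ← Real.exp_nat_mul]
    refine le_trans ?_ (Real.exp_le_exp.2 (?_ : 2 * h * d.re + h ^ 2 * ‖d‖ ^ 2 ≤ _))
    · have := Real.add_one_le_exp (2 * h * d.re + h ^ 2 * ‖d‖ ^ 2); linarith
    · push_cast
      nlinarith [mul_le_mul_of_nonneg_left hd hh, mul_le_mul_of_nonneg_left hK (sq_nonneg h)]
  exact le_of_sq_le_sq h2 (Real.exp_nonneg _)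

/-- The embedding of `ℝ^q` in `ℂ^q` with the `L^r`-norm, in the coordinates given by `Q`. -/
def coordMap {q : ℕ} (r : ℝ≥0∞) [Fact (1 ≤ r)] (Q : Matrix (Fin q) (Fin q) ℂ) :
    (Fin q → ℝ) →ₗ[ℝ] PiLp r (fun _ : Fin q ↦ ℂ) where
  toFun x := WithLp.toLp r (Q⁻¹.mulVec fun i ↦ (x i : ℂ))
  map_add' x y := by
    rw [← WithLp.toLp_add, ← Matrix.mulVec_add]
    congr 2
    ext i
    simp
  map_smul' s x := by
    rw [RingHom.id_apply, ← WithLp.toLp_smul, ← Matrix.mulVec_smul]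
    congr 2
    ext i
    simp

namespace CogarchParams

variable {k q : ℕ} (C : CogarchParams k q)

/-- The drift `x ↦ B x`. -/
def drift : (Fin q → ℝ) →L[ℝ] (Fin q → ℝ) := LinearMap.toContinuousLinearMap C.B.mulVecLin

/-- The linear form `x ↦ a' x`. -/
def form : (Fin q → ℝ) →L[ℝ] ℝ := LinearMap.toContinuousLinearMap (dotProductBilin ℝ ℝ C.α)

lemma form_apply (x : Fin q → ℝ) : C.form x = C.α ⬝ᵥ x := rfl

lemma mulVec_ofReal (M : Matrix (Fin q) (Fin q) ℝ) (x : Fin q → ℝ) :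
    (fun i ↦ ((M.mulVec x i : ℝ) : ℂ)) = (M.map Complex.ofReal).mulVec fun i ↦ (x i : ℂ) := by
  ext i
  simp [Matrix.mulVec, dotProduct]

/-- In the coordinates that diagonalize `B`, the `L^r`-norm is a contraction norm: an Euler step
`1 + h B` is diagonal, hence bounded by `exp (h η + O(h²))`, and `e a'` has norm
`‖Q⁻¹ e a' Q‖_r`. -/
theorem isContractionNorm (Q : Matrix (Fin q) (Fin q) ℂ) (hQ : IsUnit Q.det)
    (h_diag : (Q⁻¹ * C.Bc * Q).IsDiag) (r : ℝ≥0∞) [Fact (1 ≤ r)] :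
    ∃ K, IsContractionNorm C.drift C.form C.e
      ((normSeminorm ℝ (PiLp r (fun _ : Fin q ↦ ℂ))).comp (coordMap r Q)) C.η
      (lrNorm r (Q⁻¹ * C.ea * Q)) K := by
  have hQQ : Q * Q⁻¹ = 1 := Matrix.mul_nonsing_inv Q hQ
  have hQQ' : Q⁻¹ * Q = 1 := Matrix.nonsing_inv_mul Q hQ
  set d : Fin q → ℂ := fun i ↦ (Q⁻¹ * C.Bc * Q) i i with hd
  have hdiag : Q⁻¹ * C.Bc * Q = Matrix.diagonal d := h_diag.diagonal_diag.symm
  have hspec : ∀ i, d i ∈ spectrum ℂ C.Bc := by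
    intro i
    let u : (Matrix (Fin q) (Fin q) ℂ)ˣ := ⟨Q, Q⁻¹, hQQ, hQQ'⟩
    have h1 : spectrum ℂ (Q⁻¹ * C.Bc * Q) = spectrum ℂ C.Bc :=
      spectrum.units_conjugate' (a := C.Bc) (u := u)
    rw [← h1, hdiag, spectrum_diagonal]
    exact ⟨i, rfl⟩
  have hre : ∀ i, (d i).re ≤ C.η := fun i ↦
    le_csSup ((Matrix.finite_spectrum C.Bc).image _).bddAbove ⟨_, hspec i, rfl⟩
  have hcoord : ∀ M : Matrix (Fin q) (Fin q) ℝ, ∀ x, coordMap r Q (M.mulVec x)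
      = WithLp.toLp r ((Q⁻¹ * M.map Complex.ofReal * Q).mulVec
        (Q⁻¹.mulVec fun i ↦ (x i : ℂ))) := by
    intro M x
    change WithLp.toLp r (Q⁻¹.mulVec _) = _
    rw [mulVec_ofReal, Matrix.mulVec_mulVec, Matrix.mulVec_mulVec, Matrix.mul_assoc _ Q, hQQ,
      Matrix.mul_one]
  refine ⟨∑ i, ‖d i‖ ^ 2 / 2, lrNorm_nonneg _ _, fun h hh x ↦ ?_, fun x ↦ ?_, ?_, ?_⟩
  · change ‖coordMap r Q (x + h • C.B.mulVec x)‖ ≤ _ * ‖coordMap r Q x‖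
    have h1 : coordMap r Q (x + h • C.B.mulVec x)
        = WithLp.toLp r (fun i ↦ (1 + (h : ℂ) * d i) * Q⁻¹.mulVec (fun i ↦ (x i : ℂ)) i) := by
      rw [map_add, map_smul, hcoord]
      change _ + h • WithLp.toLp r ((Q⁻¹ * C.Bc * Q).mulVec _) = _
      rw [hdiag]
      change WithLp.toLp r (Q⁻¹.mulVec fun i ↦ (x i : ℂ)) + _ = _
      generalize Q⁻¹.mulVec (fun i ↦ (x i : ℂ)) = v
      ext i
      simp [Matrix.mulVec_diagonal]
      ring
    rw [h1]
    exact norm_toLp_mul_le r (Real.exp_nonneg _) (fun i ↦ norm_one_add_mul_le (hre i) hh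
      (Finset.single_le_sum (f := fun i ↦ ‖d i‖ ^ 2 / 2) (fun i _ ↦ by positivity)
        (Finset.mem_univ i))) _
  · change ‖coordMap r Q ((C.α ⬝ᵥ x) • C.e)‖ ≤ _ * ‖coordMap r Q x‖
    have h1 : (C.α ⬝ᵥ x) • C.e = (Matrix.vecMulVec C.e C.α).mulVec x := by
      ext i
      simp [Matrix.vecMulVec_mulVec, mul_comm]
    rw [h1, hcoord]
    exact norm_toLp_mulVec_le_lrNorm r _ _
  · have hinj : Function.Injective (coordMap r Q) := by
      rw [injective_iff_map_eq_zero]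
      intro x hx
      have h1 : Q⁻¹.mulVec (fun i ↦ (x i : ℂ)) = 0 := by
        simpa [coordMap] using hx
      have h2 := congrArg Q.mulVec h1
      rw [Matrix.mulVec_mulVec, hQQ, Matrix.one_mulVec, Matrix.mulVec_zero] at h2
      ext i
      simpa using congrFun h2 i
    obtain ⟨M, hM, h⟩ := (coordMap r Q).exists_antilipschitzWith (LinearMap.ker_eq_bot.2 hinj)
    exact ⟨M, by exact_mod_cast hM, fun x ↦ by simpa using h.le_mul_norm_sub x 0⟩
  · refine ⟨‖LinearMap.toContinuousLinearMap (coordMap r Q)‖ + 1, by positivity, fun x ↦ ?_⟩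
    refine ((LinearMap.toContinuousLinearMap (coordMap r Q)).le_opNorm x).trans ?_
    gcongr
    linarith

end CogarchParams

/-! ### The state equation and the price increments along a path -/

/-- The measure with mass `max (c n) 0` in the `n`-th jump time of `ν`, for `1 ≤ n ≤ k`. -/
def jumpMeasure (ν : ℝ≥0 → ℕ) (c : ℕ → ℝ) (k : ℕ) : Measure ℝ≥0 :=
  ∑ n ∈ Finset.Icc 1 k, ENNReal.ofReal (c n) • Measure.dirac (arrivalTime ν n)

instance (ν : ℝ≥0 → ℕ) (c : ℕ → ℝ) (k : ℕ) : IsFiniteMeasure (jumpMeasure ν c k) := by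
  constructor
  simp only [jumpMeasure, Measure.coe_finsetSum, Finset.sum_apply, Measure.smul_apply, smul_eq_mul]
  exact ENNReal.sum_lt_top.2 fun n _ ↦ by simp

lemma setIntegral_Ioc_split {m : Measure ℝ≥0} {F : Type*} [NormedAddCommGroup F] [NormedSpace ℝ F]
    {g : ℝ≥0 → F} {b s t : ℝ≥0} (hg : IntegrableOn g (Ioc 0 b) m) (hst : s ≤ t) (htb : t ≤ b) :
    ∫ u in Ioc 0 t, g u ∂m = ∫ u in Ioc 0 s, g u ∂m + ∫ u in Ioc s t, g u ∂m := by
  rw [← Ioc_union_Ioc_eq_Ioc zero_le hst, setIntegral_union (Ioc_disjoint_Ioc_of_le le_rfl)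
    measurableSet_Ioc (hg.mono_set (Ioc_subset_Ioc_right (hst.trans htb)))
    (hg.mono_set (Ioc_subset_Ioc zero_le htb))]

section Integrable

variable {k q : ℕ} (C : CogarchParams k q) {y : ℝ≥0 → Fin q → ℝ}

lemma IsCadlag.measurable_drift (hy : IsCadlag y) :
    Measurable fun u ↦ C.drift (Function.leftLim y u) :=
  C.drift.continuous.measurable.comp hy.measurable_leftLim

lemma IsCadlag.integrableOn_drift (hy : IsCadlag y) (b : ℝ≥0) :
    IntegrableOn (fun u ↦ C.drift (Function.leftLim y u)) (Ioc 0 b) lebNN := by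
  obtain ⟨K, hK⟩ := hy.exists_bound b
  refine Measure.integrableOn_of_bounded (M := ‖C.drift‖ * K) (by rw [lebNN_Ioc]; simp)
    (hy.measurable_drift C).aestronglyMeasurable ((ae_restrict_iff' measurableSet_Ioc).2
      (Eventually.of_forall fun u hu ↦ (C.drift.le_opNorm _).trans ?_))
  gcongr
  exact hy.norm_leftLim_le hK hu.2

lemma IsCadlag.integrableOn_vol (hy : IsCadlag y) (b : ℝ≥0) (μ : Measure ℝ≥0) [IsFiniteMeasure μ] :
    IntegrableOn (fun u ↦ C.α₀ + C.form (Function.leftLim y u)) (Ioc 0 b) μ := by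
  have := hy.integrableOn_comp_leftLim (a := 0) (T := b) (measure_ne_top μ _)
    (g := fun v ↦ C.α₀ + C.form v) (by fun_prop)
  rwa [zero_add] at this

end Integrable

namespace IsCountingPath

variable {ν : ℝ≥0 → ℕ} (hν : IsCountingPath ν)
include hν

lemma jumpMeasure_real_Ioc (c : ℕ → ℝ) {u v b : ℝ≥0} (hvb : v ≤ b) :
    (jumpMeasure ν c (ν b)).real (Ioc u v)
      = ∑ n ∈ Finset.Ioc (ν u) (ν v), max (c n) 0 := by
  have h1 : ∀ n ∈ Finset.Icc 1 (ν b), (ENNReal.ofReal (c n) • Measure.dirac (arrivalTime ν n))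
      (Ioc u v) = if n ∈ Finset.Ioc (ν u) (ν v) then ENNReal.ofReal (c n) else 0 := by
    intro n hn
    have h2 := hν.arrivalTime_mem_Ioc_iff (Finset.mem_Icc.1 hn).2 (s := u) (t := v)
    rw [Measure.smul_apply, Measure.dirac_apply' _ measurableSet_Ioc, smul_eq_mul, indicator_apply]
    by_cases h3 : arrivalTime ν n ∈ Ioc u v
    · rw [if_pos h3, if_pos (h2.1 h3)]; simp
    · rw [if_neg h3, if_neg (fun h ↦ h3 (h2.2 h))]; simp
  have h2 : Finset.Icc 1 (ν b) ∩ Finset.Ioc (ν u) (ν v) = Finset.Ioc (ν u) (ν v) := by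
    refine Finset.inter_eq_right.2 fun n hn ↦ ?_
    rw [Finset.mem_Ioc] at hn
    exact Finset.mem_Icc.2 ⟨by omega, hn.2.trans (hν.mono hvb)⟩
  rw [measureReal_def, jumpMeasure, Measure.coe_finsetSum, Finset.sum_apply,
    Finset.sum_congr rfl h1, Finset.sum_ite_mem, h2, ENNReal.toReal_sum (by simp)]
  exact Finset.sum_congr rfl fun n _ ↦ by rw [ENNReal.toReal_ofReal']

lemma continuousWithinAt_sum (c : ℕ → ℝ) (u : ℝ≥0) :
    ContinuousWithinAt (fun t ↦ ∑ n ∈ Finset.Icc 1 (ν t), c n) (Ici u) u :=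
  (continuous_of_discreteTopology (f := fun k : ℕ ↦ ∑ n ∈ Finset.Icc 1 k, c n)).continuousAt
    |>.comp_continuousWithinAt (hν.right_cont u)

variable {k q : ℕ} {C : CogarchParams k q} {y : ℝ≥0 → Fin q → ℝ} {δ : ℝ} {z : ℕ → ℝ}

lemma jumpMeasure_sq_real_Ioc {u v b : ℝ≥0} (hvb : v ≤ b) :
    (jumpMeasure ν (fun n ↦ z n ^ 2) (ν b)).real (Ioc u v)
      = ∑ n ∈ Finset.Ioc (ν u) (ν v), z n ^ 2 := by
  rw [hν.jumpMeasure_real_Ioc _ hvb]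
  exact Finset.sum_congr rfl fun n _ ↦ max_eq_left (sq_nonneg _)

/-- The state equation in terms of `jumpMeasure`. -/
lemma equation_sub (hy : IsCadlag y)
    (heq : ∀ t : ℝ≥0, y t = y 0
      + (∫ u in (0 : ℝ)..t, C.B.mulVec (Function.leftLim y u.toNNReal))
      + lsIntegral (C.vol y) (quadVar (driftStep ν δ z)) 0 t • C.e) {b t : ℝ≥0} (ht : t ≤ b) :
    y t - y 0 = ∫ u in Ioc 0 t, C.drift (Function.leftLim y u) ∂lebNN
      + (∫ u in Ioc 0 t, (C.α₀ + C.form (Function.leftLim y u))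
          ∂(jumpMeasure ν (fun n ↦ z n ^ 2) (ν b))) • C.e := by
  set μ := jumpMeasure ν (fun n ↦ z n ^ 2) (ν b) with hμ
  have hqv : quadVar (driftStep ν δ z) = fun t ↦ ∑ n ∈ Finset.Icc 1 (ν t), z n ^ 2 :=
    funext fun t ↦ hν.quadVar_driftStep δ z t
  have hls : lsIntegral (C.vol y) (quadVar (driftStep ν δ z)) 0 t
      = ∫ u in Ioc 0 t, (C.α₀ + C.form (Function.leftLim y u)) ∂μ := by
    rw [lsIntegral_eq_integral_sub (g := C.vol y) (μ₁ := μ) (μ₂ := 0) zero_le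
      (fun u ↦ by rw [hqv]; exact hν.continuousWithinAt_sum _ u) (measure_ne_top _ _) (by simp)
      (fun u v _ huv hvt ↦ ?_) ((hy.integrableOn_vol C b μ).mono_set (Ioc_subset_Ioc_right ht))
      (by rw [IntegrableOn, Measure.restrict_zero]; exact integrable_zero_measure)]
    · rw [Measure.restrict_zero, integral_zero_measure, sub_zero]
      rfl
    · rw [hqv, hν.jumpMeasure_sq_real_Ioc (hvt.trans ht)]
      simpa using sum_Icc_one_sub (hν.mono huv)
  have hdr : ∫ u in (0 : ℝ)..t, C.B.mulVec (Function.leftLim y u.toNNReal)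
      = ∫ u in Ioc 0 t, C.drift (Function.leftLim y u) ∂lebNN := by
    have := intervalIntegral_toNNReal (hy.measurable_drift C).stronglyMeasurable
      (s := 0) (t := t) zero_le
    rw [NNReal.coe_zero] at this
    exact this
  rw [heq t, hdr, hls]
  abel

/-- A solution of the state equation is the limit of its Euler schemes, on every interval. -/
theorem eulerLimit_of_sub (hy : IsCadlag y) (a T : ℝ≥0)
    (h : ∀ t ≤ a + T, y t - y 0 = ∫ u in Ioc 0 t, C.drift (Function.leftLim y u) ∂lebNN
      + (∫ u in Ioc 0 t, (C.α₀ + C.form (Function.leftLim y u))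
          ∂(jumpMeasure ν (fun n ↦ z n ^ 2) (ν (a + T)))) • C.e) :
    EulerLimit C.drift C.form C.α₀ C.e ν z a T (y a) (y (a + T)) := by
  have key := tendsto_eulerScheme (L := C.drift) (A := C.form) (c₀ := C.α₀) (e := C.e) hy
    (ν := jumpMeasure ν (fun n ↦ z n ^ 2) (ν (a + T))) (a := a) (T := T) (measure_ne_top _ _) ?_
  · refine key.congr fun n ↦ eulerScheme_congr fun i hi ↦ ?_
    rw [hν.jumpMeasure_sq_real_Ioc, cellSum]
    exact add_le_add_right (mul_mesh_le hi) a
  · intro s t hs hst htb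
    rw [← sub_sub_sub_cancel_right _ _ (y 0), h t htb, h s (hst.trans htb),
      setIntegral_Ioc_split (hy.integrableOn_drift C _) hst htb,
      setIntegral_Ioc_split (hy.integrableOn_vol C _ _) hst htb]
    module

/-- Over fine grids, the squared increments of `t ↦ δ t + ∑_{n ≤ ν t} z n` without drift are the
sums of the squared jumps. -/
lemma eventually_sq_increment (a T : ℝ≥0) : ∀ᶠ n in atTop, ∀ i < n + 1,
    (driftStep ν δ z (a + (i + 1 : ℕ) * mesh T n) - driftStep ν δ z (a + i * mesh T n)
      - δ * mesh T n) ^ 2 = cellSum ν z a (mesh T n) i := by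
  obtain ⟨ε, hε, h⟩ := hν.exists_mesh (a + T)
  filter_upwards [(tendsto_mesh T).eventually (gt_mem_nhds hε)] with n hn i hi
  have h1 : a + (i + 1 : ℕ) * mesh T n = a + i * mesh T n + mesh T n := by push_cast; ring
  have h2 := h (a + i * mesh T n) (a + (i + 1 : ℕ) * mesh T n)
    (add_le_add_right (mul_mesh_le hi) a) (by rw [h1]; gcongr)
  have h3 : ν (a + i * mesh T n) ≤ ν (a + (i + 1 : ℕ) * mesh T n) :=
    hν.mono (grid_mono a (mesh T n) (Nat.le_succ i))
  rw [hν.driftStep_sub (grid_mono a (mesh T n) (Nat.le_succ i)), cellSum]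
  have h4 : ((a + (i + 1 : ℕ) * mesh T n : ℝ≥0) : ℝ) - ((a + i * mesh T n : ℝ≥0) : ℝ)
      = mesh T n := by push_cast; ring
  rw [h4, add_sub_cancel_left]
  rcases Nat.le_iff_lt_or_eq.1 h3 with h5 | h5
  · have h6 : ν (a + (i + 1 : ℕ) * mesh T n) = ν (a + i * mesh T n) + 1 := by
      omega
    rw [h6]; simp
  · rw [h5]; simp

/-- The price increments are limits of Riemann sums. -/
theorem tendsto_price (hy : IsCadlag y) (a T : ℝ≥0) :
    Tendsto (fun n ↦ ∑ i ∈ Finset.range (n + 1), √(C.α₀ + C.form (y (a + i * mesh T n)))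
        * (driftStep ν δ z (a + (i + 1 : ℕ) * mesh T n) - driftStep ν δ z (a + i * mesh T n)))
      atTop (𝓝 (lsIntegral (fun u ↦ √(C.vol y u)) (driftStep ν δ z) a (a + T))) := by
  set b := a + T with hb
  set μ₁ := ENNReal.ofReal δ • lebNN + jumpMeasure ν z (ν b) with hμ₁
  set μ₂ := ENNReal.ofReal (-δ) • lebNN + jumpMeasure ν (fun n ↦ - z n) (ν b) with hμ₂
  have hleb : ∀ s t : ℝ≥0, lebNN (Ioc s t) ≠ ∞ := fun s t ↦ by rw [lebNN_Ioc]; simp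
  have hfin : ∀ (d : ℝ) (c : ℕ → ℝ) (s t : ℝ≥0),
      (ENNReal.ofReal d • lebNN + jumpMeasure ν c (ν b)) (Ioc s t) ≠ ∞ := by
    intro d c s t
    rw [Measure.add_apply, Measure.smul_apply, smul_eq_mul]
    exact ENNReal.add_ne_top.2 ⟨ENNReal.mul_ne_top ENNReal.ofReal_ne_top (hleb s t),
      measure_ne_top _ _⟩
  have hreal : ∀ (d : ℝ) (c : ℕ → ℝ) (u v : ℝ≥0), u ≤ v → v ≤ b →
      (ENNReal.ofReal d • lebNN + jumpMeasure ν c (ν b)).real (Ioc u v)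
        = max d 0 * (v - u) + ∑ n ∈ Finset.Ioc (ν u) (ν v), max (c n) 0 := by
    intro d c u v huv hvb
    rw [measureReal_add_apply (ENNReal.mul_ne_top ENNReal.ofReal_ne_top (hleb u v))
      (measure_ne_top _ _), hν.jumpMeasure_real_Ioc _ hvb, measureReal_ennreal_smul_apply,
      lebNN_real_Ioc huv, ENNReal.toReal_ofReal']
  have hsub : ∀ u v, u ≤ v → v ≤ b → driftStep ν δ z v - driftStep ν δ z u
      = μ₁.real (Ioc u v) - μ₂.real (Ioc u v) := by
    intro u v huv hvb
    have hm : ∀ x : ℝ, max x 0 - max (-x) 0 = x := fun x ↦ by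
      rcases le_total x 0 with h | h
      · rw [max_eq_right h, max_eq_left (by linarith)]; ring
      · rw [max_eq_left h, max_eq_right (by linarith)]; ring
    rw [hν.driftStep_sub huv, hreal _ _ _ _ huv hvb, hreal _ _ _ _ huv hvb,
      ← Finset.sum_congr rfl fun n _ ↦ hm (z n), Finset.sum_sub_distrib]
    linear_combination (v - u : ℝ) * (hm δ).symm
  have hgcont : Continuous fun v : Fin q → ℝ ↦ √(C.α₀ + C.form v) := by fun_prop
  have hi₁ := hy.integrableOn_comp_leftLim (hfin δ z a b) hgcont
  have hi₂ := hy.integrableOn_comp_leftLim (hfin (-δ) (fun n ↦ - z n) a b) hgcont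
  have h1 : lsIntegral (fun u ↦ √(C.vol y u)) (driftStep ν δ z) a b
      = ∫ u in Ioc a b, √(C.vol y u) ∂μ₁ - ∫ u in Ioc a b, √(C.vol y u) ∂μ₂ := by
    refine lsIntegral_eq_integral_sub le_self_add (fun u ↦ ?_) (hfin _ _ _ _) (hfin _ _ _ _)
      (fun u v _ huv hvb ↦ hsub u v huv hvb) hi₁ hi₂
    exact ContinuousWithinAt.add (Continuous.continuousWithinAt (by fun_prop))
      (hν.continuousWithinAt_sum z u)
  rw [h1]
  refine ((hy.tendsto_sum_grid (hfin δ z a b) hgcont).sub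
    (hy.tendsto_sum_grid (hfin (-δ) (fun n ↦ - z n) a b) hgcont)).congr fun n ↦ ?_
  rw [← Finset.sum_sub_distrib]
  refine Finset.sum_congr rfl fun i hi ↦ ?_
  rw [hsub _ _ (grid_mono a (mesh T n) (Nat.le_succ i))
    (add_le_add_right (mul_mesh_le (Finset.mem_range.1 hi)) a)]
  ring

end IsCountingPath

/-! ### The flow of the state equation -/

section Flow

variable {k q : ℕ} (C : CogarchParams k q)

/-- The approximations of `flow`. -/
def flowApprox (δ : ℝ) (T : ℝ≥0) (n : ℕ) (yx : (Fin q → ℝ) × (ℝ≥0 → ℝ)) : Fin q → ℝ :=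
  eulerScheme C.drift C.form C.α₀ C.e (mesh T n)
    (fun i ↦ (yx.2 ((i + 1 : ℕ) * mesh T n) - yx.2 (i * mesh T n) - δ * mesh T n) ^ 2) yx.1 (n + 1)

/-- The state at time `T` of the solution with initial value `y`, as a functional of the path `x`
of the driving process (with drift `δ`): the limit of the Euler schemes, when it exists. -/
def flow (δ : ℝ) (T : ℝ≥0) (yx : (Fin q → ℝ) × (ℝ≥0 → ℝ)) : Fin q → ℝ :=
  limUnder atTop fun n ↦ flowApprox C δ T n yx

lemma measurable_eulerScheme {α : Type*} [MeasurableSpace α] (h : ℝ) {w : α → ℕ → ℝ}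
    (hw : ∀ i, Measurable fun a ↦ w a i) {x : α → Fin q → ℝ} (hx : Measurable x) (n : ℕ) :
    Measurable fun a ↦ eulerScheme C.drift C.form C.α₀ C.e h (w a) (x a) n := by
  induction n with
  | zero => exact hx
  | succ n ih =>
    simp only [eulerScheme]
    have h1 := C.drift.continuous.measurable.comp ih
    have h2 := C.form.continuous.measurable.comp ih
    exact (ih.add (h1.const_smul h)).add (((hw n).mul (h2.const_add _)).smul_const _)

lemma measurable_flowApprox (δ : ℝ) (T : ℝ≥0) (n : ℕ) : Measurable (flowApprox C δ T n) := by
  refine measurable_eulerScheme C _ (fun i ↦ ?_) measurable_fst _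
  have h : ∀ t : ℝ≥0, Measurable fun yx : (Fin q → ℝ) × (ℝ≥0 → ℝ) ↦ yx.2 t := fun t ↦
    (measurable_pi_apply t).comp measurable_snd
  exact (((h _).sub (h _)).sub_const _).pow_const 2

lemma measurable_flow (δ : ℝ) (T : ℝ≥0) : Measurable (flow C δ T) :=
  (StronglyMeasurable.limUnder fun n ↦
    (measurable_flowApprox C δ T n).stronglyMeasurable).measurable

/-- The increments of the path `x` after time `a`. -/
def shiftPath (a : ℝ≥0) (x : ℝ≥0 → ℝ) (t : ℝ≥0) : ℝ := x (a + t) - x a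

lemma EulerLimit.flow_eq {ν : ℝ≥0 → ℕ} (hν : IsCountingPath ν) {z : ℕ → ℝ} {a T : ℝ≥0}
    {y₀ y₁ : Fin q → ℝ} (h : EulerLimit C.drift C.form C.α₀ C.e ν z a T y₀ y₁) (δ : ℝ) :
    flow C δ T (y₀, shiftPath a (driftStep ν δ z)) = y₁ := by
  refine Tendsto.limUnder_eq (Tendsto.congr' ?_ h)
  filter_upwards [hν.eventually_sq_increment (δ := δ) (z := z) a T] with n hn
  refine eulerScheme_congr fun i hi ↦ ?_
  rw [← hn i hi]
  simp only [shiftPath]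
  ring

end Flow

/-! ### Existence of solutions -/

namespace IsCountingPath

variable {ν : ℝ≥0 → ℕ} (hν : IsCountingPath ν)

section Solution

variable {k q : ℕ} (C : CogarchParams k q) (ν) (z : ℕ → ℝ) (y₀ : Fin q → ℝ)

/-- The flow `exp (t B)` of the drift. -/
def expFlow (t : ℝ) : (Fin q → ℝ) →L[ℝ] (Fin q → ℝ) := NormedSpace.exp (t • C.drift)

/-- The value of the solution just after the `n`-th jump. -/
def jumpValue : ℕ → Fin q → ℝ
  | 0 => y₀
  | n + 1 =>
    let x := expFlow C (arrivalTime ν (n + 1) - arrivalTime ν n) (jumpValue n)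
    x + (z (n + 1) ^ 2 * (C.α₀ + C.form x)) • C.e

/-- The solution of the state equation with initial value `y₀`. -/
def solution (t : ℝ≥0) : Fin q → ℝ :=
  expFlow C (t - arrivalTime ν (ν t)) (jumpValue ν C z y₀ (ν t))

end Solution

variable {k q : ℕ} {C : CogarchParams k q} {z : ℕ → ℝ} {y₀ : Fin q → ℝ}

lemma expFlow_zero (x : Fin q → ℝ) : expFlow C 0 x = x := by
  simp [expFlow, NormedSpace.exp_zero]

lemma hasDerivAt_expFlow (x : Fin q → ℝ) (t : ℝ) :
    HasDerivAt (fun s ↦ expFlow C s x) (C.drift (expFlow C t x)) t := by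
  have h := hasDerivAt_exp_smul_const' (𝕂 := ℝ) C.drift t
  have h2 := h.clm_apply (hasDerivAt_const t x)
  rw [map_zero, add_zero] at h2
  exact h2

lemma continuous_expFlow (x : Fin q → ℝ) : Continuous fun s ↦ expFlow C s x :=
  continuous_iff_continuousAt.2 fun t ↦ (hasDerivAt_expFlow x t).continuousAt

include hν

lemma tendsto_solution_right (t : ℝ≥0) :
    ContinuousWithinAt (solution ν C z y₀) (Ici t) t := by
  have h1 : ∀ᶠ u in 𝓝[≥] t, ν u = ν t :=
    (hν.right_cont t).eventually (by simp : ∀ᶠ n in 𝓝 (ν t), n = ν t)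
  have h2 : Continuous fun u : ℝ≥0 ↦
      expFlow C (u - arrivalTime ν (ν t)) (jumpValue ν C z y₀ (ν t)) :=
    (continuous_expFlow _).comp (by fun_prop)
  refine h2.continuousWithinAt.congr_of_eventuallyEq ?_ rfl
  filter_upwards [h1] with u hu
  simp only [solution, hu]

omit hν in
lemma tendsto_solution_left {u : ℝ≥0} {j : ℕ} (hj : ∀ᶠ v in 𝓝[<] u, ν v = j) :
    Tendsto (solution ν C z y₀) (𝓝[<] u)
      (𝓝 (expFlow C (u - arrivalTime ν j) (jumpValue ν C z y₀ j))) := by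
  have h2 : Continuous fun u : ℝ≥0 ↦ expFlow C (u - arrivalTime ν j) (jumpValue ν C z y₀ j) :=
    (continuous_expFlow _).comp (by fun_prop)
  refine ((h2.tendsto u).mono_left nhdsWithin_le_nhds).congr' ?_
  filter_upwards [hj] with v hv
  simp only [solution, hv]

lemma isCadlag_solution : IsCadlag (solution ν C z y₀) := by
  refine fun t ↦ ⟨hν.tendsto_solution_right t, ?_⟩
  rcases eq_zero_or_pos t with rfl | ht
  · refine ⟨0, ?_⟩
    simp
  · obtain ⟨j, hj, -⟩ := hν.exists_left_value ht
    exact ⟨_, tendsto_solution_left hj⟩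

omit hν in
lemma solution_leftLim {u : ℝ≥0} (hu : 0 < u) {j : ℕ} (hj : ∀ᶠ v in 𝓝[<] u, ν v = j) :
    Function.leftLim (solution ν C z y₀) u
      = expFlow C (u - arrivalTime ν j) (jumpValue ν C z y₀ j) := by
  have : (𝓝[<] u).NeBot := nhdsLT_neBot_of_exists_lt ⟨0, hu⟩
  exact leftLim_eq_of_tendsto (tendsto_solution_left hj)

omit hν in
/-- The drift part of the equation, over an interval in the interior of which there is no jump. -/
lemma integral_drift_solution {v u : ℝ≥0} (hvu : v ≤ u) {j : ℕ}
    (hc : ∀ w, v ≤ w → w < u → ν w = j) :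
    ∫ w in Ioc v u, C.drift (Function.leftLim (solution ν C z y₀) w) ∂lebNN
      = expFlow C (u - arrivalTime ν j) (jumpValue ν C z y₀ j)
        - expFlow C (v - arrivalTime ν j) (jumpValue ν C z y₀ j) := by
  set x := jumpValue ν C z y₀ j
  set a : ℝ := ((arrivalTime ν j : ℝ≥0) : ℝ)
  have h1 : ∀ w ∈ Ioc v u, Function.leftLim (solution ν C z y₀) w = expFlow C (w - a) x := by
    intro w hw
    refine solution_leftLim (zero_le.trans_lt hw.1) ?_
    filter_upwards [Ioo_mem_nhdsLT hw.1] with w' hw'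
    exact hc w' hw'.1.le (hw'.2.trans_le hw.2)
  rw [setIntegral_congr_fun measurableSet_Ioc (fun w hw ↦ by rw [h1 w hw] :
    EqOn _ (fun w : ℝ≥0 ↦ C.drift (expFlow C (w - a) x)) _)]
  have h2 : Continuous fun w : ℝ≥0 ↦ C.drift (expFlow C (w - a) x) :=
    C.drift.continuous.comp ((continuous_expFlow x).comp (by fun_prop))
  rw [← intervalIntegral_toNNReal h2.stronglyMeasurable hvu]
  have h3 : ∫ w in (v : ℝ)..u, C.drift (expFlow C ((w.toNNReal : ℝ≥0) - a) x)
      = ∫ w in (v : ℝ)..u, C.drift (expFlow C (w - a) x) := by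
    refine intervalIntegral.integral_congr fun w hw ↦ ?_
    rw [uIcc_of_le (NNReal.coe_le_coe.2 hvu)] at hw
    simp only [Real.coe_toNNReal _ (v.2.trans hw.1)]
  rw [h3, intervalIntegral.integral_eq_sub_of_hasDerivAt (f := fun w : ℝ ↦ expFlow C (w - a) x)]
  · intro w _
    have := (hasDerivAt_expFlow (C := C) x (w - a)).scomp w ((hasDerivAt_id w).sub_const a)
    simpa [Function.comp_def] using this
  · exact (C.drift.continuous.comp ((continuous_expFlow x).comp
      (by fun_prop))).intervalIntegrable _ _

/-- `solution` satisfies the state equation on `[0, b]`. -/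
lemma solution_sub (b : ℝ≥0) {t : ℝ≥0} (htb : t ≤ b) :
    solution ν C z y₀ t - y₀
      = ∫ w in Ioc 0 t, C.drift (Function.leftLim (solution ν C z y₀) w) ∂lebNN
        + (∫ w in Ioc 0 t, (C.α₀ + C.form (Function.leftLim (solution ν C z y₀) w))
            ∂(jumpMeasure ν (fun n ↦ z n ^ 2) (ν b))) • C.e := by
  set y := solution ν C z y₀ with hy
  set μ := jumpMeasure ν (fun n ↦ z n ^ 2) (ν b) with hμ
  have hcad : IsCadlag y := hν.isCadlag_solution
  have hsplit₁ := fun s t ↦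
    setIntegral_Ioc_split (s := s) (t := t) (hcad.integrableOn_drift C b)
  have hsplit₂ := fun s t ↦
    setIntegral_Ioc_split (s := s) (t := t) (hcad.integrableOn_vol C b μ)
  -- no contribution of the jump measure over intervals on which `ν` is constant
  have hzero : ∀ s t : ℝ≥0, s ≤ t → t ≤ b → ν s = ν t →
      ∫ w in Ioc s t, (C.α₀ + C.form (Function.leftLim y w)) ∂μ = 0 := by
    intro s t hst htb hst'
    have h1 := hν.jumpMeasure_real_Ioc (fun n ↦ z n ^ 2) (u := s) htb
    rw [hst', Finset.Ioc_self, Finset.sum_empty, measureReal_eq_zero_iff] at h1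
    rw [Measure.restrict_eq_zero.2 h1, integral_zero_measure]
  obtain ⟨j, hj⟩ : ∃ j, ν t = j := ⟨_, rfl⟩
  -- from the last jump to `t`
  have hlast : ∀ {t : ℝ≥0}, t ≤ b → ∀ {j : ℕ}, ν t = j →
      (y (arrivalTime ν j) - y₀
      = ∫ w in Ioc 0 (arrivalTime ν j), C.drift (Function.leftLim y w) ∂lebNN
        + (∫ w in Ioc 0 (arrivalTime ν j), (C.α₀ + C.form (Function.leftLim y w)) ∂μ) • C.e) →
      y t - y₀ = ∫ w in Ioc 0 t, C.drift (Function.leftLim y w) ∂lebNN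
        + (∫ w in Ioc 0 t, (C.α₀ + C.form (Function.leftLim y w)) ∂μ) • C.e := by
    intro t htb j hj h
    have hat : arrivalTime ν j ≤ t := (hν.arrivalTime_le_iff hj.ge).2 hj.ge
    have hνa : ν (arrivalTime ν j) = j := hν.apply_arrivalTime hj.ge
    rw [hsplit₁ _ _ hat htb, hsplit₂ _ _ hat htb, hzero _ _ hat htb (hνa.trans hj.symm),
      add_zero, integral_drift_solution hat (j := j) fun w h1 h2 ↦
        le_antisymm (hj ▸ hν.mono h2.le) (hνa ▸ hν.mono h1)]
    have h1 : y t = expFlow C (t - arrivalTime ν j) (jumpValue ν C z y₀ j) := by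
      rw [hy, solution, hj]
    have h2 : y (arrivalTime ν j)
        = expFlow C (arrivalTime ν j - arrivalTime ν j) (jumpValue ν C z y₀ j) := by
      rw [hy, solution, hνa]
    rw [h2] at h
    rw [h1, add_right_comm, ← h]
    abel
  induction j generalizing t with
  | zero =>
    refine hlast htb hj ?_
    have h0 : arrivalTime ν 0 = 0 := by simp [arrivalTime]
    simp [h0, hy, solution, hν.zero, jumpValue, expFlow_zero]
  | succ j ih =>
    refine hlast htb hj ?_
    set u := arrivalTime ν (j + 1) with hu
    have hut : u ≤ t := (hν.arrivalTime_le_iff hj.ge).2 hj.ge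
    have hνu : ν u = j + 1 := hν.apply_arrivalTime hj.ge
    have hvu : arrivalTime ν j < u := hν.arrivalTime_lt hj.ge
    set v := arrivalTime ν j with hv
    have hνv : ν v = j := hν.apply_arrivalTime (T := t) (by omega)
    have hc : ∀ w, v ≤ w → w < u → ν w = j := by
      intro w h1 h2
      have h3 : j ≤ ν w := hνv ▸ hν.mono h1
      have h4 : ν w < j + 1 := (hν.lt_arrivalTime_iff hj.ge).1 h2
      omega
    have hub := hut.trans htb
    have hvb := hvu.le.trans hub
    have hpos : 0 < u := zero_le.trans_lt hvu
    have hleft : Function.leftLim y u = expFlow C (u - v) (jumpValue ν C z y₀ j) := by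
      refine solution_leftLim hpos ?_
      filter_upwards [Ioo_mem_nhdsLT hvu] with w hw
      exact hc w hw.1.le hw.2
    have hjump : ∫ w in Ioc v u, (C.α₀ + C.form (Function.leftLim y w)) ∂μ
        = z (j + 1) ^ 2 * (C.α₀ + C.form (Function.leftLim y u)) := by
      have hμ0 : μ (Ioo v u) = 0 := by
        simp only [hμ, jumpMeasure, Measure.coe_finsetSum, Finset.sum_apply, Measure.smul_apply,
          smul_eq_mul]
        refine Finset.sum_eq_zero fun n hn ↦ ?_
        rw [Measure.dirac_apply' _ measurableSet_Ioo, indicator_of_notMem, mul_zero]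
        intro h1
        have h2 := hc _ h1.1.le h1.2
        rw [hν.apply_arrivalTime (Finset.mem_Icc.1 hn).2] at h2
        rw [h2] at h1
        exact h1.1.false
      have hae : ∀ᵐ w ∂μ, w ∈ Ioc v u → C.α₀ + C.form (Function.leftLim y w)
          = C.α₀ + C.form (Function.leftLim y u) := by
        filter_upwards [measure_eq_zero_iff_ae_notMem.1 hμ0] with w hw hwu
        have : w = u := by
          by_contra hne
          exact hw ⟨hwu.1, lt_of_le_of_ne hwu.2 hne⟩
        rw [this]
      rw [setIntegral_congr_ae measurableSet_Ioc hae, setIntegral_const,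
        hν.jumpMeasure_sq_real_Ioc hub, hνv, hνu, smul_eq_mul]
      simp
    have hyv : y v = jumpValue ν C z y₀ j := by
      rw [hy, solution, hνv, ← hv, sub_self, expFlow_zero]
    have hyu : y u = jumpValue ν C z y₀ (j + 1) := by
      rw [hy, solution, hνu, ← hu, sub_self, expFlow_zero]
    rw [hsplit₁ _ _ hvu.le hub, hsplit₂ _ _ hvu.le hub, hjump,
      integral_drift_solution hvu.le hc, hleft, ← hv, sub_self, expFlow_zero, hyu]
    have h5 := ih hvb hνv
    rw [hyv] at h5
    have h6 : jumpValue ν C z y₀ (j + 1) = expFlow C (u - v) (jumpValue ν C z y₀ j)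
        + (z (j + 1) ^ 2 * (C.α₀ + C.form (expFlow C (u - v) (jumpValue ν C z y₀ j)))) • C.e := rfl
    rw [h6, add_smul, add_add_add_comm, ← h5]
    abel

/-- From every initial value, the Euler schemes converge. -/
theorem exists_eulerLimit (C : CogarchParams k q) (z : ℕ → ℝ) (y₀ : Fin q → ℝ) (T : ℝ≥0) :
    ∃ y₁, EulerLimit C.drift C.form C.α₀ C.e ν z 0 T y₀ y₁ := by
  have h0 : solution ν C z y₀ 0 = y₀ := by
    have h0 : arrivalTime ν 0 = 0 := by simp [arrivalTime]
    simp [solution, hν.zero, jumpValue, expFlow_zero, h0]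
  have h1 := hν.eulerLimit_of_sub (C := C) (z := z) (hν.isCadlag_solution (z := z) (y₀ := y₀)) 0 T
    fun t ht ↦ by rw [h0]; exact hν.solution_sub _ ht
  rw [h0] at h1
  exact ⟨_, h1⟩

end IsCountingPath

/-! ### Iterated random contractions -/

section RandomContraction

variable {E : Type*} [NormedAddCommGroup E] [NormedSpace ℝ E] [MeasurableSpace E]
  {Ω : Type*} [MeasurableSpace Ω]

/-- A random map `Φ(·, ω)` that is Lipschitz with constant `H ω` for the seminorm `p` (which is
equivalent to the norm) and of growth `H ω p(y) + B ω`, where `E H^s < 1` and `E B^s < ∞` for some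
exponent `s ∈ (0, 1]`. -/
structure IsRandomContraction (P : Measure Ω) (p : Seminorm ℝ E) (Φ : E × Ω → E) (H B : Ω → ℝ)
    (s : ℝ) : Prop where
  measurable : Measurable Φ
  norm_le : ∃ M, 0 < M ∧ ∀ x, ‖x‖ ≤ M * p x
  le_norm : ∃ M, 0 < M ∧ ∀ x, p x ≤ M * ‖x‖
  s_pos : 0 < s
  s_le_one : s ≤ 1
  H_nonneg : ∀ ω, 0 ≤ H ω
  B_nonneg : ∀ ω, 0 ≤ B ω
  sub_le : ∀ ω y y', p (Φ (y, ω) - Φ (y', ω)) ≤ H ω * p (y - y')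
  le : ∀ ω y, p (Φ (y, ω)) ≤ H ω * p y + B ω
  H_integrable : Integrable (fun ω ↦ H ω ^ s) P
  B_integrable : Integrable (fun ω ↦ B ω ^ s) P
  H_lt : ∫ ω, H ω ^ s ∂P < 1

/-- `f` is bounded by `M`, and `s`-Hölder continuous with constant `L` for the seminorm `p`. -/
structure IsBddHolder (p : Seminorm ℝ E) (s L M : ℝ) (f : E → ℝ) : Prop where
  bdd : ∀ y, |f y| ≤ M
  holder : ∀ y y', |f y - f y'| ≤ L * p (y - y') ^ s

/-- The law of `Φ(Y, ω)` for `Y` with law `μ` and independent of `ω`. -/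
def evolve (P : Measure Ω) (Φ : E × Ω → E) (μ : Measure E) : Measure E := (μ.prod P).map Φ

/-- The average of `f ∘ Φ(·, ω)`: the dual of `evolve`. -/
def avg (P : Measure Ω) (Φ : E × Ω → E) (f : E → ℝ) (y : E) : ℝ := ∫ ω, f (Φ (y, ω)) ∂P

omit [MeasurableSpace E] in
lemma isBddHolder_of_lipschitz {p : Seminorm ℝ E} (hp : ∃ M, 0 < M ∧ ∀ x, ‖x‖ ≤ M * p x) {s : ℝ}
    (hs1 : s ≤ 1) (hs : 0 < s) {f : E → ℝ} {K : ℝ≥0} (hf : LipschitzWith K f) {M : ℝ}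
    (hM : ∀ y, |f y| ≤ M) :
    ∃ L, 0 ≤ L ∧ IsBddHolder p s L M f := by
  obtain ⟨c, hc, h⟩ := hp
  have hM0 : 0 ≤ M := (abs_nonneg _).trans (hM 0)
  refine ⟨K * c + 2 * M, by positivity, hM, fun y y' ↦ ?_⟩
  set x := p (y - y') with hx
  have hx0 : 0 ≤ x := apply_nonneg p _
  have h1 : |f y - f y'| ≤ K * (c * x) := by
    have := hf.dist_le_mul y y'
    rw [Real.dist_eq, dist_eq_norm] at this
    exact this.trans (mul_le_mul_of_nonneg_left (h _) K.2)
  have h2 : |f y - f y'| ≤ 2 * M := by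
    have := abs_sub (f y) (f y')
    linarith [hM y, hM y']
  have hxs : 0 ≤ x ^ s := Real.rpow_nonneg hx0 s
  have hK : (0 : ℝ) ≤ K := K.2
  rcases le_total x 1 with h3 | h3
  · have h4 : x ≤ x ^ s := by
      simpa using Real.rpow_le_rpow_of_exponent_ge_of_imp hx0 h3 hs1 (by intro _ h; simp at h)
    calc _ ≤ K * (c * x) := h1
      _ ≤ K * c * x ^ s := by rw [← mul_assoc]; gcongr
      _ ≤ _ := by nlinarith
  · have h4 : 1 ≤ x ^ s := Real.one_le_rpow h3 hs.le
    calc _ ≤ 2 * M * 1 := by linarith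
      _ ≤ 2 * M * x ^ s := by gcongr
      _ ≤ _ := by
        have : 0 ≤ K * c * x ^ s := by positivity
        linarith

variable {P : Measure Ω} {p : Seminorm ℝ E} {Φ : E × Ω → E} {H B : Ω → ℝ}
  {s : ℝ} {L M : ℝ} {f : E → ℝ}

namespace IsRandomContraction

variable (h : IsRandomContraction P p Φ H B s)
include h

lemma continuous_seminorm_rpow : Continuous fun x ↦ p x ^ s := by
  obtain ⟨c, hc, h1⟩ := h.le_norm
  have : Continuous p := by
    refine Seminorm.continuous_of_continuousAt_zero ?_
    rw [ContinuousAt, map_zero]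
    refine squeeze_zero (fun x ↦ apply_nonneg p x) h1 ?_
    have : Continuous fun x : E ↦ c * ‖x‖ := by fun_prop
    simpa using this.tendsto 0
  exact this.rpow_const fun x ↦ Or.inr h.s_pos.le

lemma continuous_of_isBddHolder (hf : IsBddHolder p s L M f) : Continuous f := by
  refine continuous_iff_continuousAt.2 fun x ↦ ?_
  rw [ContinuousAt, tendsto_iff_norm_sub_tendsto_zero]
  refine squeeze_zero (fun y ↦ norm_nonneg _) (fun y ↦
    (Real.norm_eq_abs _).le.trans (hf.holder y x)) ?_
  have h1 : Continuous fun y ↦ L * p (y - x) ^ s :=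
    (h.continuous_seminorm_rpow.comp (continuous_id.sub continuous_const)).const_mul L
  have h2 := h1.tendsto x
  simpa [Real.zero_rpow h.s_pos.ne'] using h2

lemma measurable_comp (hf : Measurable f) (y : E) : Measurable fun ω ↦ f (Φ (y, ω)) :=
  hf.comp (h.measurable.comp measurable_prodMk_left)

variable [IsProbabilityMeasure P]

lemma isProbabilityMeasure_evolve (μ : Measure E) [IsProbabilityMeasure μ] :
    IsProbabilityMeasure (evolve P Φ μ) :=
  Measure.isProbabilityMeasure_map h.measurable.aemeasurable

lemma isProbabilityMeasure_evolve_iterate (μ : Measure E) [hμ : IsProbabilityMeasure μ] (m : ℕ) :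
    IsProbabilityMeasure ((evolve P Φ)^[m] μ) := by
  induction m with
  | zero => exact hμ
  | succ m ih => rw [Function.iterate_succ_apply']; exact h.isProbabilityMeasure_evolve _

variable [BorelSpace E]

lemma integrable_comp (hf : IsBddHolder p s L M f) (y : E) :
    Integrable (fun ω ↦ f (Φ (y, ω))) P :=
  Integrable.of_bound (h.measurable_comp (h.continuous_of_isBddHolder hf).measurable y).aestronglyMeasurable
    M (Eventually.of_forall fun ω ↦ by rw [Real.norm_eq_abs]; exact hf.bdd _)

lemma isBddHolder_avg (hL : 0 ≤ L) (hf : IsBddHolder p s L M f) :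
    IsBddHolder p s ((∫ ω, H ω ^ s ∂P) * L) M (avg P Φ f) := by
  constructor
  · intro y
    have := norm_integral_le_of_norm_le_const (μ := P) (f := fun ω ↦ f (Φ (y, ω))) (C := M)
      (Eventually.of_forall fun ω ↦ by rw [Real.norm_eq_abs]; exact hf.bdd _)
    simpa [avg] using this
  · intro y y'
    rw [avg, avg, ← integral_sub (h.integrable_comp hf y) (h.integrable_comp hf y'),
      ← Real.norm_eq_abs, mul_assoc, ← integral_mul_const]
    refine norm_integral_le_of_norm_le (h.H_integrable.mul_const _)
      (Eventually.of_forall fun ω ↦ ?_)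
    rw [Real.norm_eq_abs]
    have h1 : p (Φ (y, ω) - Φ (y', ω)) ^ s ≤ H ω ^ s * p (y - y') ^ s := by
      rw [← Real.mul_rpow (h.H_nonneg ω) (apply_nonneg p _)]
      exact Real.rpow_le_rpow (apply_nonneg p _) (h.sub_le ω y y') h.s_pos.le
    calc _ ≤ L * p (Φ (y, ω) - Φ (y', ω)) ^ s := hf.holder _ _
      _ ≤ L * (H ω ^ s * p (y - y') ^ s) := mul_le_mul_of_nonneg_left h1 hL
      _ = _ := by ring

lemma isBddHolder_avg_iterate (hL : 0 ≤ L) (hf : IsBddHolder p s L M f) (m : ℕ) :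
    IsBddHolder p s ((∫ ω, H ω ^ s ∂P) ^ m * L) M ((avg P Φ)^[m] f) := by
  have h0 : 0 ≤ ∫ ω, H ω ^ s ∂P := integral_nonneg fun ω ↦ Real.rpow_nonneg (h.H_nonneg ω) s
  induction m with
  | zero => simpa using hf
  | succ m ih =>
    rw [Function.iterate_succ_apply', pow_succ', mul_assoc]
    exact h.isBddHolder_avg (by positivity) ih

lemma integral_evolve (hf : IsBddHolder p s L M f) (μ : Measure E) [IsProbabilityMeasure μ] :
    ∫ y, f y ∂(evolve P Φ μ) = ∫ y, avg P Φ f y ∂μ := by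
  have hfm := (h.continuous_of_isBddHolder hf).measurable
  rw [evolve, integral_map h.measurable.aemeasurable hfm.aestronglyMeasurable, integral_prod]
  · rfl
  · exact Integrable.of_bound (hfm.comp h.measurable).aestronglyMeasurable M
      (Eventually.of_forall fun ω ↦ by rw [Real.norm_eq_abs]; exact hf.bdd _)

lemma integral_evolve_iterate (hL : 0 ≤ L) (hf : IsBddHolder p s L M f) (m : ℕ) (μ : Measure E)
    [hμ : IsProbabilityMeasure μ] :
    ∫ y, f y ∂((evolve P Φ)^[m] μ) = ∫ y, (avg P Φ)^[m] f y ∂μ := by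
  induction m generalizing μ with
  | zero => rfl
  | succ m ih =>
    have := h.isProbabilityMeasure_evolve μ
    rw [Function.iterate_succ_apply, ih, Function.iterate_succ_apply',
      h.integral_evolve (h.isBddHolder_avg_iterate hL hf m)]

/-- The influence of the initial law vanishes. -/
lemma tendsto_integral_sub (hL : 0 ≤ L) (hf : IsBddHolder p s L M f) (μ : Measure E)
    [hμ : IsProbabilityMeasure μ] :
    Tendsto (fun m ↦ ∫ y, f y ∂((evolve P Φ)^[m] μ) - (avg P Φ)^[m] f 0) atTop (𝓝 0) := by
  have h0 : 0 ≤ ∫ ω, H ω ^ s ∂P := integral_nonneg fun ω ↦ Real.rpow_nonneg (h.H_nonneg ω) s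
  have hg := h.isBddHolder_avg_iterate hL hf
  have hmeas : ∀ m, Measurable ((avg P Φ)^[m] f) := fun m ↦
    (h.continuous_of_isBddHolder (hg m)).measurable
  have h1 := tendsto_integral_of_dominated_convergence (μ := μ) (f := fun _ ↦ (0 : ℝ))
    (F := fun m y ↦ (avg P Φ)^[m] f y - (avg P Φ)^[m] f 0) (fun _ ↦ M + M)
    (fun m ↦ ((hmeas m).sub_const _).aestronglyMeasurable) (integrable_const _)
    (fun m ↦ Eventually.of_forall fun y ↦ by
      rw [Real.norm_eq_abs]
      exact (abs_sub _ _).trans (add_le_add ((hg m).bdd _) ((hg m).bdd _)))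
    (Eventually.of_forall fun y ↦ ?_)
  · rw [integral_zero] at h1
    refine h1.congr fun m ↦ ?_
    rw [h.integral_evolve_iterate hL hf, integral_sub _ (integrable_const _)]
    · simp
    · exact Integrable.of_bound (hmeas m).aestronglyMeasurable M
        (Eventually.of_forall fun y ↦ by rw [Real.norm_eq_abs]; exact (hg m).bdd _)
  · refine squeeze_zero_norm (fun m ↦ (Real.norm_eq_abs _).le.trans ((hg m).holder y 0)) ?_
    have := ((tendsto_pow_atTop_nhds_zero_of_lt_one h0 h.H_lt).mul_const L).mul_const
      (p (y - 0) ^ s)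
    simpa using this

lemma lintegral_evolve_iterate_le (m : ℕ) :
    ∫⁻ y, ENNReal.ofReal (p y ^ s) ∂((evolve P Φ)^[m] (Measure.dirac 0))
      ≤ ENNReal.ofReal ((∫ ω, B ω ^ s ∂P) / (1 - ∫ ω, H ω ^ s ∂P)) := by
  set r := ∫ ω, H ω ^ s ∂P with hr
  set b := ∫ ω, B ω ^ s ∂P with hb
  have hr0 : 0 ≤ r := integral_nonneg fun ω ↦ Real.rpow_nonneg (h.H_nonneg ω) s
  have hb0 : 0 ≤ b := integral_nonneg fun ω ↦ Real.rpow_nonneg (h.B_nonneg ω) s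
  have hr1 : 0 < 1 - r := sub_pos.2 h.H_lt
  have hpm : Measurable fun y ↦ ENNReal.ofReal (p y ^ s) :=
    h.continuous_seminorm_rpow.measurable.ennreal_ofReal
  induction m with
  | zero => simp [lintegral_dirac' _ hpm, Real.zero_rpow h.s_pos.ne']
  | succ m ih =>
    have := h.isProbabilityMeasure_evolve_iterate (Measure.dirac 0) m
    set ν := (evolve P Φ)^[m] (Measure.dirac 0)
    rw [Function.iterate_succ_apply', evolve, lintegral_map hpm h.measurable,
      lintegral_prod _ (show Measurable fun a ↦ ENNReal.ofReal (p (Φ a) ^ s) from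
        hpm.comp h.measurable).aemeasurable]
    have h1 : ∀ y, ∫⁻ ω, ENNReal.ofReal (p (Φ (y, ω)) ^ s) ∂P
        ≤ ENNReal.ofReal r * ENNReal.ofReal (p y ^ s) + ENNReal.ofReal b := by
      intro y
      have h2 : ∀ ω, p (Φ (y, ω)) ^ s ≤ H ω ^ s * p y ^ s + B ω ^ s := fun ω ↦ by
        rw [← Real.mul_rpow (h.H_nonneg ω) (apply_nonneg p _)]
        exact (Real.rpow_le_rpow (apply_nonneg p _) (h.le ω y) h.s_pos.le).trans
          (Real.rpow_add_le_add_rpow (mul_nonneg (h.H_nonneg ω) (apply_nonneg p _))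
            (h.B_nonneg ω) h.s_pos.le h.s_le_one)
      refine (lintegral_mono fun ω ↦ ENNReal.ofReal_le_ofReal (h2 ω)).trans (le_of_eq ?_)
      rw [← ofReal_integral_eq_lintegral_ofReal (f := fun ω ↦ H ω ^ s * p y ^ s + B ω ^ s)
        ((h.H_integrable.mul_const _).add h.B_integrable) (Eventually.of_forall fun ω ↦
          add_nonneg (mul_nonneg (Real.rpow_nonneg (h.H_nonneg ω) s)
            (Real.rpow_nonneg (apply_nonneg p _) s)) (Real.rpow_nonneg (h.B_nonneg ω) s)),
        integral_add (h.H_integrable.mul_const _) h.B_integrable, integral_mul_const,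
        ENNReal.ofReal_add (mul_nonneg hr0 (Real.rpow_nonneg (apply_nonneg p _) s)) hb0,
        ENNReal.ofReal_mul hr0]
    refine (lintegral_mono h1).trans ?_
    rw [lintegral_add_right _ measurable_const, lintegral_const_mul _ hpm, lintegral_const,
      measure_univ, mul_one]
    calc ENNReal.ofReal r * ∫⁻ y, ENNReal.ofReal (p y ^ s) ∂ν + ENNReal.ofReal b
        ≤ ENNReal.ofReal r * ENNReal.ofReal (b / (1 - r)) + ENNReal.ofReal b := by gcongr
      _ = ENNReal.ofReal (b / (1 - r)) := by
        rw [← ENNReal.ofReal_mul hr0, ← ENNReal.ofReal_add (by positivity) hb0]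
        congr 1
        field_simp
        ring

variable [FiniteDimensional ℝ E]

/-- The iterates started at `0` have bounded moments of order `s`, hence they are tight by Markov's
inequality. -/
lemma isTightMeasureSet : IsTightMeasureSet
    (range fun m ↦ (evolve P Φ)^[m] (Measure.dirac (0 : E))) := by
  have : ProperSpace E := FiniteDimensional.proper ℝ E
  obtain ⟨c, hc, hcp⟩ := h.norm_le
  set K := (∫ ω, B ω ^ s ∂P) / (1 - ∫ ω, H ω ^ s ∂P) with hK
  have hpm : Measurable fun y ↦ ENNReal.ofReal (p y ^ s) :=
    h.continuous_seminorm_rpow.measurable.ennreal_ofReal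
  rw [isTightMeasureSet_iff_tendsto_measure_norm_gt]
  have h1 : Tendsto (fun r : ℝ ↦ ENNReal.ofReal K / ENNReal.ofReal ((r / c) ^ s)) atTop (𝓝 0) := by
    have h2 : Tendsto (fun r : ℝ ↦ ENNReal.ofReal ((r / c) ^ s)) atTop (𝓝 ∞) :=
      ENNReal.tendsto_ofReal_atTop.comp ((tendsto_rpow_atTop h.s_pos).comp
        (tendsto_id.atTop_div_const hc))
    simpa using ENNReal.Tendsto.const_div h2 (Or.inr ENNReal.ofReal_ne_top)
  refine tendsto_of_tendsto_of_tendsto_of_le_of_le' tendsto_const_nhds h1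
    (Eventually.of_forall fun _ ↦ zero_le) ?_
  filter_upwards [eventually_gt_atTop 0] with r hr
  refine iSup₂_le ?_
  rintro _ ⟨m, rfl⟩
  have hpos : 0 < (r / c) ^ s := Real.rpow_pos_of_pos (div_pos hr hc) s
  rw [ENNReal.le_div_iff_mul_le (Or.inl (ENNReal.ofReal_pos.2 hpos).ne')
    (Or.inl ENNReal.ofReal_ne_top), mul_comm]
  refine le_trans ?_ (h.lintegral_evolve_iterate_le m)
  refine le_trans ?_ (mul_meas_ge_le_lintegral hpm (ENNReal.ofReal ((r / c) ^ s)))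
  refine mul_le_mul_right (measure_mono fun x hx ↦ ENNReal.ofReal_le_ofReal ?_) _
  change r < _ at hx
  refine Real.rpow_le_rpow (by positivity) ?_ h.s_pos.le
  rw [div_le_iff₀ hc, mul_comm]
  exact hx.le.trans (hcp _)

/-- An iterated random contraction has a unique invariant law, to which it converges from every
initial law. -/
theorem exists_invariant : ∃ U : ProbabilityMeasure E, evolve P Φ U = U ∧
    ∀ (μ : Measure E) [IsProbabilityMeasure μ],
      Tendsto (β := ProbabilityMeasure E)
        (fun m ↦ ⟨(evolve P Φ)^[m] μ, h.isProbabilityMeasure_evolve_iterate μ m⟩) atTop (𝓝 U) := by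
  let ν : ℕ → ProbabilityMeasure E := fun m ↦
    ⟨(evolve P Φ)^[m] (Measure.dirac 0), h.isProbabilityMeasure_evolve_iterate _ m⟩
  have h_compact : IsCompact (closure (range ν)) := by
    refine isCompact_closure_of_isTightMeasureSet (h.isTightMeasureSet.subset ?_)
    rintro _ ⟨_, ⟨m, rfl⟩, rfl⟩
    exact ⟨m, rfl⟩
  let 𝒰 : Ultrafilter ℕ := hyperfilter ℕ
  have h𝒰 : (𝒰 : Filter ℕ) ≤ atTop := by
    rw [← Nat.cofinite_eq_atTop]; exact hyperfilter_le_cofinite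
  obtain ⟨U, -, hU⟩ := h_compact.ultrafilter_le_nhds (𝒰.map ν)
    (le_principal_iff.2 (mem_map.2 (Eventually.of_forall fun m ↦ subset_closure ⟨m, rfl⟩)))
  have hU : Tendsto ν 𝒰 (𝓝 U) := hU
  have hUp : IsProbabilityMeasure (evolve P Φ (U : Measure E)) := h.isProbabilityMeasure_evolve _
  -- test functions
  have hint : ∀ {f : E → ℝ} {L M : ℝ}, IsBddHolder p s L M f →
      Tendsto (fun m ↦ ∫ y, f y ∂(ν m : Measure E)) 𝒰 (𝓝 (∫ y, f y ∂(U : Measure E))) := by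
    intro f L M hf
    exact ProbabilityMeasure.tendsto_iff_forall_integral_tendsto.1 hU
      (BoundedContinuousFunction.ofNormedAddCommGroup f (h.continuous_of_isBddHolder hf) M
        fun y ↦ by rw [Real.norm_eq_abs]; exact hf.bdd y)
  have hinv : ∀ {f : E → ℝ} {L M : ℝ}, 0 ≤ L → IsBddHolder p s L M f →
      ∫ y, f y ∂(evolve P Φ (U : Measure E)) = ∫ y, f y ∂(U : Measure E) := by
    intro f L M hL hf
    have h1 := hint (h.isBddHolder_avg hL hf)
    rw [← h.integral_evolve hf] at h1
    have h2 := hint hf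
    have hp1 := h.isProbabilityMeasure_evolve (Measure.dirac (0 : E))
    have h3 := ((h.tendsto_integral_sub hL hf (evolve P Φ (Measure.dirac 0))).sub
      (h.tendsto_integral_sub hL hf (Measure.dirac 0))).mono_left h𝒰
    have h4 := h1.sub h2
    refine sub_eq_zero.1 (tendsto_nhds_unique (h4.congr fun m ↦ ?_) (by simpa using h3))
    have hp2 := (ν m).2
    rw [← h.integral_evolve hf, ← Function.iterate_succ_apply, Function.iterate_succ_apply']
    rfl
  have hUeq : evolve P Φ (U : Measure E) = U := by
    have h1 : Tendsto (fun _ : ℕ ↦ U) atTop (𝓝 (⟨_, hUp⟩ : ProbabilityMeasure E)) := by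
      refine tendsto_iff_forall_lipschitz_integral_tendsto.2 ?_
      rintro f ⟨C, hC⟩ ⟨K, hK⟩
      have hb : ∀ y, |f y| ≤ |f 0| + C := fun y ↦ by
        have h1 := hC y 0
        rw [Real.dist_eq] at h1
        linarith [abs_sub_abs_le_abs_sub (f y) (f 0)]
      obtain ⟨L, hL, hf⟩ := isBddHolder_of_lipschitz h.norm_le h.s_le_one h.s_pos hK hb
      have := hinv hL hf
      simp only [ProbabilityMeasure.coe_mk]
      rw [this]
      exact tendsto_const_nhds
    exact (congrArg ((↑) : ProbabilityMeasure E → Measure E)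
      (tendsto_nhds_unique tendsto_const_nhds h1)).symm
  refine ⟨U, hUeq, fun μ hμ ↦ tendsto_iff_forall_lipschitz_integral_tendsto.2 ?_⟩
  rintro f ⟨C, hC⟩ ⟨K, hK⟩
  have hb : ∀ y, |f y| ≤ |f 0| + C := fun y ↦ by
    have h1 := hC y 0
    rw [Real.dist_eq] at h1
    linarith [abs_sub_abs_le_abs_sub (f y) (f 0)]
  obtain ⟨L, hL, hf⟩ := isBddHolder_of_lipschitz h.norm_le h.s_le_one h.s_pos hK hb
  have h1 := (h.tendsto_integral_sub hL hf μ).sub (h.tendsto_integral_sub hL hf (U : Measure E))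
  have h2 : ∀ m, (evolve P Φ)^[m] (U : Measure E) = U := fun m ↦
    Function.iterate_fixed hUeq m
  simp only [h2, sub_sub_sub_cancel_right] at h1
  simpa using h1.add_const (∫ y, f y ∂(U : Measure E))

end IsRandomContraction

end RandomContraction

/-! ### Independence -/

section Independence

variable {Ω : Type*} [MeasurableSpace Ω] {P : Measure Ω}

/-- Regrouping four random elements. -/
lemma IndepFun.prodMk_swap [IsProbabilityMeasure P] {α β γ δ : Type*} [MeasurableSpace α]
    [MeasurableSpace β] [MeasurableSpace γ] [MeasurableSpace δ] {a : Ω → α} {b : Ω → β} {c : Ω → γ}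
    {d : Ω → δ} (ha : Measurable a) (hb : Measurable b) (hc : Measurable c) (hd : Measurable d)
    (h : IndepFun (fun ω ↦ (a ω, b ω)) (fun ω ↦ (c ω, d ω)) P) (hab : IndepFun a b P)
    (hcd : IndepFun c d P) :
    IndepFun (fun ω ↦ (a ω, c ω)) (fun ω ↦ (b ω, d ω)) P := by
  have hac : IndepFun a c P := h.comp measurable_fst measurable_fst
  have hbd : IndepFun b d P := h.comp measurable_snd measurable_snd
  rw [indepFun_iff_map_prod_eq_prod_map_map (by fun_prop) (by fun_prop)] at h hab hcd hac hbd ⊢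
  rw [hac, hbd]
  rw [hab, hcd] at h
  have hpa := Measure.isProbabilityMeasure_map (μ := P) ha.aemeasurable
  have hpb := Measure.isProbabilityMeasure_map (μ := P) hb.aemeasurable
  have hpc := Measure.isProbabilityMeasure_map (μ := P) hc.aemeasurable
  have hpd := Measure.isProbabilityMeasure_map (μ := P) hd.aemeasurable
  let e : (α × β) × (γ × δ) → (α × γ) × (β × δ) := fun x ↦ ((x.1.1, x.2.1), (x.1.2, x.2.2))
  have he : Measurable e := by fun_prop
  have h1 : P.map (fun ω ↦ ((a ω, c ω), (b ω, d ω)))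
      = (((P.map a).prod (P.map b)).prod ((P.map c).prod (P.map d))).map e := by
    rw [← h, Measure.map_map he (by fun_prop)]
    rfl
  rw [h1]
  refine Measure.prod_eq_generateFrom (C := image2 (· ×ˢ ·) {s | MeasurableSet s} {t | MeasurableSet t})
    (D := image2 (· ×ˢ ·) {s | MeasurableSet s} {t | MeasurableSet t})
    generateFrom_prod generateFrom_prod isPiSystem_prod isPiSystem_prod
    ⟨fun _ ↦ univ, fun _ ↦ ⟨univ, .univ, univ, .univ, univ_prod_univ⟩, fun _ ↦ measure_lt_top _ _,
      iUnion_const _⟩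
    ⟨fun _ ↦ univ, fun _ ↦ ⟨univ, .univ, univ, .univ, univ_prod_univ⟩, fun _ ↦ measure_lt_top _ _,
      iUnion_const _⟩ ?_ |>.symm
  rintro _ ⟨A, hA, C, hC, rfl⟩ _ ⟨B, hB, D, hD, rfl⟩
  have hpre : e ⁻¹' ((A ×ˢ C) ×ˢ (B ×ˢ D)) = (A ×ˢ B) ×ˢ (C ×ˢ D) := by
    ext x
    simp only [e, mem_preimage, mem_prod]
    tauto
  simp only [mem_ofPred_eq] at hA hB hC hD
  rw [Measure.map_apply he ((hA.prod hC).prod (hB.prod hD)), hpre]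
  simp only [Measure.prod_prod]
  ring

lemma IndepFun.prodMk_left [IsProbabilityMeasure P] {α β γ : Type*} [MeasurableSpace α]
    [MeasurableSpace β] [MeasurableSpace γ] {a : Ω → α} {b : Ω → β} {c : Ω → γ}
    (ha : Measurable a) (hb : Measurable b) (hc : Measurable c)
    (h : IndepFun a (fun ω ↦ (b ω, c ω)) P) (hbc : IndepFun b c P) :
    IndepFun (fun ω ↦ (a ω, b ω)) c P := by
  have h1 := IndepFun.prodMk_swap (a := a) (b := fun _ ↦ ()) (c := b) (d := c) ha
    measurable_const hb hc
    (h.comp (φ := fun x ↦ (x, ())) (ψ := id) (by fun_prop) measurable_id)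
    (indepFun_const_right a ()) hbc
  exact h1.comp measurable_id measurable_snd

end Independence

/-! ### Restarting a Poisson process -/

/-- A finite set of times is listed by a nondecreasing sequence that starts at `0`; by this,
statements about arbitrary finite families of times reduce to independent increments. -/
lemma exists_monotone_enumeration (I : Finset ℝ≥0) : ∃ (b : ℕ → ℝ≥0) (n : ℕ), Monotone b ∧ b 0 = 0 ∧
    (∀ x ∈ I, ∃ i ≤ n, b i = x) ∧ ∀ i, b i = 0 ∨ b i ∈ I := by
  classical
  set J := insert 0 I with hJ
  have hpos : 0 < J.card := Finset.card_pos.2 ⟨0, Finset.mem_insert_self _ _⟩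
  let e := J.orderEmbOfFin rfl
  let b : ℕ → ℝ≥0 := fun i ↦ e ⟨min i (J.card - 1), by omega⟩
  have hb : ∀ i, b i ∈ J := fun i ↦ J.orderEmbOfFin_mem rfl _
  have hbm : Monotone b := fun i j hij ↦ e.monotone (by
    simp only [Fin.mk_le_mk]
    omega)
  have hsurj : ∀ x ∈ J, ∃ i ≤ J.card, b i = x := by
    intro x hx
    have : x ∈ range e := by rw [Finset.range_orderEmbOfFin]; exact hx
    obtain ⟨i, rfl⟩ := this
    refine ⟨i, i.2.le, ?_⟩
    simp only [b]
    congr 1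
    ext
    simp only
    omega
  refine ⟨b, J.card, hbm, ?_, fun x hx ↦ hsurj x (Finset.mem_insert_of_mem hx), fun i ↦ by
    simpa [hJ] using hb i⟩
  obtain ⟨i, -, hi⟩ := hsurj 0 (Finset.mem_insert_self _ _)
  exact le_antisymm (hi ▸ hbm (Nat.zero_le i)) zero_le

namespace IsPoissonProcess

variable {Ω : Type*} [MeasurableSpace Ω] {P : Measure Ω} {Λ : ℝ≥0 → ℝ} {N : ℝ≥0 → Ω → ℕ}
  (h : IsPoissonProcess Λ N P)
include h

lemma isCountingPath (ω : Ω) : IsCountingPath fun t ↦ N t ω :=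
  ⟨h.zero ω, h.mono ω, h.right_cont ω, h.jump_le ω⟩

lemma sum_increments {b : ℕ → ℝ≥0} (hb : Monotone b) (ω : Ω) (k : ℕ) :
    ∑ i ∈ Finset.range k, (N (b (i + 1)) ω - N (b i) ω) = N (b k) ω - N (b 0) ω :=
  Finset.sum_range_tsub ((h.mono ω).comp hb) k

/-- The increments after time `τ` are distributed as the process itself, if the mean function has
the same increments after time `τ`. -/
lemma map_shift (τ : ℝ≥0) (hΛ : ∀ s t, s ≤ t → Λ (τ + t) - Λ (τ + s) = Λ t - Λ s)
    [IsProbabilityMeasure P] :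
    P.map (fun ω t ↦ N (τ + t) ω - N τ ω) = P.map (fun ω t ↦ N t ω) := by
  have hm := h.measurable
  refine (map_eq_iff_forall_finset_map_restrict_eq
    (X := fun t ω ↦ N (τ + t) ω - N τ ω) (Y := N)
    (measurable_pi_lambda _ fun t ↦ (hm _).sub (hm _)).aemeasurable
    (measurable_pi_lambda _ hm).aemeasurable).2 fun I ↦ ?_
  obtain ⟨b, n, hb, hb0, hI, -⟩ := exists_monotone_enumeration I
  choose! idx hidx hbidx using hI
  let g : (ℕ → ℕ) → (I → ℕ) := fun x t ↦ ∑ i ∈ Finset.range (idx t), x i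
  have hg : Measurable g := by fun_prop
  have hb' : Monotone fun i ↦ τ + b i := fun i j hij ↦ add_le_add_right (hb hij) τ
  have h1 : (fun ω ↦ I.restrict fun t ↦ N (τ + t) ω - N τ ω)
      = g ∘ fun ω i ↦ N (τ + b (i + 1)) ω - N (τ + b i) ω := by
    ext ω t
    simp only [Function.comp_apply, g, Finset.restrict_def]
    rw [h.sum_increments hb' ω, hb0, add_zero, hbidx t t.2]
  have h2 : (fun ω ↦ I.restrict fun t ↦ N t ω) = g ∘ fun ω i ↦ N (b (i + 1)) ω - N (b i) ω := by
    ext ω t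
    simp only [Function.comp_apply, g, Finset.restrict_def]
    rw [h.sum_increments hb ω, hb0, h.zero, hbidx t t.2, tsub_zero]
  have hm1 : ∀ i, Measurable fun ω ↦ N (τ + b (i + 1)) ω - N (τ + b i) ω :=
    fun i ↦ (hm _).sub (hm _)
  have hm2 : ∀ i, Measurable fun ω ↦ N (b (i + 1)) ω - N (b i) ω := fun i ↦ (hm _).sub (hm _)
  rw [h1, h2, ← Measure.map_map hg (measurable_pi_lambda _ hm1),
    ← Measure.map_map hg (measurable_pi_lambda _ hm2),
    (iIndepFun_iff_map_fun_eq_infinitePi_map hm1).1 (h.indep.nat hb'),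
    (iIndepFun_iff_map_fun_eq_infinitePi_map hm2).1 (h.indep.nat hb)]
  congr 2
  funext i
  rw [h.law _ _ (hb' (Nat.le_succ i)), h.law _ _ (hb (Nat.le_succ i)), hΛ _ _ (hb (Nat.le_succ i))]

/-- The process up to time `τ` is independent of the increments after time `τ`. -/
lemma indepFun_shift (τ : ℝ≥0) [IsProbabilityMeasure P] :
    IndepFun (fun ω t ↦ N (min t τ) ω) (fun ω t ↦ N (τ + t) ω - N τ ω) P := by
  have hm := h.measurable
  refine IndepFun.process_indepFun_process (X := fun t ω ↦ N (min t τ) ω)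
    (Y := fun t ω ↦ N (τ + t) ω - N τ ω) (fun t ↦ hm _) (fun t ↦ (hm _).sub (hm _)) fun I J ↦ ?_
  classical
  obtain ⟨a, m', ha, ha0, hI, ha'⟩ :=
    exists_monotone_enumeration (insert τ (I.image fun t ↦ min t τ))
  obtain ⟨m, -, hmτ⟩ := hI τ (Finset.mem_insert_self _ _)
  have haτ : ∀ i, a i ≤ τ := fun i ↦ by
    rcases ha' i with h | h
    · rw [h]; exact zero_le
    · rcases Finset.mem_insert.1 h with h | h
      · exact h.le
      · obtain ⟨t, -, h⟩ := Finset.mem_image.1 h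
        rw [← h]; exact min_le_right _ _
  have hI' : ∀ t ∈ I, ∃ i ≤ m, a i = min t τ := by
    intro t ht
    obtain ⟨i, -, hi⟩ := hI (min t τ) (Finset.mem_insert_of_mem (Finset.mem_image_of_mem _ ht))
    rcases le_total i m with him | him
    · exact ⟨i, him, hi⟩
    · exact ⟨m, le_rfl, le_antisymm (hi ▸ ha him) (by rw [hmτ]; exact min_le_right _ _)⟩
  obtain ⟨b, n, hb, hb0, hJ, -⟩ := exists_monotone_enumeration J
  choose! ia hiam hia using hI'
  choose! ib hibn hib using hJ
  let c : ℕ → ℝ≥0 := fun i ↦ if i ≤ m then a i else τ + b (i - m)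
  have hc1 : ∀ i ≤ m, c i = a i := fun i hi ↦ if_pos hi
  have hc2 : ∀ i, c (m + i) = τ + b i := fun i ↦ by
    rcases Nat.eq_zero_or_pos i with rfl | hi
    · simp only [c, add_zero, le_refl, if_true, hmτ, hb0]
    · simp only [c]
      rw [if_neg (by omega), Nat.add_sub_cancel_left]
  have hc : Monotone c := by
    refine monotone_nat_of_le_succ fun i ↦ ?_
    rcases lt_or_ge i m with him | him
    · rw [hc1 i him.le, hc1 (i + 1) him]; exact ha (Nat.le_succ i)
    · obtain ⟨j, rfl⟩ := Nat.exists_eq_add_of_le him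
      rw [hc2, add_assoc, hc2]; exact add_le_add_right (hb (Nat.le_succ j)) τ
  let X : ℕ → Ω → ℕ := fun i ω ↦ N (c (i + 1)) ω - N (c i) ω
  have hX : ∀ i, Measurable (X i) := fun i ↦ (hm _).sub (hm _)
  have key := (h.indep.nat hc).indepFun_finset (Finset.range m) (Finset.Ico m (m + n))
    (by rw [Finset.range_eq_Ico]; exact Finset.Ico_disjoint_Ico_consecutive 0 m (m + n)) hX
  let g₁ : ((Finset.range m) → ℕ) → (I → ℕ) := fun x t ↦
    ∑ i ∈ Finset.range (ia t), if hi : i ∈ Finset.range m then x ⟨i, hi⟩ else 0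
  let g₂ : ((Finset.Ico m (m + n)) → ℕ) → (J → ℕ) := fun x t ↦
    ∑ i ∈ Finset.range (ib t), if hi : m + i ∈ Finset.Ico m (m + n) then x ⟨m + i, hi⟩ else 0
  have hg₁ : Measurable g₁ := by
    refine measurable_pi_lambda _ fun t ↦ Finset.measurable_sum _ fun i _ ↦ ?_
    by_cases hi : i ∈ Finset.range m
    · simp only [hi, dif_pos]; exact measurable_pi_apply _
    · simp only [hi, dif_neg, not_false_eq_true]; exact measurable_const
  have hg₂ : Measurable g₂ := by
    refine measurable_pi_lambda _ fun t ↦ Finset.measurable_sum _ fun i _ ↦ ?_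
    by_cases hi : m + i ∈ Finset.Ico m (m + n)
    · simp only [hi, dif_pos]; exact measurable_pi_apply _
    · simp only [hi, dif_neg, not_false_eq_true]; exact measurable_const
  have e1 : (fun ω (t : I) ↦ N (min (t : ℝ≥0) τ) ω)
      = g₁ ∘ fun ω (i : Finset.range m) ↦ X i ω := by
    ext ω t
    have h1 : g₁ (fun i : Finset.range m ↦ X i ω) t = ∑ i ∈ Finset.range (ia t), X i ω :=
      Finset.sum_congr rfl fun i hi ↦ dif_pos
        (Finset.mem_range.2 ((Finset.mem_range.1 hi).trans_le (hiam t t.2)))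
    rw [Function.comp_apply, h1, h.sum_increments hc ω, hc1 _ (hiam t t.2), hia t t.2,
      hc1 0 (Nat.zero_le m), ha0, h.zero, tsub_zero]
  have e2 : (fun ω (t : J) ↦ N (τ + (t : ℝ≥0)) ω - N τ ω)
      = g₂ ∘ fun ω (i : Finset.Ico m (m + n)) ↦ X i ω := by
    ext ω t
    have h1 : g₂ (fun i : Finset.Ico m (m + n) ↦ X i ω) t
        = ∑ i ∈ Finset.range (ib t), X (m + i) ω :=
      Finset.sum_congr rfl fun i hi ↦ dif_pos
        (Finset.mem_Ico.2 ⟨Nat.le_add_right _ _, by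
          have := hibn t t.2
          have := Finset.mem_range.1 hi
          omega⟩)
    have h2 := h.sum_increments (b := fun i ↦ c (m + i))
      (fun i j hij ↦ hc (by omega)) ω (ib t)
    rw [Function.comp_apply, h1]
    refine Eq.trans ?_ h2.symm
    rw [hc2, hc2, hb0, add_zero, hib t t.2]
  rw [e1, e2]
  exact key.comp hg₁ hg₂

end IsPoissonProcess

/-! ### The periodic partition and the mean function -/

namespace SLCPData

variable (D : SLCPData)

lemma s_d : D.s D.d = D.τ := by
  have h := Finset.sum_range_tsub D.s_strictMono.monotone D.d
  rw [D.s_zero, tsub_zero] at h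
  rw [← h, τ, Fin.sum_univ_eq_sum_range (fun j ↦ D.s (j + 1) - D.s j)]

lemma τ_pos : 0 < D.τ := by
  rw [← D.s_d, ← D.s_zero]; exact D.s_strictMono D.d_pos

lemma s_add_d (m : ℕ) : D.s (m + D.d) = D.s m + D.τ := by
  induction m with
  | zero => rw [zero_add, D.s_d, D.s_zero, zero_add]
  | succ m ih =>
    have h := D.s_periodic m
    rw [ih] at h
    rw [Nat.add_right_comm, ← NNReal.coe_inj]
    push_cast at h ⊢
    linarith

lemma s_mul_d (k : ℕ) : D.s (k * D.d) = k * D.τ := by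
  induction k with
  | zero => simp [D.s_zero]
  | succ k ih => rw [Nat.succ_mul, D.s_add_d, ih]; push_cast; ring

/-- The number of an interval of the partition beyond `t`. -/
def cover (t : ℝ≥0) : ℕ := ⌈t / D.τ⌉₊ * D.d

lemma le_s_cover (t : ℝ≥0) : t ≤ D.s (D.cover t) := by
  rw [cover, s_mul_d, ← div_le_iff₀ D.τ_pos]
  exact Nat.le_ceil _

lemma exists_mem_Ioc {u : ℝ≥0} (hu : 0 < u) : ∃ m, u ∈ Ioc (D.s m) (D.s (m + 1)) := by
  classical
  have hex : ∃ m, u ≤ D.s m := ⟨_, D.le_s_cover u⟩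
  have h1 := Nat.find_spec hex
  have h2 : Nat.find hex ≠ 0 := fun h0 ↦ by
    rw [h0, D.s_zero] at h1; exact absurd hu (not_lt.2 h1)
  obtain ⟨m, hm⟩ := Nat.exists_eq_succ_of_ne_zero h2
  refine ⟨m, not_le.1 (Nat.find_min hex (by omega)), ?_⟩
  rw [hm] at h1
  exact h1

/-- The index of the class of the `m`-th interval. -/
def cls (m : ℕ) : Fin D.d := ⟨m % D.d, Nat.mod_lt _ D.d_pos⟩

lemma cls_add_d (m : ℕ) : D.cls (m + D.d) = D.cls m := by
  simp [cls]

lemma mem_𝔇_iff {m : ℕ} {u : ℝ≥0} (hu : u ∈ Ioc (D.s m) (D.s (m + 1))) (j : Fin D.d) :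
    u ∈ D.𝔇 j ↔ j = D.cls m := by
  simp only [𝔇, mem_iUnion]
  constructor
  · rintro ⟨k, hk⟩
    have h1 : D.s m < D.s ((j : ℕ) + k * D.d + 1) := hu.1.trans_le hk.2
    have h2 : D.s ((j : ℕ) + k * D.d) < D.s (m + 1) := hk.1.trans_le hu.2
    rw [D.s_strictMono.lt_iff_lt] at h1 h2
    have h3 : m = (j : ℕ) + k * D.d := by omega
    ext
    rw [cls, h3]
    simp [Nat.mod_eq_of_lt j.2]
  · rintro rfl
    refine ⟨m / D.d, ?_⟩
    have : ((D.cls m : Fin D.d) : ℕ) + m / D.d * D.d = m := Nat.mod_add_div' m D.d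
    rwa [this]

lemma measurableSet_𝔇 (j : Fin D.d) : MeasurableSet (D.𝔇 j) :=
  MeasurableSet.iUnion fun _ ↦ measurableSet_Ioc

lemma measurable_intensity : Measurable D.intensity :=
  Finset.measurable_sum _ fun j _ ↦ measurable_const.indicator (D.measurableSet_𝔇 j)

lemma intensity_nonneg (u : ℝ≥0) : 0 ≤ D.intensity u :=
  Finset.sum_nonneg fun _ _ ↦ indicator_nonneg (fun _ _ ↦ NNReal.coe_nonneg _) _

lemma intensity_le (u : ℝ≥0) : D.intensity u ≤ ∑ j, (D.lam j : ℝ) :=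
  Finset.sum_le_sum fun _ _ ↦ indicator_le_self' (fun _ _ ↦ NNReal.coe_nonneg _) _

lemma intensity_add_τ {u : ℝ≥0} (hu : 0 < u) : D.intensity (D.τ + u) = D.intensity u := by
  classical
  obtain ⟨m, hm⟩ := D.exists_mem_Ioc hu
  have hm' : D.τ + u ∈ Ioc (D.s (m + D.d)) (D.s (m + D.d + 1)) := by
    rw [Nat.add_right_comm, D.s_add_d, D.s_add_d, add_comm D.τ]
    exact ⟨add_lt_add_left hm.1 _, add_le_add_left hm.2 _⟩
  refine Finset.sum_congr rfl fun j _ ↦ ?_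
  rw [indicator_apply, indicator_apply, D.mem_𝔇_iff hm, D.mem_𝔇_iff hm', D.cls_add_d]

lemma intervalIntegrable_intensity (a b : ℝ) :
    IntervalIntegrable (fun u : ℝ ↦ D.intensity u.toNNReal) volume a b := by
  refine intervalIntegrable_const (c := ∑ j, (D.lam j : ℝ)) |>.mono_fun
    (D.measurable_intensity.comp measurable_real_toNNReal).aestronglyMeasurable
    (Eventually.of_forall fun u ↦ ?_)
  change ‖_‖ ≤ ‖_‖
  rw [Real.norm_of_nonneg (D.intensity_nonneg _)]
  exact (D.intensity_le _).trans (le_abs_self _)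

lemma Λ_sub (s t : ℝ≥0) : D.Λ t - D.Λ s = ∫ u in (s : ℝ)..t, D.intensity u.toNNReal :=
  intervalIntegral.integral_interval_sub_left (D.intervalIntegrable_intensity _ _)
    (D.intervalIntegrable_intensity _ _)

lemma Λ_zero : D.Λ 0 = 0 := by simp [Λ]

lemma Λ_mono : Monotone D.Λ := fun s t hst ↦ by
  rw [← sub_nonneg, D.Λ_sub]
  exact intervalIntegral.integral_nonneg (NNReal.coe_le_coe.2 hst) fun u _ ↦ D.intensity_nonneg _

lemma Λ_sub_le {s t : ℝ≥0} (hst : s ≤ t) : D.Λ t - D.Λ s ≤ (∑ j, (D.lam j : ℝ)) * (t - s) := by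
  rw [D.Λ_sub]
  have h := intervalIntegral.integral_mono_on (NNReal.coe_le_coe.2 hst)
    (D.intervalIntegrable_intensity s t) (intervalIntegrable_const (c := ∑ j, (D.lam j : ℝ)))
    fun u _ ↦ D.intensity_le u.toNNReal
  rw [intervalIntegral.integral_const, smul_eq_mul, mul_comm] at h
  exact h

lemma Λ_shift (s t : ℝ≥0) (hst : s ≤ t) : D.Λ (D.τ + t) - D.Λ (D.τ + s) = D.Λ t - D.Λ s := by
  rw [D.Λ_sub, D.Λ_sub, NNReal.coe_add, NNReal.coe_add,
    ← intervalIntegral.integral_comp_add_left (fun u ↦ D.intensity u.toNNReal)]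
  refine intervalIntegral.integral_congr_ae (Eventually.of_forall fun u hu ↦ ?_)
  rw [uIoc_of_le (NNReal.coe_le_coe.2 hst)] at hu
  have hu0 : 0 < u := lt_of_le_of_lt s.2 hu.1
  rw [Real.toNNReal_add (NNReal.coe_nonneg D.τ) hu0.le, Real.toNNReal_coe,
    D.intensity_add_τ (Real.toNNReal_pos.2 hu0)]

end SLCPData

/-! ### The driving process as a functional of `N` and the jump sizes -/

namespace SLCPData

variable (D : SLCPData)

/-- The driving path, in terms of the path `ν` of the counting process and of `ξ (n, j)`, the size
of the `(n + 1)`-st jump if this jump falls in `𝔇_j`: the jumps are sorted by the intervals of the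
partition, so that only finitely many values of `ν` enter. -/
def drivingPath (νξ : (ℝ≥0 → ℕ) × (ℕ × Fin D.d → ℝ)) (t : ℝ≥0) : ℝ :=
  D.δ * t + ∑ m ∈ Finset.range (D.cover t),
    ∑ n ∈ Finset.Ico (νξ.1 (min (D.s m) t)) (νξ.1 (min (D.s (m + 1)) t)), νξ.2 (n, D.cls m)

lemma measurable_sum_Ico {α : Type*} [MeasurableSpace α] {a b : α → ℕ} (ha : Measurable a)
    (hb : Measurable b) {f : ℕ → α → ℝ} (hf : ∀ n, Measurable (f n)) :
    Measurable fun x ↦ ∑ n ∈ Finset.Ico (a x) (b x), f n x := by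
  have h : Measurable fun y : (ℕ × ℕ) × α ↦ ∑ n ∈ Finset.Ico y.1.1 y.1.2, f n y.2 :=
    measurable_from_prod_countable_right fun c ↦
      Finset.measurable_sum (Finset.Ico c.1 c.2) fun n _ ↦ hf n
  exact h.comp ((ha.prodMk hb).prodMk measurable_id)

lemma measurable_drivingPath : Measurable D.drivingPath := by
  refine measurable_pi_lambda _ fun t ↦ Measurable.const_add ?_ _
  refine Finset.measurable_sum _ fun m _ ↦ measurable_sum_Ico ?_ ?_ fun n ↦ ?_
  · exact (measurable_pi_apply _).comp measurable_fst
  · exact (measurable_pi_apply _).comp measurable_fst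
  · exact (measurable_pi_apply _).comp measurable_snd

/-- Sorting the jumps by the intervals of the partition. -/
lemma sum_Ico_eq_sum_sum {ν : ℝ≥0 → ℕ} (hν : Monotone ν) (f : ℕ → ℝ) {M : ℕ} {t : ℝ≥0}
    (hM : t ≤ D.s M) :
    ∑ m ∈ Finset.range M, ∑ n ∈ Finset.Ico (ν (min (D.s m) t)) (ν (min (D.s (m + 1)) t)), f n
      = ∑ n ∈ Finset.Ico (ν 0) (ν t), f n := by
  have h : ∀ k, ∑ m ∈ Finset.range k,
      ∑ n ∈ Finset.Ico (ν (min (D.s m) t)) (ν (min (D.s (m + 1)) t)), f n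
      = ∑ n ∈ Finset.Ico (ν 0) (ν (min (D.s k) t)), f n := by
    intro k
    induction k with
    | zero => simp [D.s_zero]
    | succ k ih =>
      rw [Finset.sum_range_succ, ih, Finset.sum_Ico_consecutive]
      · exact hν zero_le
      · exact hν (min_le_min (D.s_strictMono.monotone (Nat.le_succ k)) le_rfl)
  rw [h, min_eq_right hM]

/-- Stopping the driving path only requires the stopped data. -/
lemma drivingPath_min {ν : ℝ≥0 → ℕ} (hν : Monotone ν) (ξ : ℕ × Fin D.d → ℝ) (a t : ℝ≥0) :
    D.drivingPath (ν, ξ) (min t a) = D.drivingPath (fun u ↦ ν (min u a),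
      fun i ↦ if i.1 < ν a then ξ i else 0) (min t a) := by
  rw [drivingPath, drivingPath]
  congr 1
  refine Finset.sum_congr rfl fun m _ ↦ ?_
  have h1 : ∀ u, min (min u (min t a)) a = min u (min t a) := fun u ↦
    min_eq_left ((min_le_right _ _).trans (min_le_right _ _))
  simp only [h1]
  refine Finset.sum_congr rfl fun n hn ↦ ?_
  rw [if_pos]
  exact (Finset.mem_Ico.1 hn).2.trans_le (hν ((min_le_right _ _).trans (min_le_right _ _)))

end SLCPData

namespace SLCP

variable {D : SLCPData} {Ω : Type*} [MeasurableSpace Ω] {P : Measure Ω} (X : SLCP D P)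

/-- The jump sizes with the index `n` shifted by one. -/
def ξ (ω : Ω) (i : ℕ × Fin D.d) : ℝ := X.ζ (i.1 + 1) i.2 ω

lemma measurable_ξ : Measurable X.ξ :=
  measurable_pi_lambda _ fun _ ↦ X.ζ_measurable _ _

lemma isCountingPath (ω : Ω) : IsCountingPath fun t ↦ X.N t ω := X.poisson.isCountingPath ω

lemma measurable_N : Measurable fun ω t ↦ X.N t ω := measurable_pi_lambda _ X.poisson.measurable

lemma Z_eq {m n : ℕ} {ω : Ω}
    (hn : n ∈ Finset.Ico (X.N (D.s m) ω) (X.N (D.s (m + 1)) ω)) :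
    X.Z (n + 1) ω = X.ξ ω (n, D.cls m) := by
  have hn' : n + 1 ∈ Finset.Ioc (X.N (D.s m) ω) (X.N (D.s (m + 1)) ω) := by
    rw [Finset.mem_Ico] at hn; rw [Finset.mem_Ioc]; omega
  have h1 : X.arrival (n + 1) ω ∈ Ioc (D.s m) (D.s (m + 1)) :=
    ((X.isCountingPath ω).arrivalTime_mem_Ioc_iff (Finset.mem_Ioc.1 hn').2).2 hn'
  rw [Z, Finset.sum_eq_single (D.cls m)]
  · rw [indicator_of_mem ((D.mem_𝔇_iff h1 _).2 rfl)]; rfl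
  · intro j _ hj
    exact indicator_of_notMem (fun h ↦ hj ((D.mem_𝔇_iff h1 _).1 h)) _
  · simp

lemma S_eq_driftStep (ω : Ω) : (fun t ↦ X.S t ω)
    = driftStep (fun t ↦ X.N t ω) D.δ fun n ↦ X.Z n ω := rfl

/-- The increments of the driving process after time `kτ` are given by the increments of `N` and by
the remaining jump sizes. -/
lemma shiftPath_S (k : ℕ) (ω : Ω) : shiftPath (k * D.τ) (fun t ↦ X.S t ω)
    = D.drivingPath (fun t ↦ X.N (k * D.τ + t) ω - X.N (k * D.τ) ω,
        fun i ↦ X.ξ ω (i.1 + X.N (k * D.τ) ω, i.2)) := by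
  have hν := X.isCountingPath ω
  set a := (k : ℝ≥0) * D.τ with ha
  have hsa : ∀ m, a + D.s m = D.s (k * D.d + m) := by
    intro m
    clear_value a
    subst ha
    induction k with
    | zero => simp
    | succ k ih =>
      rw [Nat.succ_mul, Nat.add_right_comm, D.s_add_d, ← ih]
      push_cast; ring
  have hcls : ∀ m, D.cls (k * D.d + m) = D.cls m := fun m ↦ by simp [SLCPData.cls]
  funext t
  set K := X.N a ω with hK
  have hmono : Monotone fun t ↦ X.N (a + t) ω := fun u v huv ↦ hν.mono (add_le_add_right huv a)
  have h1 := D.sum_Ico_eq_sum_sum hmono (fun n ↦ X.Z (n + 1) ω) (D.le_s_cover t)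
  have h2 : shiftPath a (fun t ↦ X.S t ω) t
      = D.δ * t + ∑ n ∈ Finset.Ico (X.N (a + 0) ω) (X.N (a + t) ω), X.Z (n + 1) ω := by
    have h3 := hν.driftStep_sub (δ := D.δ) (c := fun n ↦ X.Z n ω) (s := a) (t := a + t) le_self_add
    refine h3.trans ?_
    rw [add_zero]
    have h4 : Finset.Ioc (X.N a ω) (X.N (a + t) ω)
        = (Finset.Ico (X.N a ω) (X.N (a + t) ω)).image (· + 1) := by
      ext n
      simp only [Finset.mem_Ioc, Finset.mem_image, Finset.mem_Ico]
      constructor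
      · rintro ⟨h, h'⟩; exact ⟨n - 1, by omega, by omega⟩
      · rintro ⟨m, h, rfl⟩; omega
    rw [h4, Finset.sum_image fun x _ y _ h ↦ Nat.succ_injective h]
    push_cast; ring
  rw [h2, ← h1, SLCPData.drivingPath]
  congr 1
  refine Finset.sum_congr rfl fun m _ ↦ ?_
  have hle : ∀ u, K ≤ X.N (a + u) ω := fun u ↦ hν.mono le_self_add
  have h5 : Finset.Ico (X.N (a + min (D.s m) t) ω) (X.N (a + min (D.s (m + 1)) t) ω)
      = (Finset.Ico (X.N (a + min (D.s m) t) ω - K)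
          (X.N (a + min (D.s (m + 1)) t) ω - K)).image (· + K) := by
    ext n
    simp only [Finset.mem_image, Finset.mem_Ico]
    have := hle (min (D.s m) t)
    have := hle (min (D.s (m + 1)) t)
    constructor
    · rintro ⟨h, h'⟩; exact ⟨n - K, by omega, by omega⟩
    · rintro ⟨m, h, rfl⟩; omega
  rw [h5, Finset.sum_image fun x _ y _ h ↦ Nat.add_right_cancel h]
  refine Finset.sum_congr rfl fun n hn ↦ ?_
  -- an interval of the partition is only used up to time `t`
  have hn' : n + K ∈ Finset.Ico (X.N (D.s (k * D.d + m)) ω) (X.N (D.s (k * D.d + m + 1)) ω) := by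
    have h6 : n + K ∈ Finset.Ico (X.N (a + min (D.s m) t) ω) (X.N (a + min (D.s (m + 1)) t) ω) := by
      rw [h5]; exact Finset.mem_image_of_mem _ hn
    rw [Finset.mem_Ico] at h6
    have h7 : D.s m < t := by
      by_contra hcon
      rw [not_lt] at hcon
      rw [min_eq_right hcon,
        min_eq_right (hcon.trans (D.s_strictMono.monotone (Nat.le_succ m)))] at h6
      omega
    rw [min_eq_left h7.le, hsa] at h6
    refine Finset.mem_Ico.2 ⟨h6.1, h6.2.trans_le ?_⟩
    rw [add_assoc, ← hsa]
    exact hν.mono (add_le_add_right (min_le_left _ _) a)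
  rw [X.Z_eq hn', hcls]

lemma S_zero (ω : Ω) : X.S 0 ω = 0 := by
  simp [S, X.poisson.zero]

lemma S_eq_drivingPath (ω : Ω) :
    (fun t ↦ X.S t ω) = D.drivingPath (fun t ↦ X.N t ω, X.ξ ω) := by
  have h := X.shiftPath_S 0 ω
  simp only [Nat.cast_zero, zero_mul, zero_add, X.poisson.zero, tsub_zero, add_zero] at h
  rw [← h]
  funext t
  simp [shiftPath, X.S_zero]

lemma measurable_S : Measurable fun ω t ↦ X.S t ω := by
  rw [show (fun ω t ↦ X.S t ω) = fun ω ↦ D.drivingPath (fun t ↦ X.N t ω, X.ξ ω) from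
    funext X.S_eq_drivingPath]
  exact D.measurable_drivingPath.comp (X.measurable_N.prodMk X.measurable_ξ)

end SLCP

/-! ### Restarting the driving process after one period -/

lemma measurable_shiftPath (a : ℝ≥0) : Measurable (shiftPath a) :=
  measurable_pi_lambda _ fun _ ↦ (measurable_pi_apply _).sub (measurable_pi_apply _)

/-- The path `x` stopped at time `a`. -/
def stopPath (a : ℝ≥0) (x : ℝ≥0 → ℝ) (t : ℝ≥0) : ℝ := x (min t a)

lemma measurable_stopPath (a : ℝ≥0) : Measurable (stopPath a) :=
  measurable_pi_lambda _ fun _ ↦ measurable_pi_apply _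

namespace SLCP

variable {D : SLCPData} {Ω : Type*} [MeasurableSpace Ω] {P : Measure Ω} (X : SLCP D P)

lemma iIndepFun_ξ : iIndepFun (fun i ω ↦ X.ξ ω i) P :=
  X.ζ_indep.precomp (g := fun i : ℕ × Fin D.d ↦ (i.1 + 1, i.2)) fun i j h ↦ by
    simp only [Prod.mk.injEq, Nat.add_right_cancel_iff] at h
    exact Prod.ext h.1 h.2

lemma map_ξ (i : ℕ × Fin D.d) : P.map (fun ω ↦ X.ξ ω i) = D.F i.2 := X.ζ_law _ _

lemma indepFun_N_ξ : IndepFun (fun ω t ↦ X.N t ω) X.ξ P :=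
  have hψ : Measurable fun (x : ℕ × Fin D.d → ℝ) (i : ℕ × Fin D.d) ↦ x (i.1 + 1, i.2) :=
    measurable_pi_lambda _ fun _ ↦ measurable_pi_apply _
  X.N_indep_ζ.comp measurable_id hψ

/-- The jump sizes after the `k`-th one. -/
def ξshift (k : ℕ) (ω : Ω) (i : ℕ × Fin D.d) : ℝ := X.ξ ω (i.1 + k, i.2)

/-- The jump sizes up to the `k`-th one. -/
def ξtrunc (k : ℕ) (ω : Ω) (i : ℕ × Fin D.d) : ℝ := if i.1 < k then X.ξ ω i else 0

lemma measurable_ξshift (k : ℕ) : Measurable (X.ξshift k) :=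
  measurable_pi_lambda _ fun _ ↦ X.ζ_measurable _ _

lemma measurable_ξtrunc (k : ℕ) : Measurable (X.ξtrunc k) :=
  measurable_pi_lambda _ fun i ↦ by
    by_cases hi : i.1 < k
    · simp only [ξtrunc, hi, if_true]; exact X.ζ_measurable _ _
    · simp only [ξtrunc, hi, if_false]; exact measurable_const

lemma indepFun_ξtrunc_ξshift (k : ℕ) : IndepFun (X.ξtrunc k) (X.ξshift k) P := by
  have h1 := indep_iSup_of_disjoint (fun i : ℕ × Fin D.d ↦ (X.ζ_measurable (i.1 + 1) i.2).comap_le)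
    ((iIndepFun_iff_iIndep _ _ _).1 X.iIndepFun_ξ) (S := {i : ℕ × Fin D.d | i.1 < k})
    (T := {i : ℕ × Fin D.d | k ≤ i.1})
    (Set.disjoint_left.2 fun i (hi : i.1 < k) (hi' : k ≤ i.1) ↦ absurd hi (not_lt.2 hi'))
  rw [IndepFun_iff_Indep]
  refine indep_of_indep_of_le_left (indep_of_indep_of_le_right h1 ?_) ?_
  · rw [MeasurableSpace.pi, MeasurableSpace.comap_iSup]
    refine iSup_le fun i ↦ ?_
    rw [MeasurableSpace.comap_comp]
    exact le_iSup₂_of_le (f := fun (i : ℕ × Fin D.d) (_ : i ∈ {i : ℕ × Fin D.d | k ≤ i.1}) ↦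
      MeasurableSpace.comap (X.ζ (i.1 + 1) i.2) inferInstance) (i.1 + k, i.2)
      (Nat.le_add_left _ _) le_rfl
  · rw [MeasurableSpace.pi, MeasurableSpace.comap_iSup]
    refine iSup_le fun i ↦ ?_
    rw [MeasurableSpace.comap_comp]
    by_cases hi : i.1 < k
    · have h2 : (fun x : ℕ × Fin D.d → ℝ ↦ x i) ∘ X.ξtrunc k = X.ζ (i.1 + 1) i.2 := by
        funext ω
        simp [ξtrunc, hi, ξ]
      rw [h2]
      exact le_iSup₂_of_le (f := fun (i : ℕ × Fin D.d) (_ : i ∈ {i : ℕ × Fin D.d | i.1 < k}) ↦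
        MeasurableSpace.comap (X.ζ (i.1 + 1) i.2) inferInstance) i hi le_rfl
    · have h2 : (fun x : ℕ × Fin D.d → ℝ ↦ x i) ∘ X.ξtrunc k = fun _ ↦ 0 := by
        funext ω
        simp [ξtrunc, hi]
      rw [h2, MeasurableSpace.comap_const]
      exact bot_le

variable [IsProbabilityMeasure P]

lemma map_ξshift (k : ℕ) : P.map (X.ξshift k) = P.map X.ξ := by
  have hm : ∀ i : ℕ × Fin D.d, Measurable fun ω ↦ X.ξ ω i := fun i ↦ X.ζ_measurable _ _
  have h1 : iIndepFun (fun (i : ℕ × Fin D.d) ω ↦ X.ξ ω (i.1 + k, i.2)) P :=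
    X.iIndepFun_ξ.precomp (g := fun i : ℕ × Fin D.d ↦ (i.1 + k, i.2)) fun i j h ↦ by
      simp only [Prod.mk.injEq, Nat.add_right_cancel_iff] at h
      exact Prod.ext h.1 h.2
  have h2 := (iIndepFun_iff_map_fun_eq_infinitePi_map fun i ↦ hm _).1 h1
  have h3 := (iIndepFun_iff_map_fun_eq_infinitePi_map hm).1 X.iIndepFun_ξ
  refine h2.trans (Eq.trans ?_ h3.symm)
  congr 1
  funext i
  rw [X.map_ξ, X.map_ξ]

/-- The process `N` up to time `τ`. -/
def Nbefore (ω : Ω) (t : ℝ≥0) : ℕ := X.N (min t D.τ) ω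

/-- The increments of `N` after time `τ`. -/
def Nafter (ω : Ω) (t : ℝ≥0) : ℕ := X.N (D.τ + t) ω - X.N D.τ ω

omit [IsProbabilityMeasure P] in
lemma measurable_Nbefore : Measurable X.Nbefore :=
  measurable_pi_lambda _ fun _ ↦ X.poisson.measurable _

omit [IsProbabilityMeasure P] in
lemma measurable_Nafter : Measurable X.Nafter :=
  measurable_pi_lambda _ fun _ ↦ (X.poisson.measurable _).sub (X.poisson.measurable _)

/-- For a fixed `k`, the arrivals up to time `τ` and the first `k` jump sizes are jointly independent
of the arrivals after time `τ` and the later jump sizes. -/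
lemma indepFun_past_future (k : ℕ) :
    IndepFun (fun ω ↦ (X.Nbefore ω, X.ξtrunc k ω)) (fun ω ↦ (X.Nafter ω, X.ξshift k ω)) P := by
  refine IndepFun.prodMk_swap X.measurable_Nbefore X.measurable_Nafter (X.measurable_ξtrunc k)
    (X.measurable_ξshift k) ?_ (X.poisson.indepFun_shift D.τ) (X.indepFun_ξtrunc_ξshift k)
  have hφ : Measurable fun ν : ℝ≥0 → ℕ ↦
      ((fun t ↦ ν (min t D.τ) : ℝ≥0 → ℕ), (fun t ↦ ν (D.τ + t) - ν D.τ : ℝ≥0 → ℕ)) :=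
    (measurable_pi_lambda _ fun _ ↦ measurable_pi_apply _).prodMk
      (measurable_pi_lambda _ fun _ ↦ (measurable_pi_apply _).sub (measurable_pi_apply _))
  have hψ : Measurable fun x : ℕ × Fin D.d → ℝ ↦
      ((fun i ↦ if i.1 < k then x i else 0 : ℕ × Fin D.d → ℝ),
        (fun i ↦ x (i.1 + k, i.2) : ℕ × Fin D.d → ℝ)) := by
    refine (measurable_pi_lambda _ fun i ↦ ?_).prodMk
      (measurable_pi_lambda _ fun _ ↦ measurable_pi_apply _)
    by_cases hi : i.1 < k
    · simp only [hi, if_true]; exact measurable_pi_apply _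
    · simp only [hi, if_false]; exact measurable_const
  exact X.indepFun_N_ξ.comp hφ hψ

lemma map_future (k : ℕ) :
    P.map (fun ω ↦ (X.Nafter ω, X.ξshift k ω)) = P.map (fun ω ↦ (fun t ↦ X.N t ω, X.ξ ω)) := by
  have hφ : Measurable fun (ν : ℝ≥0 → ℕ) (t : ℝ≥0) ↦ ν (D.τ + t) - ν D.τ :=
    measurable_pi_lambda _ fun _ ↦ (measurable_pi_apply _).sub (measurable_pi_apply _)
  have hψ : Measurable fun (x : ℕ × Fin D.d → ℝ) (i : ℕ × Fin D.d) ↦ x (i.1 + k, i.2) :=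
    measurable_pi_lambda _ fun _ ↦ measurable_pi_apply _
  have h1 : IndepFun X.Nafter (X.ξshift k) P := X.indepFun_N_ξ.comp hφ hψ
  rw [(indepFun_iff_map_prod_eq_prod_map_map X.measurable_Nafter.aemeasurable
      (X.measurable_ξshift k).aemeasurable).1 h1,
    (indepFun_iff_map_prod_eq_prod_map_map X.measurable_N.aemeasurable
      X.measurable_ξ.aemeasurable).1 X.indepFun_N_ξ, X.map_ξshift k]
  congr 1
  exact X.poisson.map_shift D.τ D.Λ_shift

/-- The law of the driving process. -/
def pathLaw : Measure (ℝ≥0 → ℝ) := P.map fun ω t ↦ X.S t ω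

/-- The path after one period is independent of the path up to then, and distributed as the driving
process itself. Which jump sizes belong to the future depends on the number of arrivals in the first
period, so the event is split according to this number; on each part, past and future are functions
of the independent families of `indepFun_past_future`. -/
lemma measure_stop_inter_shift {A B : Set (ℝ≥0 → ℝ)} (hA : MeasurableSet A)
    (hB : MeasurableSet B) :
    P ((fun ω ↦ stopPath D.τ fun t ↦ X.S t ω) ⁻¹' A ∩
        (fun ω ↦ shiftPath D.τ fun t ↦ X.S t ω) ⁻¹' B)
      = P ((fun ω ↦ stopPath D.τ fun t ↦ X.S t ω) ⁻¹' A) * X.pathLaw B := by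
  set past : Ω → ℝ≥0 → ℝ := fun ω ↦ stopPath D.τ fun t ↦ X.S t ω with hpast
  set future : Ω → ℝ≥0 → ℝ := fun ω ↦ shiftPath D.τ fun t ↦ X.S t ω with hfuture
  have hpm : Measurable past := (measurable_stopPath _).comp X.measurable_S
  have hfm : Measurable future := (measurable_shiftPath _).comp X.measurable_S
  have hNm : Measurable (X.N D.τ) := X.poisson.measurable _
  -- on `{N_τ = k}`, past and future are functionals of independent random elements
  have e1 : ∀ ω, past ω
      = stopPath D.τ (D.drivingPath (X.Nbefore ω, X.ξtrunc (X.N D.τ ω) ω)) := by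
    intro ω
    funext t
    have h1 := congrFun (X.S_eq_drivingPath ω) (min t D.τ)
    have h2 := D.drivingPath_min (X.poisson.mono ω) (X.ξ ω) D.τ t
    exact h1.trans h2
  have e2 : ∀ ω, future ω = D.drivingPath (X.Nafter ω, X.ξshift (X.N D.τ ω) ω) := by
    intro ω
    have h := X.shiftPath_S 1 ω
    simp only [Nat.cast_one, one_mul] at h
    exact h
  have hsum : ∀ E : Set Ω, P E = ∑' k, P (E ∩ X.N D.τ ⁻¹' {k}) := by
    intro E
    have h := tsum_measure_preimage_singleton (μ := P.restrict E) (s := (univ : Set ℕ))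
      (f := X.N D.τ) countable_univ fun k _ ↦ hNm (measurableSet_singleton k)
    rw [preimage_univ, Measure.restrict_apply_univ, tsum_univ (fun k ↦ (P.restrict E) (X.N D.τ ⁻¹' {k}))] at h
    rw [← h]
    refine tsum_congr fun k ↦ ?_
    rw [Measure.restrict_apply (hNm (measurableSet_singleton k)), inter_comm]
  rw [hsum, hsum (past ⁻¹' A), ← ENNReal.tsum_mul_right]
  refine tsum_congr fun k ↦ ?_
  let A' : Set ((ℝ≥0 → ℕ) × (ℕ × Fin D.d → ℝ)) :=
    {x | stopPath D.τ (D.drivingPath x) ∈ A ∧ x.1 D.τ = k}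
  have hev : Measurable fun x : (ℝ≥0 → ℕ) × (ℕ × Fin D.d → ℝ) ↦ x.1 D.τ :=
    (measurable_pi_apply D.τ).comp measurable_fst
  have hA' : MeasurableSet A' :=
    ((measurable_stopPath _).comp D.measurable_drivingPath hA).inter
      (hev (measurableSet_singleton k))
  let B' : Set ((ℝ≥0 → ℕ) × (ℕ × Fin D.d → ℝ)) := D.drivingPath ⁻¹' B
  have hB' : MeasurableSet B' := D.measurable_drivingPath hB
  have h1 : past ⁻¹' A ∩ X.N D.τ ⁻¹' {k} = (fun ω ↦ (X.Nbefore ω, X.ξtrunc k ω)) ⁻¹' A' := by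
    ext ω
    have h0 : X.Nbefore ω D.τ = X.N D.τ ω := by simp [Nbefore]
    simp only [mem_inter_iff, mem_preimage, mem_singleton_iff, A', mem_ofPred_eq, h0]
    refine and_congr_left fun hk ↦ ?_
    rw [e1, hk]
  have h2 : past ⁻¹' A ∩ future ⁻¹' B ∩ X.N D.τ ⁻¹' {k}
      = (fun ω ↦ (X.Nbefore ω, X.ξtrunc k ω)) ⁻¹' A'
        ∩ (fun ω ↦ (X.Nafter ω, X.ξshift k ω)) ⁻¹' B' := by
    rw [← h1, inter_right_comm]
    ext ω
    simp only [mem_inter_iff, mem_preimage, mem_singleton_iff, B']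
    refine and_congr_right fun hk ↦ ?_
    rw [e2, hk.2]
  rw [h2, (X.indepFun_past_future k).measure_inter_preimage_eq_mul _ _ hA' hB', h1]
  congr 1
  have h3 : Measurable fun ω ↦ (X.Nafter ω, X.ξshift k ω) :=
    X.measurable_Nafter.prodMk (X.measurable_ξshift k)
  rw [← Measure.map_apply h3 hB', X.map_future k,
    Measure.map_apply (X.measurable_N.prodMk X.measurable_ξ) hB', pathLaw,
    Measure.map_apply X.measurable_S hB]
  congr 1
  ext ω
  simp only [mem_preimage, B']
  rw [X.S_eq_drivingPath]

instance : IsProbabilityMeasure X.pathLaw :=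
  Measure.isProbabilityMeasure_map X.measurable_S.aemeasurable

/-- The increments of the driving process after one period are distributed as the driving process
itself. -/
lemma map_shiftPath_pathLaw : X.pathLaw.map (shiftPath D.τ) = X.pathLaw := by
  ext B hB
  have h := X.measure_stop_inter_shift .univ hB
  rw [preimage_univ, univ_inter, measure_univ, one_mul] at h
  rw [← h, Measure.map_apply (measurable_shiftPath _) hB, pathLaw,
    Measure.map_apply X.measurable_S (measurable_shiftPath _ hB)]
  rfl

/-- Under the law of the driving process, the path up to time `τ` is independent of the increments
after time `τ`. -/
lemma indepFun_stopPath_shiftPath : IndepFun (stopPath D.τ) (shiftPath D.τ) X.pathLaw := by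
  rw [indepFun_iff_measure_inter_preimage_eq_mul]
  intro A B hA hB
  have h := X.measure_stop_inter_shift hA hB
  have h1 : X.pathLaw (shiftPath D.τ ⁻¹' B) = X.pathLaw B := by
    rw [← Measure.map_apply (measurable_shiftPath _) hB, X.map_shiftPath_pathLaw]
  rw [h1]
  conv_lhs => rw [pathLaw]
  rw [Measure.map_apply X.measurable_S
    ((measurable_stopPath _ hA).inter (measurable_shiftPath _ hB))]
  refine h.trans ?_
  congr 1
  rw [pathLaw, Measure.map_apply X.measurable_S (measurable_stopPath _ hA)]
  rfl

end SLCP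

/-! ### Moments of products over the jumps of one period -/

/-- The probability generating function of the Poisson distribution. -/
lemma lintegral_pow_poissonMeasure (r : ℝ≥0) {x : ℝ} (hx : 0 ≤ x) :
    ∫⁻ k, ENNReal.ofReal x ^ k ∂(poissonMeasure r) = ENNReal.ofReal (Real.exp (r * (x - 1))) := by
  have h1 : HasSum (fun n : ℕ ↦ Real.exp (-r) * ((r * x) ^ n / n.factorial))
      (Real.exp (-r) * Real.exp (r * x)) := by
    rw [Real.exp_eq_exp_ℝ]
    exact (NormedSpace.expSeries_div_hasSum_exp ((r : ℝ) * x)).mul_left _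
  have h0 : ∀ n : ℕ, 0 ≤ Real.exp (-r) * ((r * x) ^ n / n.factorial) := fun n ↦ by positivity
  rw [lintegral_countable', show (r : ℝ) * (x - 1) = -r + r * x by ring, Real.exp_add, ← h1.tsum_eq,
    ENNReal.ofReal_tsum_of_nonneg h0 h1.summable]
  refine tsum_congr fun n ↦ ?_
  rw [poissonMeasure_singleton, ← ENNReal.ofReal_pow hx, ← ENNReal.ofReal_mul (by positivity)]
  congr 1
  rw [mul_pow]
  ring

lemma measurable_prod_Ico {α β : Type*} [MeasurableSpace α] [MeasurableSpace β] [CommMonoid β]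
    [MeasurableMul₂ β] {a b : α → ℕ} (ha : Measurable a)
    (hb : Measurable b) {f : ℕ → α → β} (hf : ∀ n, Measurable (f n)) :
    Measurable fun x ↦ ∏ n ∈ Finset.Ico (a x) (b x), f n x := by
  have h : Measurable fun y : (ℕ × ℕ) × α ↦ ∏ n ∈ Finset.Ico y.1.1 y.1.2, f n y.2 :=
    measurable_from_prod_countable_right fun c ↦
      Finset.measurable_prod (Finset.Ico c.1 c.2) fun n _ ↦ hf n
  exact h.comp ((ha.prodMk hb).prodMk measurable_id)

namespace SLCPData

variable (D : SLCPData)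

/-- The product of `g` over the jump sizes in the first period, as a functional of the counting path
and of the candidates for the jump sizes. -/
def periodProd {β : Type*} [CommMonoid β] (g : ℝ → β) (νξ : (ℝ≥0 → ℕ) × (ℕ × Fin D.d → ℝ)) : β :=
  ∏ j : Fin D.d, ∏ n ∈ Finset.Ico (νξ.1 (D.s j)) (νξ.1 (D.s (j + 1))), g (νξ.2 (n, j))

lemma measurable_periodProd {β : Type*} [CommMonoid β] [MeasurableSpace β] [MeasurableMul₂ β]
    {g : ℝ → β} (hg : Measurable g) : Measurable (D.periodProd g) := by
  refine Finset.measurable_prod _ fun j _ ↦ measurable_prod_Ico ?_ ?_ fun n ↦ hg.comp ?_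
  · exact (measurable_pi_apply _).comp measurable_fst
  · exact (measurable_pi_apply _).comp measurable_fst
  · exact (measurable_pi_apply _).comp measurable_snd

lemma cls_val (j : Fin D.d) : D.cls j = j := Fin.ext (Nat.mod_eq_of_lt j.2)

/-- The expected number of jumps in `(s_j, s_{j+1}]`. -/
def cellMean (j : Fin D.d) : ℝ := D.Λ (D.s (j + 1)) - D.Λ (D.s j)

lemma cellMean_nonneg (j : Fin D.d) : 0 ≤ D.cellMean j :=
  sub_nonneg.2 (D.Λ_mono (D.s_strictMono.monotone (Nat.le_succ _)))

lemma sum_cellMean : ∑ j, D.cellMean j = D.Λ D.τ := by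
  have h := Finset.sum_range_sub (fun m ↦ D.Λ (D.s m)) D.d
  rw [D.s_zero, D.Λ_zero, sub_zero, D.s_d] at h
  rw [← h, ← Fin.sum_univ_eq_sum_range (fun m ↦ D.Λ (D.s (m + 1)) - D.Λ (D.s m))]
  rfl

end SLCPData

namespace SLCP

variable {D : SLCPData} {Ω : Type*} [MeasurableSpace Ω] {P : Measure Ω} (X : SLCP D P)

lemma prod_Z_eq_periodProd {β : Type*} [CommMonoid β] (g : ℝ → β) (ω : Ω) :
    ∏ n ∈ Finset.Ioc 0 (X.N D.τ ω), g (X.Z n ω) = D.periodProd g (fun t ↦ X.N t ω, X.ξ ω) := by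
  have h : ∀ k, ∏ m ∈ Finset.range k, ∏ n ∈ Finset.Ico (X.N (D.s m) ω) (X.N (D.s (m + 1)) ω),
      g (X.ξ ω (n, D.cls m)) = ∏ n ∈ Finset.Ico 0 (X.N (D.s k) ω), g (X.Z (n + 1) ω) := by
    intro k
    induction k with
    | zero => simp [D.s_zero, X.poisson.zero]
    | succ k ih =>
      rw [Finset.prod_range_succ, ih, ← Finset.prod_Ico_consecutive _ (Nat.zero_le _)
        (X.poisson.mono ω (D.s_strictMono.monotone (Nat.le_succ k)))]
      congr 1
      exact Finset.prod_congr rfl fun n hn ↦ by rw [X.Z_eq hn]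
  have h1 : ∏ n ∈ Finset.Ioc 0 (X.N D.τ ω), g (X.Z n ω)
      = ∏ n ∈ Finset.Ico 0 (X.N D.τ ω), g (X.Z (n + 1) ω) := by
    rw [Finset.prod_Ico_add' (fun n ↦ g (X.Z n ω))]
    refine Finset.prod_congr ?_ fun _ _ ↦ rfl
    ext n
    simp only [Finset.mem_Ioc, Finset.mem_Ico]
    omega
  rw [h1, ← D.s_d, ← h, SLCPData.periodProd, ← Fin.prod_univ_eq_prod_range
    (fun m ↦ ∏ n ∈ Finset.Ico (X.N (D.s m) ω) (X.N (D.s (m + 1)) ω), g (X.ξ ω (n, D.cls m)))]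
  refine Finset.prod_congr rfl fun j _ ↦ ?_
  rw [D.cls_val]

lemma lintegral_prod_ξ {g : ℝ → ℝ≥0∞} (hg : Measurable g) (ν : ℝ≥0 → ℕ) :
    ∫⁻ ω, D.periodProd g (ν, X.ξ ω) ∂P
      = ∏ j : Fin D.d, (∫⁻ z, g z ∂(D.F j)) ^ (ν (D.s (j + 1)) - ν (D.s j)) := by
  have hm : ∀ i : ℕ × Fin D.d, Measurable fun ω ↦ X.ξ ω i := fun i ↦ X.ζ_measurable _ _
  have hind : iIndepFun (fun (x : Σ _ : Fin D.d, ℕ) ω ↦ g (X.ξ ω (x.2, x.1))) P :=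
    (X.iIndepFun_ξ.precomp (g := fun x : Σ _ : Fin D.d, ℕ ↦ (x.2, x.1)) fun x y h ↦ by
      obtain ⟨a, b⟩ := x
      obtain ⟨a', b'⟩ := y
      simp only [Prod.mk.injEq] at h
      obtain ⟨rfl, rfl⟩ := h
      rfl).comp (fun _ ↦ g) fun _ ↦ hg
  have h1 : ∀ ω, D.periodProd g (ν, X.ξ ω)
      = ∏ x ∈ Finset.univ.sigma fun j : Fin D.d ↦ Finset.Ico (ν (D.s j)) (ν (D.s (j + 1))),
        g (X.ξ ω (x.2, x.1)) := fun ω ↦ by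
    rw [Finset.prod_sigma]; rfl
  rw [lintegral_congr h1, lintegral_prod_eq_prod_lintegral_of_indepFun _ _ hind
    fun x ↦ hg.comp (hm _), Finset.prod_sigma]
  refine Finset.prod_congr rfl fun j _ ↦ ?_
  rw [Finset.prod_congr rfl fun n _ ↦ show ∫⁻ ω, g (X.ξ ω (n, j)) ∂P = ∫⁻ z, g z ∂(D.F j) by
    rw [← X.map_ξ (n, j), lintegral_map hg (hm _)], Finset.prod_const, Nat.card_Ico]

variable [IsProbabilityMeasure P]

lemma lintegral_prod_Z {g : ℝ → ℝ≥0∞} (hg : Measurable g) {γ : Fin D.d → ℝ} (hγ0 : ∀ j, 0 ≤ γ j)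
    (hγ : ∀ j, ∫⁻ z, g z ∂(D.F j) = ENNReal.ofReal (γ j)) :
    ∫⁻ ω, ∏ n ∈ Finset.Ioc 0 (X.N D.τ ω), g (X.Z n ω) ∂P
      = ENNReal.ofReal (Real.exp (∑ j, D.cellMean j * (γ j - 1))) := by
  have hpp := D.measurable_periodProd hg
  have h1 : ∫⁻ ω, ∏ n ∈ Finset.Ioc 0 (X.N D.τ ω), g (X.Z n ω) ∂P
      = ∫⁻ ω, ∏ j : Fin D.d, ENNReal.ofReal (γ j) ^ (X.N (D.s (j + 1)) ω - X.N (D.s j) ω) ∂P := by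
    rw [lintegral_congr fun ω ↦ X.prod_Z_eq_periodProd g ω,
      ← lintegral_map (f := D.periodProd g) (g := fun ω ↦ (fun t ↦ X.N t ω, X.ξ ω)) hpp
        (X.measurable_N.prodMk X.measurable_ξ),
      (indepFun_iff_map_prod_eq_prod_map_map X.measurable_N.aemeasurable
        X.measurable_ξ.aemeasurable).1 X.indepFun_N_ξ, lintegral_prod _ hpp.aemeasurable,
      lintegral_map hpp.lintegral_prod_right' X.measurable_N]
    refine lintegral_congr fun ω ↦ ?_
    refine (lintegral_map (hpp.comp measurable_prodMk_left) X.measurable_ξ).trans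
      ((X.lintegral_prod_ξ hg _).trans ?_)
    simp only [hγ]
  have hinc : iIndepFun (fun (j : Fin D.d) ω ↦
      ENNReal.ofReal (γ j) ^ (X.N (D.s (j + 1)) ω - X.N (D.s j) ω)) P :=
    ((X.poisson.indep.nat D.s_strictMono.monotone).precomp (g := fun j : Fin D.d ↦ (j : ℕ))
      Fin.val_injective).comp (fun j k ↦ ENNReal.ofReal (γ j) ^ k) fun _ ↦ measurable_from_nat
  have hmN : ∀ j : Fin D.d, Measurable fun ω ↦ X.N (D.s (j + 1)) ω - X.N (D.s j) ω := fun j ↦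
    (X.poisson.measurable _).sub (X.poisson.measurable _)
  rw [h1, lintegral_prod_eq_prod_lintegral_of_indepFun _ _ hinc
    fun j ↦ (measurable_from_nat (f := fun k ↦ ENNReal.ofReal (γ j) ^ k)).comp (hmN j),
    Real.exp_sum, ENNReal.ofReal_prod_of_nonneg fun _ _ ↦ Real.exp_nonneg _]
  refine Finset.prod_congr rfl fun j _ ↦ ?_
  rw [← lintegral_map (f := fun k ↦ ENNReal.ofReal (γ j) ^ k) measurable_from_nat (hmN j),
    X.poisson.law _ _ (D.s_strictMono.monotone (Nat.le_succ _)),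
    lintegral_pow_poissonMeasure _ (hγ0 j)]
  have h2 : ((D.Λ (D.s (j + 1)) - D.Λ (D.s j)).toNNReal : ℝ) = D.cellMean j :=
    Real.coe_toNNReal _ (D.cellMean_nonneg j)
  rw [← h2]

/-- The exponential formula for the jumps in one period. -/
lemma integral_prod_Z {g : ℝ → ℝ} (hg : Measurable g) (hg0 : ∀ z, 0 ≤ g z)
    (hgi : ∀ j, Integrable g (D.F j)) :
    Integrable (fun ω ↦ ∏ n ∈ Finset.Ioc 0 (X.N D.τ ω), g (X.Z n ω)) P ∧
      ∫ ω, ∏ n ∈ Finset.Ioc 0 (X.N D.τ ω), g (X.Z n ω) ∂P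
        = Real.exp (∑ j, D.cellMean j * (∫ z, g z ∂(D.F j) - 1)) := by
  have hmeas : Measurable fun ω ↦ ∏ n ∈ Finset.Ioc 0 (X.N D.τ ω), g (X.Z n ω) := by
    simp only [X.prod_Z_eq_periodProd g]
    exact (D.measurable_periodProd hg).comp (X.measurable_N.prodMk X.measurable_ξ)
  have h0 : ∀ ω, 0 ≤ ∏ n ∈ Finset.Ioc 0 (X.N D.τ ω), g (X.Z n ω) := fun ω ↦
    Finset.prod_nonneg fun _ _ ↦ hg0 _
  have hl := X.lintegral_prod_Z (g := fun z ↦ ENNReal.ofReal (g z)) hg.ennreal_ofReal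
    (γ := fun j ↦ ∫ z, g z ∂(D.F j)) (fun j ↦ integral_nonneg hg0)
    fun j ↦ (ofReal_integral_eq_lintegral_ofReal (hgi j) (ae_of_all _ hg0)).symm
  have hl' : ∫⁻ ω, ENNReal.ofReal (∏ n ∈ Finset.Ioc 0 (X.N D.τ ω), g (X.Z n ω)) ∂P
      = ENNReal.ofReal (Real.exp (∑ j, D.cellMean j * (∫ z, g z ∂(D.F j) - 1))) := by
    rw [← hl]
    exact lintegral_congr fun ω ↦ ENNReal.ofReal_prod_of_nonneg fun _ _ ↦ hg0 _
  refine ⟨⟨hmeas.aestronglyMeasurable, ?_⟩, ?_⟩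
  · rw [hasFiniteIntegral_iff_ofReal (ae_of_all _ h0), hl']
    exact ENNReal.ofReal_lt_top
  · rw [integral_eq_lintegral_of_nonneg_ae (ae_of_all _ h0) hmeas.aestronglyMeasurable, hl',
      ENNReal.toReal_ofReal (Real.exp_nonneg _)]

end SLCP

/-! ### Fractional moments below one -/

lemma tendsto_rpow_sub_one_div {x : ℝ} (hx : 0 < x) :
    Tendsto (fun s : ℝ ↦ s⁻¹ * (x ^ s - 1)) (𝓝[>] 0) (𝓝 (Real.log x)) := by
  have h := ((Real.hasStrictDerivAt_const_rpow hx 0).hasDerivAt).tendsto_slope_zero_right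
  simpa using h

lemma log_one_add_nonneg {c : ℝ} (hc : 0 ≤ c) (z : ℝ) : 0 ≤ Real.log (1 + c * z ^ 2) :=
  Real.log_nonneg (le_add_of_nonneg_right (mul_nonneg hc (sq_nonneg z)))

lemma integrable_one_add_mul_sq {μ : Measure ℝ} [IsFiniteMeasure μ]
    (h : Integrable (fun z : ℝ ↦ z ^ 2) μ) (c : ℝ) : Integrable (fun z : ℝ ↦ 1 + c * z ^ 2) μ :=
  (integrable_const _).add (h.const_mul c)

lemma integrable_rpow_one_add_mul_sq {μ : Measure ℝ} [IsFiniteMeasure μ]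
    (h : Integrable (fun z : ℝ ↦ z ^ 2) μ) {c : ℝ} (hc : 0 ≤ c) {s : ℝ} (hs : s ≤ 1) :
    Integrable (fun z : ℝ ↦ (1 + c * z ^ 2) ^ s) μ := by
  refine (integrable_one_add_mul_sq h c).mono
    (by fun_prop : Measurable fun z : ℝ ↦ (1 + c * z ^ 2) ^ s).aestronglyMeasurable
    (Eventually.of_forall fun z ↦ ?_)
  have h1 : 1 ≤ 1 + c * z ^ 2 := le_add_of_nonneg_right (mul_nonneg hc (sq_nonneg z))
  rw [Real.norm_of_nonneg (Real.rpow_nonneg (by linarith) _), Real.norm_of_nonneg (by linarith)]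
  exact (Real.rpow_le_rpow_of_exponent_le h1 hs).trans_eq (Real.rpow_one _)

/-- The moments of order `s → 0` are governed by the logarithmic moment. -/
lemma tendsto_integral_rpow_sub_one {μ : Measure ℝ} [IsProbabilityMeasure μ]
    (h : Integrable (fun z : ℝ ↦ z ^ 2) μ) {c : ℝ} (hc : 0 ≤ c) :
    Tendsto (fun s : ℝ ↦ s⁻¹ * (∫ z, (1 + c * z ^ 2) ^ s ∂μ - 1)) (𝓝[>] 0)
      (𝓝 (∫ z, Real.log (1 + c * z ^ 2) ∂μ)) := by
  have hpos : ∀ z : ℝ, 1 ≤ 1 + c * z ^ 2 := fun z ↦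
    le_add_of_nonneg_right (mul_nonneg hc (sq_nonneg z))
  have h01 : ∀ᶠ s : ℝ in 𝓝[>] 0, 0 < s ∧ s ≤ 1 :=
    (eventually_mem_nhdsWithin).and ((eventually_le_nhds zero_lt_one).filter_mono nhdsWithin_le_nhds)
  have key : Tendsto (fun s : ℝ ↦ ∫ z, s⁻¹ * ((1 + c * z ^ 2) ^ s - 1) ∂μ) (𝓝[>] 0)
      (𝓝 (∫ z, Real.log (1 + c * z ^ 2) ∂μ)) := by
    refine tendsto_integral_filter_of_dominated_convergence (fun z ↦ c * z ^ 2) ?_ ?_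
      (h.const_mul c) (ae_of_all _ fun z ↦ tendsto_rpow_sub_one_div (by linarith [hpos z]))
    · exact Eventually.of_forall fun s ↦ (by fun_prop :
        Measurable fun z : ℝ ↦ s⁻¹ * ((1 + c * z ^ 2) ^ s - 1)).aestronglyMeasurable
    · filter_upwards [h01] with s ⟨hs0, hs1⟩
      refine ae_of_all _ fun z ↦ ?_
      have h1 : 1 ≤ (1 + c * z ^ 2) ^ s := Real.one_le_rpow (hpos z) hs0.le
      -- Bernoulli's inequality
      have h2 := rpow_one_add_le_one_add_mul_self (by linarith [hpos z] : -1 ≤ c * z ^ 2)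
        hs0.le hs1
      rw [Real.norm_of_nonneg (mul_nonneg (inv_nonneg.2 hs0.le) (by linarith)),
        inv_mul_le_iff₀ hs0]
      linarith
  refine key.congr' ?_
  filter_upwards [h01] with s ⟨_, hs1⟩
  rw [integral_const_mul, integral_sub (integrable_rpow_one_add_mul_sq h hc hs1)
    (integrable_const _)]
  simp

/-- If the logarithmic drift over one period is negative, then so is the exponent of some fractional
moment. -/
lemma SLCPData.exists_fractional_exponent (D : SLCPData) {c κ : ℝ} (hc : 0 ≤ c)
    (h : ∀ j, D.Λ D.τ * ∫ z, Real.log (1 + c * z ^ 2) ∂(D.F j) < κ) :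
    ∃ s : ℝ, 0 < s ∧ s ≤ 1 ∧
      ∑ j, D.cellMean j * (∫ z, (1 + c * z ^ 2) ^ s ∂(D.F j) - 1) < s * κ := by
  have hp := D.F_prob
  have : Nonempty (Fin D.d) := ⟨⟨0, D.d_pos⟩⟩
  obtain ⟨j₀, hj₀⟩ := Finite.exists_max fun j ↦ ∫ z, Real.log (1 + c * z ^ 2) ∂(D.F j)
  have h1 : ∑ j, D.cellMean j * ∫ z, Real.log (1 + c * z ^ 2) ∂(D.F j) < κ := by
    refine lt_of_le_of_lt (Finset.sum_le_sum fun j _ ↦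
      mul_le_mul_of_nonneg_left (hj₀ j) (D.cellMean_nonneg j)) ?_
    rw [← Finset.sum_mul, D.sum_cellMean]
    exact h j₀
  have h2 : Tendsto (fun s : ℝ ↦ ∑ j, D.cellMean j
      * (s⁻¹ * (∫ z, (1 + c * z ^ 2) ^ s ∂(D.F j) - 1))) (𝓝[>] 0)
      (𝓝 (∑ j, D.cellMean j * ∫ z, Real.log (1 + c * z ^ 2) ∂(D.F j))) :=
    tendsto_finsetSum _ fun j _ ↦ (tendsto_integral_rpow_sub_one (D.F_sq j) hc).const_mul _
  obtain ⟨s, hs, hs0, hs1⟩ := ((h2.eventually (gt_mem_nhds h1)).and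
    ((eventually_mem_nhdsWithin).and
      ((eventually_le_nhds zero_lt_one).filter_mono nhdsWithin_le_nhds))).exists
  refine ⟨s, hs0, hs1, ?_⟩
  have h3 : ∑ j, D.cellMean j * (s⁻¹ * (∫ z, (1 + c * z ^ 2) ^ s ∂(D.F j) - 1))
      = s⁻¹ * ∑ j, D.cellMean j * (∫ z, (1 + c * z ^ 2) ^ s ∂(D.F j) - 1) := by
    rw [Finset.mul_sum]
    exact Finset.sum_congr rfl fun j _ ↦ by ring
  rw [h3, inv_mul_lt_iff₀ hs0] at hs
  exact hs

/-! ### The flow over one period is a random contraction -/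

section Contraction

variable {k q : ℕ} (C : CogarchParams k q) {D : SLCPData} {Ω : Type*} [MeasurableSpace Ω]
  {P : Measure Ω} (X : SLCP D P)

lemma flow_shiftPath_zero (δ : ℝ) (T : ℝ≥0) (y : Fin q → ℝ) (x : ℝ≥0 → ℝ) :
    flow C δ T (y, shiftPath 0 x) = flow C δ T (y, x) := by
  simp only [flow, flowApprox, shiftPath, zero_add, sub_sub_sub_cancel_right]

/-- The flow up to time `T` depends only on the driving path up to time `T`. -/
lemma flow_stopPath (δ : ℝ) (T : ℝ≥0) (y : Fin q → ℝ) (x : ℝ≥0 → ℝ) :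
    flow C δ T (y, stopPath T x) = flow C δ T (y, x) := by
  rw [flow, flow]
  congr 1
  funext n
  refine eulerScheme_congr fun i hi ↦ ?_
  simp only [stopPath]
  rw [min_eq_left (mul_mesh_le hi), min_eq_left (mul_mesh_le hi.le)]

lemma SLCP.eulerLimit_flow (y : Fin q → ℝ) (T : ℝ≥0) (ω : Ω) :
    EulerLimit C.drift C.form C.α₀ C.e (fun t ↦ X.N t ω) (fun n ↦ X.Z n ω) 0 T y
      (flow C D.δ T (y, fun t ↦ X.S t ω)) := by
  obtain ⟨y₁, h⟩ := (X.isCountingPath ω).exists_eulerLimit C (fun n ↦ X.Z n ω) y T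
  have h1 := h.flow_eq C (X.isCountingPath ω) D.δ
  rw [flow_shiftPath_zero] at h1
  rw [X.S_eq_driftStep, h1]
  exact h

variable {C} {p : Seminorm ℝ (Fin q → ℝ)} {η c K : ℝ}

lemma SLCP.seminorm_flow_sub_le (hp : IsContractionNorm C.drift C.form C.e p η c K)
    (y y' : Fin q → ℝ) (T : ℝ≥0) (ω : Ω) :
    p (flow C D.δ T (y, fun t ↦ X.S t ω) - flow C D.δ T (y', fun t ↦ X.S t ω))
      ≤ Real.exp (η * T) * jumpProd c (fun n ↦ X.Z n ω) 0 (X.N T ω) * p (y - y') := by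
  have h := EulerLimit.seminorm_sub_le hp (X.isCountingPath ω).mono
    (X.eulerLimit_flow C y T ω) (X.eulerLimit_flow C y' T ω)
  simpa only [zero_add, X.poisson.zero] using h

lemma SLCP.seminorm_flow_le (hp : IsContractionNorm C.drift C.form C.e p η c K) (hη : η < 0)
    {c' : ℝ} (hc : c ≤ c') (hc' : |C.α₀| * p C.e ≤ c') (y : Fin q → ℝ) (T : ℝ≥0) (ω : Ω) :
    p (flow C D.δ T (y, fun t ↦ X.S t ω))
      ≤ Real.exp (η * T) * jumpProd c (fun n ↦ X.Z n ω) 0 (X.N T ω) * p y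
        + (jumpProd c' (fun n ↦ X.Z n ω) 0 (X.N T ω) - 1) := by
  have h := EulerLimit.seminorm_le hp hη (X.isCountingPath ω).mono hc hc'
    (X.eulerLimit_flow C y T ω)
  simpa only [zero_add, X.poisson.zero] using h

lemma SLCP.continuous_flow (hp : IsContractionNorm C.drift C.form C.e p η c K) (T : ℝ≥0) (ω : Ω) :
    Continuous fun y ↦ flow C D.δ T (y, fun t ↦ X.S t ω) := by
  obtain ⟨M, hM, h⟩ := hp.norm_le
  refine continuous_iff_continuousAt.2 fun y ↦ ?_
  rw [ContinuousAt, tendsto_iff_norm_sub_tendsto_zero]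
  have h1 : Tendsto (fun y' ↦ M * (Real.exp (η * T) * jumpProd c (fun n ↦ X.Z n ω) 0 (X.N T ω)
      * p (y' - y))) (𝓝 y) (𝓝 0) := by
    have h2 : Continuous fun y' ↦ M * (Real.exp (η * T)
        * jumpProd c (fun n ↦ X.Z n ω) 0 (X.N T ω) * p (y' - y)) :=
      ((hp.continuous.comp (continuous_id.sub continuous_const)).const_mul _).const_mul _
    simpa using h2.tendsto y
  exact squeeze_zero (fun _ ↦ norm_nonneg _) (fun y' ↦ (h _).trans
    (mul_le_mul_of_nonneg_left (X.seminorm_flow_sub_le hp _ _ _ _) hM.le)) h1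

/-- The flow over one period, driven by the sample path of the driving process. -/
def SLCP.periodFlow (C : CogarchParams k q) (X : SLCP D P) (T : ℝ≥0) (yω : (Fin q → ℝ) × Ω) :
    Fin q → ℝ :=
  flow C D.δ T (yω.1, fun t ↦ X.S t yω.2)

lemma SLCP.measurable_periodFlow (T : ℝ≥0) : Measurable (X.periodFlow C T) :=
  (measurable_flow C D.δ T).comp (measurable_fst.prodMk (X.measurable_S.comp measurable_snd))

/-- Over one period the flow is Lipschitz with the random constant
`H = exp (η τ) ∏ (1 + c Z_n²)`. The logarithmic moment condition gives `E log H < 0`, and then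
`E H ^ s < 1` for some small exponent `s > 0`. -/
theorem SLCP.isRandomContraction [IsProbabilityMeasure P]
    (hp : IsContractionNorm C.drift C.form C.e p η c K)
    (h_log : ∀ j, D.Λ D.τ * ∫ z, Real.log (1 + c * z ^ 2) ∂(D.F j) < -(η * D.τ)) :
    ∃ H B s, IsRandomContraction P p (X.periodFlow C D.τ) H B s := by
  have hF := D.F_prob
  have hc := hp.c_nonneg
  have hη : η < 0 := by
    have h1 := h_log ⟨0, D.d_pos⟩
    have h2 : 0 ≤ D.Λ D.τ * ∫ z, Real.log (1 + c * z ^ 2) ∂(D.F ⟨0, D.d_pos⟩) :=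
      mul_nonneg (by rw [← D.Λ_zero]; exact D.Λ_mono zero_le)
        (integral_nonneg fun z ↦ log_one_add_nonneg hc z)
    have h3 : 0 < (D.τ : ℝ) := NNReal.coe_pos.2 D.τ_pos
    nlinarith
  obtain ⟨s, hs0, hs1, hs⟩ := D.exists_fractional_exponent hc h_log
  -- `c'` dominates both the Lipschitz constant of a unit jump and the size of a jump from `0`, as
  -- the bound on the inhomogeneous part of the flow requires.
  set c' := max c (|C.α₀| * p C.e) with hc'
  have hc'0 : 0 ≤ c' := hc.trans (le_max_left _ _)
  have hJ : ∀ {a : ℝ}, 0 ≤ a → ∀ ω, 1 ≤ jumpProd a (fun n ↦ X.Z n ω) 0 (X.N D.τ ω) :=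
    fun ha ω ↦ one_le_jumpProd ha _ _ _
  have hpow : ∀ ω, (Real.exp (η * D.τ) * jumpProd c (fun n ↦ X.Z n ω) 0 (X.N D.τ ω)) ^ s
      = Real.exp (s * (η * D.τ))
        * ∏ n ∈ Finset.Ioc 0 (X.N D.τ ω), (fun z : ℝ ↦ (1 + c * z ^ 2) ^ s) (X.Z n ω) := by
    intro ω
    rw [Real.mul_rpow (Real.exp_nonneg _) (zero_le_one.trans (hJ hc ω)), ← Real.exp_mul, mul_comm s,
      jumpProd, Real.finsetProd_rpow _ _ fun n _ ↦
        add_nonneg zero_le_one (mul_nonneg hc (sq_nonneg _))]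
  obtain ⟨hint, heq⟩ := X.integral_prod_Z (g := fun z : ℝ ↦ (1 + c * z ^ 2) ^ s) (by fun_prop)
    (fun z ↦ Real.rpow_nonneg (add_nonneg zero_le_one (mul_nonneg hc (sq_nonneg _))) _)
    fun j ↦ integrable_rpow_one_add_mul_sq (D.F_sq j) hc hs1
  obtain ⟨hint', -⟩ := X.integral_prod_Z (g := fun z : ℝ ↦ 1 + c' * z ^ 2) (by fun_prop)
    (fun z ↦ add_nonneg zero_le_one (mul_nonneg hc'0 (sq_nonneg _)))
    fun j ↦ integrable_one_add_mul_sq (D.F_sq j) c'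
  have hmeas : Measurable fun ω ↦ jumpProd c' (fun n ↦ X.Z n ω) 0 (X.N D.τ ω) := by
    have h1 := (D.measurable_periodProd (g := fun z : ℝ ↦ 1 + c' * z ^ 2) (by fun_prop)).comp
      (X.measurable_N.prodMk X.measurable_ξ)
    refine (congrArg Measurable (funext fun ω ↦ ?_)).mpr h1
    exact X.prod_Z_eq_periodProd (fun z : ℝ ↦ 1 + c' * z ^ 2) ω
  refine ⟨fun ω ↦ Real.exp (η * D.τ) * jumpProd c (fun n ↦ X.Z n ω) 0 (X.N D.τ ω),
    fun ω ↦ jumpProd c' (fun n ↦ X.Z n ω) 0 (X.N D.τ ω) - 1, s,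
    { measurable := X.measurable_periodFlow _
      norm_le := hp.norm_le
      le_norm := hp.le_norm
      s_pos := hs0
      s_le_one := hs1
      H_nonneg := fun ω ↦ mul_nonneg (Real.exp_nonneg _) (zero_le_one.trans (hJ hc ω))
      B_nonneg := fun ω ↦ sub_nonneg.2 (hJ hc'0 ω)
      sub_le := fun ω y y' ↦ X.seminorm_flow_sub_le hp y y' _ ω
      le := fun ω y ↦ X.seminorm_flow_le hp hη (le_max_left _ _) (le_max_right _ _) y _ ω
      H_integrable := ?_
      B_integrable := ?_
      H_lt := ?_ }⟩
  · simp only [hpow]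
    exact hint.const_mul _
  · refine hint'.mono ((hmeas.sub_const 1).pow_const s).aestronglyMeasurable
      (Eventually.of_forall fun ω ↦ ?_)
    have h1 := hJ hc'0 ω
    rw [Real.norm_of_nonneg (Real.rpow_nonneg (sub_nonneg.2 h1) _)]
    refine le_trans ?_ (le_abs_self _)
    calc (jumpProd c' (fun n ↦ X.Z n ω) 0 (X.N D.τ ω) - 1) ^ s
        ≤ jumpProd c' (fun n ↦ X.Z n ω) 0 (X.N D.τ ω) ^ s :=
          Real.rpow_le_rpow (sub_nonneg.2 h1) (by linarith) hs0.le
      _ ≤ jumpProd c' (fun n ↦ X.Z n ω) 0 (X.N D.τ ω) ^ (1 : ℝ) :=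
          Real.rpow_le_rpow_of_exponent_le h1 hs1
      _ = _ := Real.rpow_one _
  · simp only [hpow]
    rw [integral_const_mul, heq, ← Real.exp_add, Real.exp_lt_one_iff]
    linarith

/-- Weak convergence of initial laws is preserved by the flow. -/
lemma tendsto_evolve {E : Type*} [TopologicalSpace E] [MeasurableSpace E] [BorelSpace E]
    [SecondCountableTopology E] [FirstCountableTopology E] [HasOuterApproxClosed E]
    [IsProbabilityMeasure P] {Φ : E × Ω → E}
    (hΦ : Measurable Φ) (hc : ∀ ω, Continuous fun y ↦ Φ (y, ω)) {μ : ℕ → ProbabilityMeasure E}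
    {U : ProbabilityMeasure E} (h : Tendsto μ atTop (𝓝 U)) {μ' : ℕ → ProbabilityMeasure E}
    {U' : ProbabilityMeasure E} (hμ : ∀ m, (μ' m : Measure E) = ((μ m : Measure E).prod P).map Φ)
    (hU : (U' : Measure E) = ((U : Measure E).prod P).map Φ) : Tendsto μ' atTop (𝓝 U') := by
  rw [ProbabilityMeasure.tendsto_iff_forall_integral_tendsto] at h ⊢
  intro f
  have hfm : Measurable f := f.continuous.measurable
  have hint : ∀ ν : ProbabilityMeasure E, ∫ x, f x ∂(((ν : Measure E).prod P).map Φ)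
      = ∫ y, ∫ ω, f (Φ (y, ω)) ∂P ∂(ν : Measure E) := by
    intro ν
    rw [integral_map hΦ.aemeasurable hfm.aestronglyMeasurable, integral_prod]
    exact Integrable.of_bound (hfm.comp hΦ).aestronglyMeasurable ‖f‖
      (ae_of_all _ fun x ↦ f.norm_coe_le_norm _)
  have hcont : Continuous fun y ↦ ∫ ω, f (Φ (y, ω)) ∂P :=
    continuous_of_dominated (bound := fun _ ↦ ‖f‖)
      (fun y ↦ (hfm.comp (hΦ.comp measurable_prodMk_left)).aestronglyMeasurable)
      (fun y ↦ ae_of_all _ fun ω ↦ f.norm_coe_le_norm _) (integrable_const _)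
      (ae_of_all _ fun ω ↦ f.continuous.comp (hc ω))
  have key := h (BoundedContinuousFunction.ofNormedAddCommGroup _ hcont ‖f‖ fun y ↦ by
    refine (norm_integral_le_of_norm_le_const (ae_of_all _ fun ω ↦ f.norm_coe_le_norm _)).trans ?_
    simp)
  simp only [hμ, hU, hint]
  exact key

end Contraction

/-! ### Processes that follow the flow -/

section FlowProcess

variable {k q : ℕ} (C : CogarchParams k q) {D : SLCPData} {Ω : Type*} [MeasurableSpace Ω]
  {P : Measure Ω} (X : SLCP D P)

/-- `Y` follows the flow driven by `W`, a copy of the driving process which is independent of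
`Y_0`. Unlike the property of being a state process, this notion is invariant under the passage from
`(Y, W)` to `(Y_{τ+·}, W_{τ+·} - W_τ)`. -/
structure IsFlowProcess (Y : ℝ≥0 → Ω → Fin q → ℝ) (W : Ω → ℝ≥0 → ℝ) : Prop where
  measurable : ∀ t, Measurable (Y t)
  measurable_path : Measurable W
  law_path : P.map W = X.pathLaw
  indep : IndepFun (Y 0) W P
  flow_ae : ∀ a T, ∀ᵐ ω ∂P, Y (a + T) ω = flow C D.δ T (Y a ω, shiftPath a (W ω))

variable {C X}

lemma IsStateProcess.isFlowProcess {Y : ℝ≥0 → Ω → Fin q → ℝ} (hY : IsStateProcess C X Y) :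
    IsFlowProcess C X Y fun ω t ↦ X.S t ω where
  measurable := hY.measurable
  measurable_path := X.measurable_S
  law_path := rfl
  indep := hY.indep
  flow_ae a T := by
    filter_upwards [hY.cadlag, hY.equation] with ω hω heq
    have hν := X.isCountingPath ω
    exact ((hν.eulerLimit_of_sub hω a T fun t ht ↦
      hν.equation_sub (z := fun n ↦ X.Z n ω) (δ := D.δ) hω heq ht).flow_eq C hν D.δ).symm

lemma shiftPath_shiftPath (a b : ℝ≥0) (x : ℝ≥0 → ℝ) :
    shiftPath a (shiftPath b x) = shiftPath (b + a) x := by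
  funext t
  simp only [shiftPath, add_assoc]
  ring

namespace IsFlowProcess

variable {Y : ℝ≥0 → Ω → Fin q → ℝ} {W : Ω → ℝ≥0 → ℝ}

lemma ae_eq_flow (h : IsFlowProcess C X Y W) (t : ℝ≥0) :
    ∀ᵐ ω ∂P, Y t ω = flow C D.δ t (Y 0 ω, W ω) := by
  filter_upwards [h.flow_ae 0 t] with ω hω
  rwa [zero_add, flow_shiftPath_zero] at hω

variable [IsProbabilityMeasure P]

lemma map_pair (h : IsFlowProcess C X Y W) :
    P.map (fun ω ↦ (Y 0 ω, W ω)) = (P.map (Y 0)).prod X.pathLaw := by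
  rw [(indepFun_iff_map_prod_eq_prod_map_map (h.measurable 0).aemeasurable
    h.measurable_path.aemeasurable).1 h.indep, h.law_path]

lemma map_eq (h : IsFlowProcess C X Y W) (t : ℝ≥0) :
    P.map (Y t) = ((P.map (Y 0)).prod X.pathLaw).map (flow C D.δ t) := by
  rw [← h.map_pair, Measure.map_map (measurable_flow C D.δ t)
    ((h.measurable 0).prodMk h.measurable_path)]
  exact Measure.map_congr (h.ae_eq_flow t)

lemma shift (h : IsFlowProcess C X Y W) :
    IsFlowProcess C X (fun t ↦ Y (D.τ + t)) fun ω ↦ shiftPath D.τ (W ω) where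
  measurable t := h.measurable _
  measurable_path := (measurable_shiftPath _).comp h.measurable_path
  law_path := by
    rw [← X.map_shiftPath_pathLaw, ← h.law_path,
      Measure.map_map (measurable_shiftPath _) h.measurable_path]
    rfl
  indep := by
    have hst : Measurable fun ω ↦ stopPath D.τ (W ω) :=
      (measurable_stopPath _).comp h.measurable_path
    have hsh : Measurable fun ω ↦ shiftPath D.τ (W ω) :=
      (measurable_shiftPath _).comp h.measurable_path
    have h1 : IndepFun (fun ω ↦ stopPath D.τ (W ω)) (fun ω ↦ shiftPath D.τ (W ω)) P := by
      rw [indepFun_iff_measure_inter_preimage_eq_mul]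
      intro A B hA hB
      have h2 := X.indepFun_stopPath_shiftPath.measure_inter_preimage_eq_mul _ _ hA hB
      rw [← h.law_path, Measure.map_apply h.measurable_path
        ((measurable_stopPath _ hA).inter (measurable_shiftPath _ hB)),
        Measure.map_apply h.measurable_path (measurable_stopPath _ hA),
        Measure.map_apply h.measurable_path (measurable_shiftPath _ hB)] at h2
      exact h2
    have h3 : IndepFun (Y 0) (fun ω ↦ (stopPath D.τ (W ω), shiftPath D.τ (W ω))) P :=
      h.indep.comp measurable_id ((measurable_stopPath D.τ).prodMk (measurable_shiftPath D.τ))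
    have h4 := (IndepFun.prodMk_left (h.measurable 0) hst hsh h3 h1).comp
      (measurable_flow C D.δ D.τ) measurable_id
    refine h4.congr ?_ EventuallyEq.rfl
    filter_upwards [h.ae_eq_flow D.τ] with ω hω
    simp only [Function.comp_apply, add_zero]
    rw [flow_stopPath, hω]
  flow_ae a T := by
    filter_upwards [h.flow_ae (D.τ + a) T] with ω hω
    rw [shiftPath_shiftPath, ← hω, add_assoc]

lemma evolve_eq (μ : Measure (Fin q → ℝ)) [SFinite μ] (t : ℝ≥0) :
    evolve P (X.periodFlow C t) μ = (μ.prod X.pathLaw).map (flow C D.δ t) := by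
  have h1 : μ.prod X.pathLaw = (μ.prod P).map (Prod.map id fun ω t ↦ X.S t ω) := by
    rw [SLCP.pathLaw, ← Measure.map_prod_map _ _ measurable_id X.measurable_S, Measure.map_id]
  rw [h1, Measure.map_map (measurable_flow C D.δ t) (measurable_id.prodMap X.measurable_S)]
  rfl

/-- The driving process after a period is independent of the state at that time, so the laws of the
state at multiples of the period are the iterates of the random flow over one period. -/
lemma map_add_period (h : IsFlowProcess C X Y W) (t : ℝ≥0) (m : ℕ) :
    P.map (Y (t + m * D.τ))
      = evolve P (X.periodFlow C t) ((evolve P (X.periodFlow C D.τ))^[m] (P.map (Y 0))) := by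
  have hprob : ∀ {Y' : Ω → Fin q → ℝ}, Measurable Y' → IsProbabilityMeasure (P.map Y') :=
    fun hm ↦ Measure.isProbabilityMeasure_map hm.aemeasurable
  induction m generalizing Y W with
  | zero =>
    have := hprob (h.measurable 0)
    rw [Function.iterate_zero, id, evolve_eq, ← h.map_eq, Nat.cast_zero, zero_mul, add_zero]
  | succ m ih =>
    have := hprob (h.measurable 0)
    have h1 := ih h.shift
    rw [Function.iterate_succ_apply, evolve_eq (P.map (Y 0)), ← h.map_eq]
    simp only [add_zero] at h1
    rw [← h1, show t + (m + 1 : ℕ) * D.τ = D.τ + (t + m * D.τ) by push_cast; ring]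

/-- If the law of `Y_0` is invariant, then shifting by a period does not change the joint law of the
initial value and of the driving process. -/
lemma identDistrib_shift (h : IsFlowProcess C X Y W)
    (hinv : evolve P (X.periodFlow C D.τ) (P.map (Y 0)) = P.map (Y 0)) :
    IdentDistrib (fun ω ↦ (Y 0 ω, W ω)) (fun ω ↦ (Y D.τ ω, shiftPath D.τ (W ω))) P P where
  aemeasurable_fst := ((h.measurable 0).prodMk h.measurable_path).aemeasurable
  aemeasurable_snd :=
    ((h.measurable _).prodMk ((measurable_shiftPath _).comp h.measurable_path)).aemeasurable
  map_eq := by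
    have := Measure.isProbabilityMeasure_map (μ := P) (h.measurable 0).aemeasurable
    have h1 := h.shift.map_pair
    simp only [add_zero] at h1
    rw [h1, h.map_pair, h.map_eq D.τ, ← evolve_eq, hinv]

lemma strictlyPeriodic (h : IsFlowProcess C X Y W)
    (hinv : evolve P (X.periodFlow C D.τ) (P.map (Y 0)) = P.map (Y 0)) :
    StrictlyPeriodic P D.τ Y := by
  intro n t
  have hΓ : Measurable fun (yx : (Fin q → ℝ) × (ℝ≥0 → ℝ)) (i : Fin n) ↦ flow C D.δ (t i) yx :=
    measurable_pi_lambda _ fun i ↦ measurable_flow C D.δ (t i)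
  have h1 := (h.identDistrib_shift hinv).comp hΓ
  have e1 : ∀ᵐ ω ∂P, (fun i ↦ Y (t i) ω) = fun i ↦ flow C D.δ (t i) (Y 0 ω, W ω) := by
    filter_upwards [ae_all_iff.2 fun i ↦ h.ae_eq_flow (t i)] with ω hω
    exact funext hω
  have e2 : ∀ᵐ ω ∂P, (fun i ↦ Y (t i + D.τ) ω)
      = fun i ↦ flow C D.δ (t i) (Y D.τ ω, shiftPath D.τ (W ω)) := by
    filter_upwards [ae_all_iff.2 fun i ↦ h.flow_ae D.τ (t i)] with ω hω
    exact funext fun i ↦ by rw [add_comm, hω i]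
  exact ((IdentDistrib.of_ae_eq (measurable_pi_lambda _ fun i ↦ h.measurable _).aemeasurable e1).trans
    h1).trans (IdentDistrib.of_ae_eq
      (measurable_pi_lambda _ fun i ↦ h.measurable _).aemeasurable e2).symm

end IsFlowProcess

end FlowProcess

/-! ### The volatility at a fixed time -/

/-- A solution of the state equation is continuous at times without jumps. -/
lemma IsCountingPath.leftLim_eq {ν : ℝ≥0 → ℕ} (hν : IsCountingPath ν) {k q : ℕ}
    {C : CogarchParams k q} {y : ℝ≥0 → Fin q → ℝ} {δ : ℝ} {z : ℕ → ℝ} (hy : IsCadlag y)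
    (heq : ∀ t : ℝ≥0, y t = y 0
      + (∫ u in (0 : ℝ)..t, C.B.mulVec (Function.leftLim y u.toNNReal))
      + lsIntegral (C.vol y) (quadVar (driftStep ν δ z)) 0 t • C.e) {v t : ℝ≥0} (hv : v < t)
    (hc : ν v = ν t) : Function.leftLim y t = y t := by
  set μ := jumpMeasure ν (fun n ↦ z n ^ 2) (ν t) with hμ
  obtain ⟨K, hK⟩ := hy.exists_bound t
  have : (𝓝[<] t).NeBot := nhdsLT_neBot_of_exists_lt ⟨v, hv⟩
  have h1 : ∀ u, v ≤ u → u ≤ t → ‖y t - y u‖ ≤ ‖C.drift‖ * K * (t - u) := by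
    intro u hvu hut
    have h2 : μ (Ioc u t) = 0 := by
      rw [← measureReal_eq_zero_iff, hν.jumpMeasure_sq_real_Ioc le_rfl,
        le_antisymm (hν.mono hut) (hc ▸ hν.mono hvu)]
      simp
    have h3 : y t - y u = ∫ w in Ioc u t, C.drift (Function.leftLim y w) ∂lebNN := by
      rw [← sub_sub_sub_cancel_right _ _ (y 0), hν.equation_sub hy heq le_rfl,
        hν.equation_sub hy heq hut, setIntegral_Ioc_split (hy.integrableOn_drift C _) hut le_rfl,
        setIntegral_Ioc_split (hy.integrableOn_vol C _ _) hut le_rfl,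
        Measure.restrict_eq_zero.2 h2, integral_zero_measure]
      module
    rw [h3, ← lebNN_real_Ioc hut]
    refine norm_setIntegral_le_of_norm_le_const (by rw [lebNN_Ioc]; exact ENNReal.ofReal_lt_top)
      fun w hw ↦ (C.drift.le_opNorm _).trans ?_
    exact mul_le_mul_of_nonneg_left (hy.norm_leftLim_le hK hw.2) (norm_nonneg _)
  have h4 : Tendsto (fun u : ℝ≥0 ↦ ‖C.drift‖ * K * ((t : ℝ) - u)) (𝓝[<] t) (𝓝 0) := by
    have h5 : Continuous fun u : ℝ≥0 ↦ ‖C.drift‖ * K * ((t : ℝ) - u) := by fun_prop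
    simpa using (h5.tendsto t).mono_left nhdsWithin_le_nhds
  refine tendsto_nhds_unique (hy.tendsto_leftLim t) ?_
  rw [tendsto_iff_norm_sub_tendsto_zero]
  refine squeeze_zero' (Eventually.of_forall fun _ ↦ norm_nonneg _) ?_ h4
  filter_upwards [Ico_mem_nhdsLT hv] with u hu
  rw [norm_sub_rev]
  exact h1 u hu.1 hu.2.le

section

variable {k q : ℕ} {C : CogarchParams k q} {D : SLCPData} {Ω : Type*} [MeasurableSpace Ω]
  {P : Measure Ω} {X : SLCP D P}

lemma SLCP.measure_jump_le (X : SLCP D P) [IsProbabilityMeasure P] {s t : ℝ≥0} (hst : s ≤ t) :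
    P {ω | X.N s ω ≠ X.N t ω} ≤ ENNReal.ofReal ((∑ j, (D.lam j : ℝ)) * (t - s)) := by
  have hm : Measurable fun ω ↦ X.N t ω - X.N s ω :=
    (X.poisson.measurable _).sub (X.poisson.measurable _)
  have h1 : {ω | X.N s ω ≠ X.N t ω} = (fun ω ↦ X.N t ω - X.N s ω) ⁻¹' {0}ᶜ := by
    ext ω
    have : X.N s ω ≤ X.N t ω := X.poisson.mono ω hst
    simp only [mem_preimage, mem_compl_iff, mem_singleton_iff]
    change ¬ _ ↔ ¬ _
    omega
  rw [h1, ← Measure.map_apply hm (measurableSet_singleton 0).compl, X.poisson.law s t hst,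
    prob_compl_eq_one_sub (measurableSet_singleton 0), poissonMeasure_singleton,
    tsub_le_iff_right]
  have h2 := D.Λ_sub_le hst
  have h3 : 0 ≤ D.Λ t - D.Λ s := sub_nonneg.2 (D.Λ_mono hst)
  rw [Real.coe_toNNReal _ h3]
  simp only [pow_zero, mul_one, Nat.factorial_zero, Nat.cast_one, div_one]
  rw [← ENNReal.ofReal_add (h3.trans h2) (Real.exp_nonneg _), ← ENNReal.ofReal_one]
  refine ENNReal.ofReal_le_ofReal ?_
  linarith [Real.add_one_le_exp (-(D.Λ t - D.Λ s))]

/-- Almost surely, there is no jump at a fixed time. -/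
lemma SLCP.ae_exists_eq (X : SLCP D P) [IsProbabilityMeasure P] {t : ℝ≥0} (ht : 0 < t) :
    ∀ᵐ ω ∂P, ∃ v < t, X.N v ω = X.N t ω := by
  have : (𝓝[<] t).NeBot := nhdsLT_neBot_of_exists_lt ⟨0, ht⟩
  have h4 : Tendsto (fun u : ℝ≥0 ↦ ENNReal.ofReal ((∑ j, (D.lam j : ℝ)) * ((t : ℝ) - u))) (𝓝[<] t)
      (𝓝 0) := by
    have h5 : Continuous fun u : ℝ≥0 ↦ ENNReal.ofReal ((∑ j, (D.lam j : ℝ)) * ((t : ℝ) - u)) :=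
      ENNReal.continuous_ofReal.comp (by fun_prop)
    simpa using (h5.tendsto t).mono_left nhdsWithin_le_nhds
  refine le_antisymm (ge_of_tendsto (f := fun u : ℝ≥0 ↦
    ENNReal.ofReal ((∑ j, (D.lam j : ℝ)) * ((t : ℝ) - u))) h4 ?_) zero_le
  filter_upwards [self_mem_nhdsWithin] with u hu
  have h6 : {ω | ¬ ∃ v < t, X.N v ω = X.N t ω} ⊆ {ω | X.N u ω ≠ X.N t ω} :=
    fun ω hω hu' ↦ hω ⟨u, hu, hu'⟩
  exact (measure_mono h6).trans (X.measure_jump_le (le_of_lt hu))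

lemma IsStateProcess.ae_vol_eq [IsProbabilityMeasure P] {Y : ℝ≥0 → Ω → Fin q → ℝ}
    (hY : IsStateProcess C X Y) (t : ℝ≥0) : V C Y t =ᵐ[P] fun ω ↦ C.α₀ + C.form (Y t ω) := by
  rcases eq_zero_or_pos t with rfl | ht
  · refine Eventually.of_forall fun ω ↦ ?_
    simp only [V, CogarchParams.vol]
    rw [leftLim_zero, C.form_apply]
  · filter_upwards [hY.cadlag, hY.equation, X.ae_exists_eq ht] with ω hω heq ⟨v, hv, hc⟩
    have h := (X.isCountingPath ω).leftLim_eq (z := fun n ↦ X.Z n ω) (δ := D.δ) hω heq hv hc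
    simp only [V, CogarchParams.vol]
    rw [h, C.form_apply]

lemma IsStateProcess.strictlyPeriodic_vol [IsProbabilityMeasure P] {Y : ℝ≥0 → Ω → Fin q → ℝ}
    (hY : IsStateProcess C X Y) (h : StrictlyPeriodic P D.τ Y) :
    StrictlyPeriodic P D.τ (V C Y) := by
  intro n t
  have hΓ : Measurable fun (y : Fin n → Fin q → ℝ) (i : Fin n) ↦ C.α₀ + C.form (y i) :=
    measurable_pi_lambda _ fun i ↦
      (C.form.continuous.measurable.comp (measurable_pi_apply i)).const_add _
  have e : ∀ t : Fin n → ℝ≥0, IdentDistrib (fun ω i ↦ V C Y (t i) ω)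
      (fun ω i ↦ C.α₀ + C.form (Y (t i) ω)) P P := fun t ↦
    (IdentDistrib.of_ae_eq (hΓ.comp (measurable_pi_lambda _ fun i ↦
      hY.measurable (t i))).aemeasurable (by
        filter_upwards [ae_all_iff.2 fun i ↦ hY.ae_vol_eq (t i)] with ω hω
        exact funext fun i ↦ (hω i).symm)).symm
  exact ((e t).trans ((h n t).comp hΓ)).trans (e fun i ↦ t i + D.τ).symm

/-! ### The price increments as functionals of the driving process -/

variable (C) in
/-- The price increment over `(t, t + l]`, as a functional of the initial state and of the path of
the driving process (with drift `δ`): the limit of Riemann sums, when it exists. -/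
def priceIncrement (δ : ℝ) (l t : ℝ≥0) (yx : (Fin q → ℝ) × (ℝ≥0 → ℝ)) : ℝ :=
  limUnder atTop fun n ↦ ∑ i ∈ Finset.range (n + 1),
    √(C.α₀ + C.form (flow C δ (t + i * mesh l n) yx))
      * (yx.2 (t + (i + 1 : ℕ) * mesh l n) - yx.2 (t + i * mesh l n))

lemma measurable_priceIncrement (δ : ℝ) (l t : ℝ≥0) : Measurable (priceIncrement C δ l t) := by
  refine (StronglyMeasurable.limUnder fun n ↦ Measurable.stronglyMeasurable ?_).measurable
  have h : ∀ t : ℝ≥0, Measurable fun yx : (Fin q → ℝ) × (ℝ≥0 → ℝ) ↦ yx.2 t := fun t ↦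
    (measurable_pi_apply t).comp measurable_snd
  exact Finset.measurable_sum _ fun i _ ↦
    ((C.form.continuous.measurable.comp (measurable_flow C δ _)).const_add _).sqrt.mul
      ((h _).sub (h _))

lemma IsStateProcess.ae_eq_priceIncrement {Y : ℝ≥0 → Ω → Fin q → ℝ}
    (hY : IsStateProcess C X Y) (l a t : ℝ≥0) : G C X Y l (a + t) =ᵐ[P]
      fun ω ↦ priceIncrement C D.δ l t (Y a ω, shiftPath a fun u ↦ X.S u ω) := by
  have hflow : ∀ᵐ ω ∂P, ∀ n i : ℕ, Y (a + (t + i * mesh l n)) ω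
      = flow C D.δ (t + i * mesh l n) (Y a ω, shiftPath a fun u ↦ X.S u ω) :=
    ae_all_iff.2 fun n ↦ ae_all_iff.2 fun i ↦ hY.isFlowProcess.flow_ae a _
  filter_upwards [hflow, hY.cadlag] with ω hω hc
  have h := (X.isCountingPath ω).tendsto_price (C := C) (δ := D.δ) (z := fun n ↦ X.Z n ω) hc
    (a + t) l
  refine (Tendsto.limUnder_eq (h.congr fun n ↦ ?_)).symm
  refine Finset.sum_congr rfl fun i _ ↦ ?_
  rw [← hω n i]
  simp only [shiftPath, sub_sub_sub_cancel_right, ← add_assoc]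
  rfl

/-- The joint laws of the price increments are periodic. -/
lemma IsStateProcess.identDistrib_price [IsProbabilityMeasure P] {Y : ℝ≥0 → Ω → Fin q → ℝ}
    (hY : IsStateProcess C X Y)
    (hinv : evolve P (X.periodFlow C D.τ) (P.map (Y 0)) = P.map (Y 0)) (l t t' : ℝ≥0) :
    IdentDistrib (fun ω ↦ (G C X Y l t ω, G C X Y l t' ω))
      (fun ω ↦ (G C X Y l (t + D.τ) ω, G C X Y l (t' + D.τ) ω)) P P := by
  have h1 := hY.isFlowProcess.identDistrib_shift hinv
  have hΓ : Measurable fun yx : (Fin q → ℝ) × (ℝ≥0 → ℝ) ↦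
      (priceIncrement C D.δ l t yx, priceIncrement C D.δ l t' yx) :=
    (measurable_priceIncrement _ _ _).prodMk (measurable_priceIncrement _ _ _)
  have h2 := h1.comp hΓ
  have h0 : ∀ ω, (shiftPath 0 fun u ↦ X.S u ω) = fun u ↦ X.S u ω := fun ω ↦ by
    funext u
    simp [shiftPath, X.S_zero]
  refine ((IdentDistrib.of_ae_eq h2.aemeasurable_fst ?_).symm.trans h2).trans
    (IdentDistrib.of_ae_eq h2.aemeasurable_snd ?_)
  · filter_upwards [hY.ae_eq_priceIncrement l 0 t, hY.ae_eq_priceIncrement l 0 t'] with ω e1 e2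
    rw [zero_add, h0] at e1 e2
    rw [e1, e2]
    rfl
  · filter_upwards [hY.ae_eq_priceIncrement l D.τ t, hY.ae_eq_priceIncrement l D.τ t'] with ω e1 e2
    rw [add_comm] at e1 e2
    rw [e1, e2]
    rfl

lemma flow_zero (C : CogarchParams k q) (δ : ℝ) (yx : (Fin q → ℝ) × (ℝ≥0 → ℝ)) :
    flow C δ 0 yx = yx.1 := by
  have hm : ∀ n, mesh 0 n = 0 := fun n ↦ by simp [mesh]
  have h : ∀ n i, eulerScheme C.drift C.form C.α₀ C.e (mesh 0 n) (fun i ↦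
      (yx.2 ((i + 1 : ℕ) * mesh 0 n) - yx.2 (i * mesh 0 n) - δ * mesh 0 n) ^ 2) yx.1 i = yx.1 := by
    intro n i
    induction i with
    | zero => rfl
    | succ i ih => simp only [eulerScheme, ih]; simp [hm]
  exact Tendsto.limUnder_eq (tendsto_const_nhds.congr fun n ↦ (h n (n + 1)).symm)

end

end SLDCogarch

end

open SLDCogarch in
theorem corollary3p3 {Ω : Type*} [MeasurableSpace Ω] {P : Measure Ω} [IsProbabilityMeasure P]
    {p q : ℕ} (D : SLCPData) (X : SLCP D P) (C : CogarchParams p q)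
    -- (i) the eigenvalues of `B` are distinct and have negative real parts
    (h_distinct : (spectrum ℂ C.Bc).ncard = q)
    (h_neg : ∀ μ ∈ spectrum ℂ C.Bc, μ.re < 0)
    -- (ii) the logarithmic moment condition, for some diagonalizing `Q` and some `r ∈ [1, ∞]`
    (Q : Matrix (Fin q) (Fin q) ℂ) (hQ : IsUnit Q.det) (h_diag : (Q⁻¹ * C.Bc * Q).IsDiag)
    (r : ℝ≥0∞) (hr : 1 ≤ r)
    (h_log : ∀ t ≤ D.τ, ∀ j,
      (D.Λ (t + D.τ) - D.Λ t) * ∫ z, Real.log (1 + lrNorm r (Q⁻¹ * C.ea * Q) * z ^ 2) ∂(D.F j)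
        < -(C.η * D.τ)) :
    -- the laws `U t` of the limits in distribution of `Y_{t+mτ}`, whatever the initial value
    ∃ U : ℝ≥0 → ProbabilityMeasure (Fin q → ℝ),
      (∀ Y, IsStateProcess C X Y → ∀ t < D.τ,
        TendstoInDistribution (fun (m : ℕ) => Y (t + m * D.τ)) atTop id (fun _ => P)
          (U t : Measure (Fin q → ℝ))) ∧
      ∀ Y, IsStateProcess C X Y →
        (∀ t < D.τ, P.map (Y t) = (U t : Measure (Fin q → ℝ))) →
        -- (a)
        (StrictlyPeriodic P D.τ Y ∧ StrictlyPeriodic P D.τ (V C Y)) ∧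
        -- (b)
        ((∀ᵐ ω ∂P, ∀ u, 0 ≤ V C Y u ω) →
          ∀ l : ℝ≥0, 0 < l → ∀ t h : ℝ≥0,
            ((Integrable (G C X Y l t) P ↔ Integrable (G C X Y l (t + D.τ)) P) ∧
              P[G C X Y l t] = P[G C X Y l (t + D.τ)]) ∧
            ((Integrable (fun ω => G C X Y l t ω * G C X Y l (t + h) ω) P ↔
                Integrable (fun ω => G C X Y l (t + D.τ) ω * G C X Y l (t + h + D.τ) ω) P) ∧
              cov[G C X Y l t, G C X Y l (t + h); P]
                = cov[G C X Y l (t + D.τ), G C X Y l (t + h + D.τ); P])) := by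
  have : Fact (1 ≤ r) := ⟨hr⟩
  obtain ⟨K, hp⟩ := C.isContractionNorm Q hQ h_diag r
  obtain ⟨H, B, s, hΦ⟩ := X.isRandomContraction hp fun j ↦ by
    simpa [D.Λ_zero] using h_log 0 zero_le j
  obtain ⟨U₀, hU₀, hconv⟩ := hΦ.exists_invariant
  have hprob : ∀ t, IsProbabilityMeasure (evolve P (X.periodFlow C t) (U₀ : Measure _)) := fun t ↦
    Measure.isProbabilityMeasure_map (X.measurable_periodFlow t).aemeasurable
  obtain ⟨U, hU⟩ : ∃ U : ℝ≥0 → ProbabilityMeasure (Fin q → ℝ),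
      ∀ t, (U t : Measure (Fin q → ℝ)) = evolve P (X.periodFlow C t) U₀ :=
    ⟨fun t ↦ ⟨_, hprob t⟩, fun _ ↦ rfl⟩
  refine ⟨U, fun Y hY t _ ↦ ?_, fun Y hY hlaw ↦ ?_⟩
  · have hY0 := Measure.isProbabilityMeasure_map (μ := P) (hY.measurable 0).aemeasurable
    have h1 := hconv (P.map (Y 0))
    refine ⟨fun m ↦ (hY.measurable _).aemeasurable, aemeasurable_id, ?_⟩
    refine tendsto_evolve (P := P) (X.measurable_periodFlow (C := C) t)
      (fun ω ↦ X.continuous_flow hp t ω) h1 (fun m ↦ ?_) ?_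
    · exact hY.isFlowProcess.map_add_period t m
    · rw [ProbabilityMeasure.coe_mk, Measure.map_id, hU, evolve]
  · have h0 : P.map (Y 0) = (U₀ : Measure (Fin q → ℝ)) := by
      rw [hlaw 0 D.τ_pos, hU, evolve]
      have h1 : X.periodFlow C 0 = Prod.fst := funext fun yω ↦ flow_zero C D.δ _
      rw [h1, Measure.map_fst_prod, measure_univ, one_smul]
    have hinv : evolve P (X.periodFlow C D.τ) (P.map (Y 0)) = P.map (Y 0) := by rw [h0, hU₀]
    have hper := hY.isFlowProcess.strictlyPeriodic hinv
    refine ⟨⟨hper, hY.strictlyPeriodic_vol hper⟩, fun _ l _ t h ↦ ?_⟩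
    have hG := hY.identDistrib_price hinv l t (t + h)
    have h1 := hG.comp measurable_fst
    have h2 := hG.comp measurable_snd
    have e1 : P[G C X Y l t] = P[G C X Y l (t + D.τ)] := h1.integral_eq
    have e2 : P[G C X Y l (t + h)] = P[G C X Y l (t + h + D.τ)] := h2.integral_eq
    refine ⟨⟨h1.integrable_iff, e1⟩,
      (hG.comp (measurable_fst.mul measurable_snd)).integrable_iff, ?_⟩
    rw [covariance, covariance, ← e1, ← e2]
    exact (hG.comp ((measurable_fst.sub_const _).mul (measurable_snd.sub_const _))).integral_eq
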